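/- **Setting.** Fix $n\ge 0$, $T>0$ and real constants $\lambda,c,C_0$ with $\lambda>cT(1+T)$. A *density* is a probability measure $m$ on $\mathbb R^n$ that is absolutely continuous with respect to Lebesgue measure and satisfies $\int|\xi|^2\,m(\xi)d\xi<\infty$; $W_2$ is the quadratic Wasserstein distance. A function $G$ is *the functional derivative at $m$* of a functional $\Phi$ of densities, written $G=\frac{\partial \Phi(m)}{\partial m}$, if $G\in L^1(m)$ and for every sequence of densities $m_k$ with $W_2(m_k,m)\to0$ one has $G\in L^1(m_k)$ for all $k$ and $$\Phi(m_k)-\Phi(m)-\int G\,(m_k-m)\,dx=o(W_2(m_k,m)).$$ (Such a $G$ is only determined up to an additive constant; every choice that satisfies the assumptions below is allowed.) **Data and assumptions.** Let $f(x,m),h(x,m)$ be real functions of $x\in\mathbb R^n$ and of a density $m$, with $f(\cdot,m),h(\cdot,m)\in L^1(m)$. Let $F(\cdot,m)$ and $F_T(\cdot,m)$ be the functional derivatives at $m$ of $m\mapsto\int f(x,m)m(x)dx$ and $m\mapsto\int h(x,m)m(x)dx$; suppose that $F(x,\cdot)$ and $F_T(x,\cdot)$ have functional derivatives $\frac{\partial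 F(x,m)}{\partial m}(\xi)$, $\frac{\partial F_T(x,m)}{\partial m}(\xi)$, that $F,F_T$ are differentiable in $x$, and that for all points $x,x_1,x_2,\xi$ and densities $m,m_1,m_2$, with $\Psi$ standing for each of $F$ and $F_T$, * $|D_x\Psi(x_1,m_1)-D_x\Psi(x_2,m_2)|\le\frac c2\left(|x_1-x_2|+W_2(m_1,m_2)\right)$; * $|D_x\Psi(x,m)|\le\frac c2\left(1+|x|+\left(\int|\xi|^2m(\xi)d\xi\right)^{1/2}\right)$; * $|\Psi(x,m)|\le C_0\left(1+|x|^2+\int|\xi|^2m(\xi)d\xi\right)$; * $\left|\frac{\partial \Psi(x,m)}{\partial m}(\xi)\right|\le C_0\left(1+|x|^2+|\xi|^2+\int|\eta|^2m(\eta)d\eta\right)$; * $D_xD_\xi\frac{\partial F(x,m)}{\partial m}(\xi)$ exists and is bounded in operator norm by $C_0$; * $\int(\Psi(x,m_1)-\Psi(x,m_2))(m_1(x)-m_2(x))dx\ge0$. **Value function.** For $t\in[0,T]$ and a density $m$, let $$V(m,t)=\inf_{v}\Big\{\tfrac\lambda2\int_t^T\!\!\int|v(x,s)|^2m_v(x,s)dxds+\int_t^T\!\!\int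 f(x,m_v(s))m_v(x,s)dxds+\int h(x,m_v(T))m_v(x,T)dx\Big\},$$ the infimum being over Borel feedbacks $v(x,s)$ together with a (jointly measurable) state process $x(s)$ solving $\frac{dx}{ds}=v(x(s),s)$ on $[t,T]$, with $x(t)$ distributed according to $m$, such that the law $m_v(s)$ of $x(s)$ is a density for every $s\in[t,T]$ and the control energy $\int_t^T\!\int|v|^2m_v\,dx\,ds$ is finite. **Claim.** There is a constant $C$, depending only on $n,\lambda,T,c,C_0$, such that for all data as above, all $t\in[0,T]$ and all densities $m$ the following hold. The infimum $V(m,t)$ is over a non-empty set and is finite. There is a unique $y=y_{mt}$ which is a solution, in $C([t,T];L^2(m))$ and continuous in $s\in[t,T]$ for every $x\in\mathbb R^n$, with all image measures $m(s):=y(\cdot,s)_\#m$ ($s\in[t,T]$) densities, of $$y(x,s)=x-\tfrac{s-t}\lambda D_xF_T(y(x,T),m(T))-\tfrac1\lambda\int_t^T(\min(s,\sigma)-t)\,D_xF(y(x,\sigma),m(\sigma))\,d\sigma,\qquad x\in\mathbb R^n,\ s\in[t,T].$$ With this curve $m(s)$, the HJB--FP system on $[t,T]$ $$-\partial_su+\tfrac1{2\lambda}|Du|^2=F(x,m(s)),\quad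 u(x,T)=F_T(x,m(T)),\qquad \partial_sm-\tfrac1\lambda\operatorname{div}(Du\,m)=0,\quad m(t)=m$$ has a solution $(u_{mt},m(\cdot))$ (classical for $u$, weak for $m$) with $$u_{mt}(x,t)=\tfrac1{2\lambda}\int_t^T|z(x,s)|^2ds+\int_t^TF(y(x,s),m(s))ds+F_T(y(x,T),m(T)),$$ $$z(x,s)=D_xF_T(y(x,T),m(T))+\int_s^TD_xF(y(x,\sigma),m(\sigma))d\sigma .$$ The functional derivative of $V(\cdot,t)$ at $m$ exists and is $U(x,m,t)=\frac{\partial V(m,t)}{\partial m}(x)=u_{mt}(x,t)$. It satisfies $$|U(x,m,t)|\le C\Big(1+|x|^2+\int|\xi|^2m(\xi)d\xi\Big)\quad\text{for all }x\in\mathbb R^n,$$ and, for all densities $m_2$, $$\Big|V(m_2,t)-V(m,t)-\int u_{mt}(x,t)\,(m_2(x)-m(x))\,dx\Big|\le C\,W_2(m,m_2)^2 .$$ -/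

import Mathlib

open MeasureTheory Filter Topology Asymptotics
open scoped ENNReal ContDiff

noncomputable section

namespace MeanField

/-- The state space `ℝⁿ` with its Euclidean norm. -/
abbrev Rn (n : ℕ) : Type := EuclideanSpace ℝ (Fin n)

variable {n : ℕ}

/-- `m` is (the law with) a probability density on `ℝⁿ` with finite second moment. -/
structure IsDensity (m : Measure (Rn n)) : Prop where
  prob : IsProbabilityMeasure m
  ac : m ≪ volume
  moment : Integrable (fun x => ‖x‖ ^ 2) m

/-- The second moment `∫ |ξ|² m(ξ) dξ`. -/
def moment2 (m : Measure (Rn n)) : ℝ := ∫ x, ‖x‖ ^ 2 ∂m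

/-- The couplings of `μ` and `ν`. -/
def couplings (μ ν : Measure (Rn n)) : Set (Measure (Rn n × Rn n)) :=
  {γ | γ.map Prod.fst = μ ∧ γ.map Prod.snd = ν}

/-- The quadratic Wasserstein distance,
`W₂(μ, ν)² = inf_γ ∫ |ξ - η|² γ(dξ, dη)` over the couplings `γ` of `μ` and `ν`. -/
def W2 (μ ν : Measure (Rn n)) : ℝ :=
  Real.sqrt (⨅ γ ∈ couplings μ ν, ∫⁻ p, ‖p.1 - p.2‖ₑ ^ 2 ∂γ).toReal

/-- `G` is the functional derivative at the density `m` of the functional `Φ`: it is in `L¹(m)`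
and, for every sequence of densities `μ k` with `W₂(μ k, m) → 0`, it is in every `L¹(μ k)` and
`Φ (μ k) - Φ m - ∫ G (μ k - m) = o(W₂(μ k, m))`. -/
def HasFunctionalDeriv (Φ : Measure (Rn n) → ℝ) (m : Measure (Rn n)) (G : Rn n → ℝ) : Prop :=
  Integrable G m ∧
    ∀ μ : ℕ → Measure (Rn n), (∀ k, IsDensity (μ k)) →
      Tendsto (fun k => W2 (μ k) m) atTop (𝓝 0) →
      (∀ k, Integrable G (μ k)) ∧
        (fun k => Φ (μ k) - Φ m - (∫ x, G x ∂(μ k) - ∫ x, G x ∂m))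
          =o[atTop] (fun k => W2 (μ k) m)

/-- The `x`-gradient `D_x F(x, m)`. -/
def Dx (F : Rn n → Measure (Rn n) → ℝ) (x : Rn n) (m : Measure (Rn n)) : Rn n :=
  gradient (fun y => F y m) x

/-- The hypotheses on the costs `f` (running) and `h` (final). Here `F`, `FT` are the functional
derivatives of `m ↦ ∫ f(x, m) m(x) dx` and `m ↦ ∫ h(x, m) m(x) dx`, and `dF`, `dFT` are the
functional derivatives of `F(x, ·)` and `FT(x, ·)`: `dF x m ξ` stands for `∂F(x, m)/∂m (ξ)`.
Only the values of these functions at densities matter. -/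
structure Assumptions (c C₀ : ℝ) (f h F FT : Rn n → Measure (Rn n) → ℝ)
    (dF dFT : Rn n → Measure (Rn n) → Rn n → ℝ) : Prop where
  f_integrable : ∀ m, IsDensity m → Integrable (fun x => f x m) m
  h_integrable : ∀ m, IsDensity m → Integrable (fun x => h x m) m
  F_deriv : ∀ m, IsDensity m →
    HasFunctionalDeriv (fun μ => ∫ x, f x μ ∂μ) m (fun x => F x m)
  FT_deriv : ∀ m, IsDensity m →
    HasFunctionalDeriv (fun μ => ∫ x, h x μ ∂μ) m (fun x => FT x m)
  dF_deriv : ∀ m, IsDensity m → ∀ x, HasFunctionalDeriv (fun μ => F x μ) m (dF x m)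
  dFT_deriv : ∀ m, IsDensity m → ∀ x, HasFunctionalDeriv (fun μ => FT x μ) m (dFT x m)
  F_diff : ∀ m, IsDensity m → Differentiable ℝ (fun x => F x m)
  FT_diff : ∀ m, IsDensity m → Differentiable ℝ (fun x => FT x m)
  DxF_lipschitz : ∀ m₁ m₂, IsDensity m₁ → IsDensity m₂ → ∀ x₁ x₂,
    ‖Dx F x₁ m₁ - Dx F x₂ m₂‖ ≤ c / 2 * (‖x₁ - x₂‖ + W2 m₁ m₂)
  DxFT_lipschitz : ∀ m₁ m₂, IsDensity m₁ → IsDensity m₂ → ∀ x₁ x₂,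
    ‖Dx FT x₁ m₁ - Dx FT x₂ m₂‖ ≤ c / 2 * (‖x₁ - x₂‖ + W2 m₁ m₂)
  DxF_growth : ∀ m, IsDensity m → ∀ x,
    ‖Dx F x m‖ ≤ c / 2 * (1 + ‖x‖ + Real.sqrt (moment2 m))
  DxFT_growth : ∀ m, IsDensity m → ∀ x,
    ‖Dx FT x m‖ ≤ c / 2 * (1 + ‖x‖ + Real.sqrt (moment2 m))
  F_growth : ∀ m, IsDensity m → ∀ x, |F x m| ≤ C₀ * (1 + ‖x‖ ^ 2 + moment2 m)
  FT_growth : ∀ m, IsDensity m → ∀ x, |FT x m| ≤ C₀ * (1 + ‖x‖ ^ 2 + moment2 m)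
  dF_growth : ∀ m, IsDensity m → ∀ x ξ,
    |dF x m ξ| ≤ C₀ * (1 + ‖x‖ ^ 2 + ‖ξ‖ ^ 2 + moment2 m)
  dFT_growth : ∀ m, IsDensity m → ∀ x ξ,
    |dFT x m ξ| ≤ C₀ * (1 + ‖x‖ ^ 2 + ‖ξ‖ ^ 2 + moment2 m)
  dF_diff : ∀ m, IsDensity m → ∀ x, Differentiable ℝ (dF x m)
  dF_diff' : ∀ m, IsDensity m → ∀ ξ, Differentiable ℝ (fun x => gradient (dF x m) ξ)
  dF_mixed : ∀ m, IsDensity m → ∀ x ξ, ‖fderiv ℝ (fun y => gradient (dF y m) ξ) x‖ ≤ C₀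
  F_monotone : ∀ m₁ m₂, IsDensity m₁ → IsDensity m₂ →
    0 ≤ (∫ x, (F x m₁ - F x m₂) ∂m₁) - ∫ x, (F x m₁ - F x m₂) ∂m₂
  FT_monotone : ∀ m₁ m₂, IsDensity m₁ → IsDensity m₂ →
    0 ≤ (∫ x, (FT x m₁ - FT x m₂) ∂m₁) - ∫ x, (FT x m₁ - FT x m₂) ∂m₂

/-- The image measure of `m` by the map `y(·, s)`. -/
def law (m : Measure (Rn n)) (y : Rn n → ℝ → Rn n) (s : ℝ) : Measure (Rn n) :=
  m.map (fun x => y x s)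

/-! ### The mean field type control problem -/

/-- `v` is a feedback and `x` a corresponding state on `[t, T]`: `dx/ds = v(x(s), s)`, with
`x(t) = ξ` distributed according to `m` (`x ξ s` is the state at time `s` started at `ξ`),
the control has finite energy and the law of the state has a density at all times. -/
structure IsAdmissible (T t : ℝ) (m : Measure (Rn n))
    (v : Rn n → ℝ → Rn n) (x : Rn n → ℝ → Rn n) : Prop where
  measurable_feedback : Measurable (Function.uncurry v)
  measurable_state : Measurable (Function.uncurry x)
  energy : Integrable (fun p : Rn n × ℝ => ‖v (x p.1 p.2) p.2‖ ^ 2)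
    (m.prod (volume.restrict (Set.Icc t T)))
  ode : ∀ᵐ ξ ∂m, ∀ s ∈ Set.Icc t T, x ξ s = ξ + ∫ σ in t..s, v (x ξ σ) σ
  density : ∀ s ∈ Set.Icc t T, IsDensity (law m x s)

/-- The cost of the feedback `v` with state `x`, where `μ s` is the law of the state:
`(λ/2) ∫ₜᵀ ∫ |v|² dμ(s) ds + ∫ₜᵀ ∫ f(x, μ(s)) dμ(s) ds + ∫ h(x, μ(T)) dμ(T)`. -/
def cost (lam T : ℝ) (f h : Rn n → Measure (Rn n) → ℝ) (t : ℝ) (m : Measure (Rn n))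
    (v : Rn n → ℝ → Rn n) (x : Rn n → ℝ → Rn n) : ℝ :=
  lam / 2 * (∫ s in t..T, ∫ ξ, ‖v ξ s‖ ^ 2 ∂(law m x s))
    + (∫ s in t..T, ∫ ξ, f ξ (law m x s) ∂(law m x s))
    + ∫ ξ, h ξ (law m x T) ∂(law m x T)

/-- The set of all costs that can be achieved from the initial density `m` at time `t`. -/
def costs (lam T : ℝ) (f h : Rn n → Measure (Rn n) → ℝ) (t : ℝ) (m : Measure (Rn n)) : Set ℝ :=
  {r | ∃ v x, IsAdmissible T t m v x ∧ r = cost lam T f h t m v x}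

/-- The value function `V(m, t)`. -/
def V (lam T : ℝ) (f h : Rn n → Measure (Rn n) → ℝ) (m : Measure (Rn n)) (t : ℝ) : ℝ :=
  sInf (costs lam T f h t m)

/-! ### The HJB-FP system -/

/-- `y = y_{mt}` solves, in `C([t, T]; L²(m))` and for every initial point `x`, the equation
`y(s) = x - (s-t)/λ D_xF_T(y(T), y(T)(m)) - (1/λ) ∫ₜᵀ (min(s,σ)-t) D_xF(y(σ), y(σ)(m)) dσ`,
where `y(s)(m)` is the image of `m` by `y(·, s)`. -/
structure IsFlow (lam T : ℝ) (F FT : Rn n → Measure (Rn n) → ℝ) (t : ℝ) (m : Measure (Rn n))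
    (y : Rn n → ℝ → Rn n) : Prop where
  continuous_time : ∀ x, ContinuousOn (y x) (Set.Icc t T)
  memLp : ∀ s ∈ Set.Icc t T, MemLp (fun x => y x s) 2 m
  continuous_L2 : ∀ s ∈ Set.Icc t T,
    Tendsto (fun σ => eLpNorm (fun x => y x σ - y x s) 2 m) (𝓝[Set.Icc t T] s) (𝓝 0)
  density : ∀ s ∈ Set.Icc t T, IsDensity (law m y s)
  eqn : ∀ x, ∀ s ∈ Set.Icc t T,
    y x s = x - ((s - t) / lam) • Dx FT (y x T) (law m y T)
      - (1 / lam) • ∫ σ in t..T, (min s σ - t) • Dx F (y x σ) (law m y σ)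

/-- The adjoint state `z_{mt}(x, s) = D_xF_T(y(T), y(T)(m)) + ∫ₛᵀ D_xF(y(σ), y(σ)(m)) dσ`. -/
def adjoint (T : ℝ) (F FT : Rn n → Measure (Rn n) → ℝ) (m : Measure (Rn n))
    (y : Rn n → ℝ → Rn n) (x : Rn n) (s : ℝ) : Rn n :=
  Dx FT (y x T) (law m y T) + ∫ σ in s..T, Dx F (y x σ) (law m y σ)

/-- The explicit formula for `u_{mt}(x, t)` in terms of the flow `y = y_{mt}`. -/
def uFormula (lam T : ℝ) (F FT : Rn n → Measure (Rn n) → ℝ) (t : ℝ) (m : Measure (Rn n))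
    (y : Rn n → ℝ → Rn n) (x : Rn n) : ℝ :=
  1 / (2 * lam) * (∫ s in t..T, ‖adjoint T F FT m y x s‖ ^ 2)
    + (∫ s in t..T, F (y x s) (law m y s))
    + FT (y x T) (law m y T)

/-- The pair `u(x, s)`, `μ(s)` solves on `[t, T]` the system
`-∂u/∂s + |Du|²/(2λ) = F(x, μ(s))`, `u(x, T) = F_T(x, μ(T))` (in the classical sense) and
`∂μ/∂s - (1/λ) div(Du μ) = 0`, `μ(t) = m` (in the weak sense, against test functions). -/
structure IsHJBFPSolution (lam T : ℝ) (F FT : Rn n → Measure (Rn n) → ℝ) (t : ℝ)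
    (m : Measure (Rn n)) (u : Rn n → ℝ → ℝ) (μ : ℝ → Measure (Rn n)) : Prop where
  differentiable : ∀ s ∈ Set.Icc t T, Differentiable ℝ (fun x => u x s)
  continuous_gradient : ContinuousOn
    (fun p : Rn n × ℝ => gradient (fun x => u x p.2) p.1) (Set.univ ×ˢ Set.Icc t T)
  hjb : ∀ x, ∀ s ∈ Set.Icc t T, HasDerivWithinAt (u x)
    (1 / (2 * lam) * ‖gradient (fun y => u y s) x‖ ^ 2 - F x (μ s)) (Set.Icc t T) s
  final : ∀ x, u x T = FT x (μ T)
  density : ∀ s ∈ Set.Icc t T, IsDensity (μ s)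
  fp : ∀ φ : Rn n → ℝ, ContDiff ℝ ∞ φ → HasCompactSupport φ → ∀ s ∈ Set.Icc t T,
    HasDerivWithinAt (fun σ => ∫ x, φ x ∂(μ σ))
      (-(1 / lam) * ∫ x, inner ℝ (gradient φ x) (gradient (fun y => u y s) x) ∂(μ s))
      (Set.Icc t T) s
  initial : μ t = m

end MeanField

end

/-!
The argument works with random variables instead of laws. A density is the law of a random vector
on a probability space that carries a coupling, and a functional `Φ` of densities with functional
derivative `Ψ` is differentiated along displacements of that random vector, with gradient `D_x Ψ`.

**Displacement expansion** (`IsPotential.abs_displacement_le`). For random vectors `X`, `Y` whose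
laws are densities, `Φ(law Y) - Φ(law X) = E⟨D_x Ψ(X, law X), Y - X⟩ + R` with
`|R| ≤ (c/2) E|Y - X|²`. On a segment of laws that are all densities this follows from the chain
rule and the Lipschitz bound on `D_x Ψ`. The interpolated laws may fail to be absolutely continuous,
so an independent noise is added to both ends and then sent to zero.

**The flow** (`exists_isRegular_flow`, `IsFlow.unique`, `IsFlow.W2_law_le`). The right-hand side of
the flow equation is a contraction for a norm with a weight that is linear in `|x|`, because
`cT(1+T)/λ < 1`: half of this rate comes from the position and half from the law. The Picard
iterates keep the displacement `y(·, s) - id` Lipschitz with a constant below one, hence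
`y(·, s)` expands distances by a factor and transports densities to densities. The same estimate
gives uniqueness, growth, and stability in the initial law.

**Optimality** (`RegularFlow.abs_action_sub_le`, `RegularFlow.action_le`). Let `z` be the adjoint
state, so that `-z/λ` is the velocity of the flow and `∂_s z = -D_x F`. For a random path `X` with
velocity `a`, integration by parts turns the kinetic energy of `X` into the one of the flow plus
`(λ/2) E∫|a + z/λ|²` minus the linear terms of the displacement expansions of the two costs, plus
`E⟨z(t), X(t) - y(t)⟩`. The remaining errors are quadratic in `X - y`. If `X` starts where the flow
starts, `λ > cT(1+T)` makes `(λ/2) E∫|a + z/λ|²` dominate them, so the flow is optimal and the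
value function is its cost.

**Differentiability** (`RegularFlow.abs_flowAction_sub_le`,
`RegularFlow.abs_flowAction_sub_sub_le`). Applied to the flows from the two marginals of a coupling,
the same expansion shows that the values differ by `E⟨z(t), Y₂ - Y₁⟩` up to a multiple of
`E|Y₂ - Y₁|²`. On the other hand `u(x, s)`, the cost from time `s` of the path of the flow
through `x`, satisfies `|u(x', s) - u(x, s) - ⟨z, x' - x⟩| ≤ K|x' - x|²`
(`RegularFlow.abs_valueFn_sub_le`), by the same computation for a single path in the frozen
environment of the laws. Hence `Du = z`, the increment of the value is `∫ u d(m₂ - m)` up to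
`C W₂²`, and differentiating `u` along the flow gives the Hamilton–Jacobi–Bellman equation
(`RegularFlow.isHJBFPSolution`).
-/

namespace MeanField

variable {n : ℕ}

/-! ### Couplings and the Wasserstein distance -/

lemma W2_nonneg (μ ν : Measure (Rn n)) : 0 ≤ W2 μ ν := Real.sqrt_nonneg _

lemma W2_sq (μ ν : Measure (Rn n)) :
    W2 μ ν ^ 2 = (⨅ γ ∈ couplings μ ν, ∫⁻ p, ‖p.1 - p.2‖ₑ ^ 2 ∂γ).toReal :=
  Real.sq_sqrt ENNReal.toReal_nonneg

lemma ofReal_integral_norm_sq {Ω : Type*} [MeasurableSpace Ω] {P : Measure Ω} {Z : Ω → Rn n}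
    (h : Integrable (fun q => ‖Z q‖ ^ 2) P) :
    ENNReal.ofReal (∫ q, ‖Z q‖ ^ 2 ∂P) = ∫⁻ q, ‖Z q‖ₑ ^ 2 ∂P := by
  rw [ofReal_integral_eq_lintegral_ofReal h (ae_of_all _ fun q => by positivity)]
  refine lintegral_congr fun q => ?_
  rw [ENNReal.ofReal_pow (norm_nonneg _), ofReal_norm]

lemma W2_comm (μ ν : Measure (Rn n)) : W2 μ ν = W2 ν μ := by
  have key : ∀ μ ν : Measure (Rn n), (⨅ γ ∈ couplings μ ν, ∫⁻ p, ‖p.1 - p.2‖ₑ ^ 2 ∂γ) ≤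
      ⨅ γ ∈ couplings ν μ, ∫⁻ p, ‖p.1 - p.2‖ₑ ^ 2 ∂γ := by
    intro μ ν
    refine le_iInf₂ fun γ hγ => ?_
    have hmem : γ.map Prod.swap ∈ couplings μ ν := by
      constructor
      · rw [Measure.map_map measurable_fst measurable_swap]; exact hγ.2
      · rw [Measure.map_map measurable_snd measurable_swap]; exact hγ.1
    refine (iInf₂_le _ hmem).trans (le_of_eq ?_)
    · rw [lintegral_map (by fun_prop) measurable_swap]
      refine lintegral_congr fun p => ?_
      simp only [Prod.fst_swap, Prod.snd_swap]
      rw [← enorm_neg, neg_sub]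
  unfold W2
  rw [le_antisymm (key μ ν) (key ν μ)]

/-- Any two random variables on a common space bound the Wasserstein distance of their laws. -/
lemma W2_map_le {Ω : Type*} [MeasurableSpace Ω] {P : Measure Ω} {X Y : Ω → Rn n}
    (hX : AEMeasurable X P) (hY : AEMeasurable Y P)
    (h : Integrable (fun q => ‖X q - Y q‖ ^ 2) P) :
    W2 (P.map X) (P.map Y) ≤ √(∫ q, ‖X q - Y q‖ ^ 2 ∂P) := by
  refine Real.sqrt_le_sqrt ?_
  refine ENNReal.toReal_le_of_le_ofReal (integral_nonneg fun _ => by positivity) ?_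
  have hmem : P.map (fun q => (X q, Y q)) ∈ couplings (P.map X) (P.map Y) := by
    constructor
    · rw [AEMeasurable.map_map_of_aemeasurable (by fun_prop) (hX.prodMk hY)]; rfl
    · rw [AEMeasurable.map_map_of_aemeasurable (by fun_prop) (hX.prodMk hY)]; rfl
  refine (iInf₂_le _ hmem).trans (le_of_eq ?_)
  · rw [lintegral_map' (by fun_prop) (hX.prodMk hY), ofReal_integral_norm_sq h]

lemma W2_map_le_of_bound {Ω : Type*} [MeasurableSpace Ω] {P : Measure Ω} [IsProbabilityMeasure P]
    {X Y : Ω → Rn n} (hX : AEMeasurable X P) (hY : AEMeasurable Y P) {D : ℝ}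
    (h : ∀ q, ‖X q - Y q‖ ≤ D) : W2 (P.map X) (P.map Y) ≤ D := by
  obtain ⟨q₀⟩ : Nonempty Ω := nonempty_of_isProbabilityMeasure P
  have hD : 0 ≤ D := (norm_nonneg _).trans (h q₀)
  have hint : Integrable (fun q => ‖X q - Y q‖ ^ 2) P := by
    refine Integrable.of_bound (C := D ^ 2)
      ((hX.sub hY).aestronglyMeasurable.norm.pow 2) (ae_of_all _ fun q => ?_)
    rw [Real.norm_of_nonneg (by positivity)]
    exact pow_le_pow_left₀ (norm_nonneg _) (h q) 2
  refine (W2_map_le hX hY hint).trans (Real.sqrt_le_iff.2 ⟨hD, ?_⟩)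
  calc ∫ q, ‖X q - Y q‖ ^ 2 ∂P ≤ ∫ q, D ^ 2 ∂P :=
        integral_mono hint (integrable_const _) fun q => pow_le_pow_left₀ (norm_nonneg _) (h q) 2
    _ = D ^ 2 := by simp

lemma integrable_norm_sub_sq {Ω : Type*} [MeasurableSpace Ω] {P : Measure Ω} {X Y : Ω → Rn n}
    (hX : AEStronglyMeasurable X P) (hY : AEStronglyMeasurable Y P)
    (hX2 : Integrable (fun q => ‖X q‖ ^ 2) P) (hY2 : Integrable (fun q => ‖Y q‖ ^ 2) P) :
    Integrable (fun q => ‖X q - Y q‖ ^ 2) P :=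
  (((memLp_two_iff_integrable_sq_norm hX).2 hX2).sub
    ((memLp_two_iff_integrable_sq_norm hY).2 hY2)).integrable_norm_pow (by norm_num)

lemma isProbabilityMeasure_of_coupling {μ ν : Measure (Rn n)} (hμ : IsDensity μ)
    {γ : Measure (Rn n × Rn n)} (hγ : γ ∈ couplings μ ν) : IsProbabilityMeasure γ := by
  have := hμ.prob
  rw [← hγ.1] at this
  exact (Measure.isProbabilityMeasure_map_iff measurable_fst.aemeasurable).1 this

lemma integrable_fst_sq_of_coupling {μ ν : Measure (Rn n)} (hμ : IsDensity μ)
    {γ : Measure (Rn n × Rn n)} (hγ : γ ∈ couplings μ ν) :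
    Integrable (fun p => ‖p.1‖ ^ 2) γ := by
  have := hμ.moment
  rw [← hγ.1] at this
  exact this.comp_measurable measurable_fst

lemma integrable_snd_sq_of_coupling {μ ν : Measure (Rn n)} (hν : IsDensity ν)
    {γ : Measure (Rn n × Rn n)} (hγ : γ ∈ couplings μ ν) :
    Integrable (fun p => ‖p.2‖ ^ 2) γ := by
  have := hν.moment
  rw [← hγ.2] at this
  exact this.comp_measurable measurable_snd

lemma integrable_sub_sq_of_coupling {μ ν : Measure (Rn n)} (hμ : IsDensity μ) (hν : IsDensity ν)
    {γ : Measure (Rn n × Rn n)} (hγ : γ ∈ couplings μ ν) :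
    Integrable (fun p => ‖p.1 - p.2‖ ^ 2) γ :=
  integrable_norm_sub_sq measurable_fst.aestronglyMeasurable measurable_snd.aestronglyMeasurable
    (integrable_fst_sq_of_coupling hμ hγ) (integrable_snd_sq_of_coupling hν hγ)

lemma exists_coupling_lt {μ ν : Measure (Rn n)} (hμ : IsDensity μ) (hν : IsDensity ν) {ε : ℝ}
    (hε : 0 < ε) : ∃ γ ∈ couplings μ ν, ∫ p, ‖p.1 - p.2‖ ^ 2 ∂γ < W2 μ ν ^ 2 + ε := by
  have := hμ.prob
  have := hν.prob
  have hprod : μ.prod ν ∈ couplings μ ν := by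
    constructor
    · exact Measure.map_fst_prod.trans (by simp)
    · exact Measure.map_snd_prod.trans (by simp)
  have hfin : (⨅ γ ∈ couplings μ ν, ∫⁻ p, ‖p.1 - p.2‖ₑ ^ 2 ∂γ) ≠ ⊤ := by
    refine ne_top_of_le_ne_top ?_ (iInf₂_le _ hprod)
    rw [← ofReal_integral_norm_sq (integrable_sub_sq_of_coupling hμ hν hprod)]
    exact ENNReal.ofReal_ne_top
  have hlt : (⨅ γ ∈ couplings μ ν, ∫⁻ p, ‖p.1 - p.2‖ₑ ^ 2 ∂γ) <
      ENNReal.ofReal (W2 μ ν ^ 2 + ε) := by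
    rw [W2_sq, ← ENNReal.ofReal_toReal hfin]
    refine (ENNReal.ofReal_lt_ofReal_iff ?_).2 ?_
    · rw [ENNReal.ofReal_toReal hfin]; positivity
    · rw [ENNReal.ofReal_toReal hfin]; linarith
  obtain ⟨γ, hγ⟩ := iInf_lt_iff.1 hlt
  obtain ⟨hmem, hγ⟩ := iInf_lt_iff.1 hγ
  refine ⟨γ, hmem, ?_⟩
  rw [← ofReal_integral_norm_sq (integrable_sub_sq_of_coupling hμ hν hmem)] at hγ
  exact (ENNReal.ofReal_lt_ofReal_iff (by positivity)).1 hγ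

/-- A quantity bounded by the transport cost of every coupling is bounded by `W₂²`. -/
lemma le_mul_W2_sq {μ ν : Measure (Rn n)} (hμ : IsDensity μ) (hν : IsDensity ν) {a C : ℝ}
    (hC : 0 ≤ C) (h : ∀ γ ∈ couplings μ ν, a ≤ C * ∫ p, ‖p.1 - p.2‖ ^ 2 ∂γ) :
    a ≤ C * W2 μ ν ^ 2 := by
  refine le_of_forall_pos_le_add fun ε hε => ?_
  obtain ⟨γ, hγ, hlt⟩ := exists_coupling_lt hμ hν (show 0 < ε / (C + 1) by positivity)
  refine (h γ hγ).trans ((mul_le_mul_of_nonneg_left hlt.le hC).trans ?_)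
  have : C * (ε / (C + 1)) ≤ ε := by
    rw [mul_div_assoc', div_le_iff₀ (by positivity)]; nlinarith
  linarith

/-- A map that expands distances at least by a fixed positive factor has Lebesgue-null preimages
of null sets. -/
lemma absolutelyContinuous_map_of_antilipschitz {m : Measure (Rn n)} (hm : m ≪ volume)
    {f : Rn n → Rn n} (hf : Measurable f) {K : NNReal} (hK : AntilipschitzWith K f) :
    m.map f ≪ volume := by
  refine Measure.AbsolutelyContinuous.mk fun s hs h0 => ?_
  rw [Measure.map_apply hf hs]
  refine hm ?_
  set H : Measure (Rn n) := μH[Module.finrank ℝ (Rn n)]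
  have h1 : H ≪ volume := Measure.absolutelyContinuous_isAddHaarMeasure _ _
  have h2 : (volume : Measure (Rn n)) ≪ H := Measure.absolutelyContinuous_isAddHaarMeasure _ _
  refine h2 (le_antisymm ?_ bot_le)
  refine (hK.hausdorffMeasure_preimage_le (by positivity) s).trans ?_
  rw [show μH[_] s = 0 from h1 h0, mul_zero]

lemma IsDensity.of_map {Ω : Type*} [MeasurableSpace Ω] {P : Measure Ω} [IsProbabilityMeasure P]
    {X : Ω → Rn n} (hX : AEMeasurable X P) (hac : P.map X ≪ volume)
    (h2 : Integrable (fun q => ‖X q‖ ^ 2) P) : IsDensity (P.map X) where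
  prob := Measure.isProbabilityMeasure_map hX
  ac := hac
  moment := (integrable_map_measure (by fun_prop) hX).2 h2

lemma IsDensity.integrable_sq {Ω : Type*} [MeasurableSpace Ω] {P : Measure Ω}
    {X : Ω → Rn n} (hX : AEMeasurable X P) (h : IsDensity (P.map X)) :
    Integrable (fun q => ‖X q‖ ^ 2) P :=
  (integrable_map_measure (by fun_prop) hX).1 h.moment

lemma moment2_nonneg (m : Measure (Rn n)) : 0 ≤ moment2 m :=
  integral_nonneg fun _ => by positivity

lemma moment2_map {Ω : Type*} [MeasurableSpace Ω] {P : Measure Ω} {X : Ω → Rn n}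
    (hX : AEMeasurable X P) : moment2 (P.map X) = ∫ q, ‖X q‖ ^ 2 ∂P :=
  integral_map hX (by fun_prop)

/-! ### Square-integrable random vectors -/

section SquareIntegrable

variable {Ω : Type*} [MeasurableSpace Ω] {P : Measure Ω} {X Y : Ω → Rn n}

lemma integral_norm_mul_norm_le {E : Type*} [NormedAddCommGroup E] {X Y : Ω → E}
    (hX : MemLp X 2 P) (hY : MemLp Y 2 P) :
    ∫ q, ‖X q‖ * ‖Y q‖ ∂P ≤ √(∫ q, ‖X q‖ ^ 2 ∂P) * √(∫ q, ‖Y q‖ ^ 2 ∂P) := by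
  have h := integral_mul_norm_le_Lp_mul_Lq (μ := P) (f := X) (g := Y)
    Real.HolderConjugate.two_two (by simpa using hX) (by simpa using hY)
  simp only [Real.rpow_two] at h
  rwa [← Real.sqrt_eq_rpow, ← Real.sqrt_eq_rpow] at h

lemma integrable_norm_mul_norm (hX : MemLp X 2 P) (hY : MemLp Y 2 P) :
    Integrable (fun q => ‖X q‖ * ‖Y q‖) P := by
  refine Integrable.mono' ((hX.integrable_norm_pow (by norm_num)).add
    (hY.integrable_norm_pow (by norm_num)))
    (hX.1.norm.mul hY.1.norm) (ae_of_all _ fun q => ?_)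
  rw [Real.norm_of_nonneg (by positivity)]
  simp only [Pi.add_apply]
  nlinarith [sq_nonneg (‖X q‖ - ‖Y q‖), sq_nonneg (‖X q‖ + ‖Y q‖)]

lemma integrable_inner_of_memLp (hX : MemLp X 2 P) (hY : MemLp Y 2 P) :
    Integrable (fun q => inner ℝ (X q) (Y q)) P :=
  (integrable_norm_mul_norm hX hY).mono' (hX.1.inner hY.1)
    (ae_of_all _ fun _ => norm_inner_le_norm _ _)

lemma integrable_sq_of_memLp (hX : MemLp X 2 P) : Integrable (fun q => ‖X q‖ ^ 2) P :=
  hX.integrable_norm_pow (by norm_num)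

lemma memLp_two_of_sq (hX : AEStronglyMeasurable X P) (h : Integrable (fun q => ‖X q‖ ^ 2) P) :
    MemLp X 2 P :=
  (memLp_two_iff_integrable_sq_norm hX).2 h

lemma eLpNorm_two_eq (hX : MemLp X 2 P) :
    eLpNorm X 2 P = ENNReal.ofReal (√(∫ q, ‖X q‖ ^ 2 ∂P)) := by
  have := hX.eLpNorm_eq_integral_rpow_norm (by norm_num) (by norm_num)
  simp only [ENNReal.toReal_ofNat, Real.rpow_two] at this
  rw [Real.sqrt_eq_rpow, one_div]
  exact this

lemma integral_norm_add_sq_le (hX : MemLp X 2 P) (hY : MemLp Y 2 P) :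
    ∫ q, ‖X q + Y q‖ ^ 2 ∂P ≤ 2 * ∫ q, ‖X q‖ ^ 2 ∂P + 2 * ∫ q, ‖Y q‖ ^ 2 ∂P := by
  have h1 := integrable_sq_of_memLp hX
  have h2 := integrable_sq_of_memLp hY
  calc ∫ q, ‖X q + Y q‖ ^ 2 ∂P ≤ ∫ q, (2 * ‖X q‖ ^ 2 + 2 * ‖Y q‖ ^ 2) ∂P := by
        refine integral_mono (integrable_sq_of_memLp (hX.add hY))
          ((h1.const_mul 2).add (h2.const_mul 2)) fun q => ?_
        have := pow_le_pow_left₀ (norm_nonneg _) (norm_add_le (X q) (Y q)) 2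
        simp only
        nlinarith [sq_nonneg (‖X q‖ - ‖Y q‖)]
    _ = _ := by
        rw [integral_add (h1.const_mul 2) (h2.const_mul 2), integral_const_mul,
          integral_const_mul]

end SquareIntegrable

/-! ### Functionals of densities with a Lipschitz intrinsic gradient -/

lemma W2_self {m : Measure (Rn n)} (hm : IsDensity m) : W2 m m = 0 := by
  have := hm.prob
  have h := W2_map_le_of_bound (P := m) (X := id) (Y := id) (D := 0) aemeasurable_id
    aemeasurable_id (by simp)
  rw [Measure.map_id] at h
  exact le_antisymm h (W2_nonneg _ _)

/-- The sequence `μ, m, m, …` tends to `m`, so a functional derivative at `m` is integrable for every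
density `μ`. -/
lemma HasFunctionalDeriv.integrable {Φ : Measure (Rn n) → ℝ} {m μ : Measure (Rn n)}
    {G : Rn n → ℝ} (h : HasFunctionalDeriv Φ m G) (hm : IsDensity m) (hμ : IsDensity μ) :
    Integrable G μ := by
  have := (h.2 (fun k => if k = 0 then μ else m) (fun k => by split_ifs <;> assumption) ?_).1 0
  · simpa using this
  · refine tendsto_const_nhds.congr' ?_
    filter_upwards [eventually_ne_atTop 0] with k hk
    simp [hk, W2_self hm]

/-- The remainder is `o(W₂)` uniformly over densities, not only along sequences. -/
lemma HasFunctionalDeriv.exists_delta {Φ : Measure (Rn n) → ℝ} {m : Measure (Rn n)}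
    {G : Rn n → ℝ} (h : HasFunctionalDeriv Φ m G) {ε : ℝ} (hε : 0 < ε) :
    ∃ δ > 0, ∀ μ, IsDensity μ → W2 μ m < δ →
      |Φ μ - Φ m - (∫ x, G x ∂μ - ∫ x, G x ∂m)| ≤ ε * W2 μ m := by
  by_contra! hcon
  choose μ hμ hlt hgt using fun k : ℕ => hcon (1 / ((k : ℝ) + 1)) (by positivity)
  have hto : Tendsto (fun k => W2 (μ k) m) atTop (𝓝 0) :=
    squeeze_zero (fun _ => W2_nonneg _ _) (fun k => (hlt k).le)
      tendsto_one_div_add_atTop_nhds_zero_nat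
  obtain ⟨k, hk⟩ := ((h.2 μ hμ hto).2.def hε).exists
  rw [Real.norm_eq_abs, Real.norm_of_nonneg (W2_nonneg _ _)] at hk
  exact absurd hk (not_le.2 (hgt k))

/-- If the derivative of `f` on `[0, 1]` differs from `A` by at most `K τ`, then `f 1 - f 0`
differs from `A` by at most `K / 2`. -/
lemma abs_sub_sub_le_of_deriv {f f' : ℝ → ℝ} {A K : ℝ} (hf : ∀ τ, HasDerivAt f (f' τ) τ)
    (h : ∀ τ, 0 ≤ τ → |f' τ - A| ≤ K * τ) : |f 1 - f 0 - A| ≤ K / 2 := by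
  have hg : ∀ τ, HasDerivAt (fun τ => f τ - f 0 - A * τ) (f' τ - A) τ := fun τ => by
    simpa using ((hf τ).sub_const (f 0)).fun_sub ((hasDerivAt_id τ).const_mul A)
  have hB : ∀ τ, HasDerivAt (fun τ : ℝ => K * τ ^ 2 / 2) (K * τ) τ := fun τ => by
    refine (((hasDerivAt_pow 2 τ).const_mul K).div_const 2).congr_deriv ?_
    push_cast
    ring
  have := image_norm_le_of_norm_deriv_right_le_deriv_boundary (a := 0) (b := 1)
    (f := fun τ => f τ - f 0 - A * τ) (f' := fun τ => f' τ - A)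
    (fun τ _ => (hg τ).continuousAt.continuousWithinAt) (fun τ _ => (hg τ).hasDerivWithinAt)
    (B := fun τ => K * τ ^ 2 / 2) (by simp) hB (fun τ hτ => h τ hτ.1)
    (Set.right_mem_Icc.2 zero_le_one)
  simpa using this

/-- `Φ` is a functional of densities with functional derivative `Ψ`, whose spatial gradient
`D_x Ψ` (the gradient of `Φ` along displacements) is Lipschitz with linear growth. -/
structure IsPotential (c : ℝ) (Φ : Measure (Rn n) → ℝ) (Ψ : Rn n → Measure (Rn n) → ℝ) :
    Prop where
  deriv : ∀ m, IsDensity m → HasFunctionalDeriv Φ m (fun x => Ψ x m)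
  diff : ∀ m, IsDensity m → Differentiable ℝ (fun x => Ψ x m)
  lipschitz : ∀ m₁ m₂, IsDensity m₁ → IsDensity m₂ → ∀ x₁ x₂,
    ‖Dx Ψ x₁ m₁ - Dx Ψ x₂ m₂‖ ≤ c / 2 * (‖x₁ - x₂‖ + W2 m₁ m₂)
  growth : ∀ m, IsDensity m → ∀ x, ‖Dx Ψ x m‖ ≤ c / 2 * (1 + ‖x‖ + √(moment2 m))

namespace IsPotential

variable {c : ℝ} {Φ : Measure (Rn n) → ℝ} {Ψ : Rn n → Measure (Rn n) → ℝ}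

lemma nonneg (h : IsPotential c Φ Ψ) {m : Measure (Rn n)} (hm : IsDensity m) : 0 ≤ c := by
  have h1 := (norm_nonneg _).trans (h.growth m hm 0)
  have h2 : 0 < 1 + ‖(0 : Rn n)‖ + √(moment2 m) := by positivity
  by_contra! hc
  nlinarith

lemma lipschitz_space (h : IsPotential c Φ Ψ) {m : Measure (Rn n)} (hm : IsDensity m)
    (x y : Rn n) : ‖Dx Ψ x m - Dx Ψ y m‖ ≤ c / 2 * ‖x - y‖ := by
  simpa [W2_self hm] using h.lipschitz m m hm hm x y

lemma continuous_Dx (h : IsPotential c Φ Ψ) {m : Measure (Rn n)} (hm : IsDensity m) :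
    Continuous (fun x => Dx Ψ x m) := by
  have hc := h.nonneg hm
  refine (LipschitzWith.of_dist_le_mul (K := ⟨c / 2, by positivity⟩) fun x y => ?_).continuous
  rw [dist_eq_norm, dist_eq_norm]
  exact h.lipschitz_space hm x y

lemma abs_taylor_le (h : IsPotential c Φ Ψ) {m : Measure (Rn n)} (hm : IsDensity m)
    (x y : Rn n) :
    |Ψ y m - Ψ x m - inner ℝ (Dx Ψ x m) (y - x)| ≤ c / 4 * ‖y - x‖ ^ 2 := by
  have hd : ∀ τ : ℝ, HasDerivAt (fun τ : ℝ => Ψ (x + τ • (y - x)) m)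
      (inner ℝ (Dx Ψ (x + τ • (y - x)) m) (y - x)) τ := fun τ => by
    have h1 := ((h.diff m hm (x + τ • (y - x))).hasGradientAt).hasFDerivAt
    have h2 : HasDerivAt (fun τ : ℝ => x + τ • (y - x)) (y - x) τ := by
      simpa using ((hasDerivAt_id τ).smul_const (y - x)).const_add x
    exact h1.comp_hasDerivAt τ h2
  have := abs_sub_sub_le_of_deriv (A := inner ℝ (Dx Ψ x m) (y - x)) (K := c / 2 * ‖y - x‖ ^ 2)
    hd fun τ hτ => by
      rw [← inner_sub_left]
      refine (abs_real_inner_le_norm _ _).trans ?_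
      refine (mul_le_mul_of_nonneg_right (h.lipschitz_space hm _ _) (norm_nonneg _)).trans ?_
      rw [add_sub_cancel_left, norm_smul, Real.norm_of_nonneg hτ]
      exact le_of_eq (by ring)
  simp only [one_smul, zero_smul, add_zero, add_sub_cancel] at this
  linarith

variable {Ω : Type*} [MeasurableSpace Ω] {P : Measure Ω}

lemma memLp_Dx (h : IsPotential c Φ Ψ) [IsFiniteMeasure P] {X : Ω → Rn n} (hX : MemLp X 2 P)
    {m : Measure (Rn n)} (hm : IsDensity m) : MemLp (fun q => Dx Ψ (X q) m) 2 P := by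
  have hg : MemLp (fun q => (1 + √(moment2 m)) + ‖X q‖) 2 P :=
    (memLp_const (1 + √(moment2 m))).add hX.norm
  refine hg.of_le_mul (c := c / 2) ((h.continuous_Dx hm).comp_aestronglyMeasurable hX.1)
    (ae_of_all _ fun q => ?_)
  rw [Real.norm_of_nonneg (by positivity)]
  exact (h.growth m hm (X q)).trans (le_of_eq (by ring))

/-- The gradient along displacements is `c`-Lipschitz in `L²`. -/
lemma abs_integral_inner_Dx_sub_le (h : IsPotential c Φ Ψ) [IsProbabilityMeasure P]
    {X Y Z : Ω → Rn n} (hX : MemLp X 2 P) (hY : MemLp Y 2 P) (hZ : MemLp Z 2 P)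
    (dX : IsDensity (P.map X)) (dY : IsDensity (P.map Y)) :
    |∫ q, inner ℝ (Dx Ψ (X q) (P.map X)) (Z q) ∂P - ∫ q, inner ℝ (Dx Ψ (Y q) (P.map Y)) (Z q) ∂P|
      ≤ c * (√(∫ q, ‖X q - Y q‖ ^ 2 ∂P) * √(∫ q, ‖Z q‖ ^ 2 ∂P)) := by
  have hc := h.nonneg dX
  set D := √(∫ q, ‖X q - Y q‖ ^ 2 ∂P)
  have hW : W2 (P.map X) (P.map Y) ≤ D :=
    W2_map_le hX.1.aemeasurable hY.1.aemeasurable (integrable_sq_of_memLp (hX.sub hY))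
  rw [← integral_sub (integrable_inner_of_memLp (h.memLp_Dx hX dX) hZ)
    (integrable_inner_of_memLp (h.memLp_Dx hY dY) hZ)]
  have hZ1 : ∫ q, ‖Z q‖ ∂P ≤ √(∫ q, ‖Z q‖ ^ 2 ∂P) := by
    have := ProbabilityTheory.variance_nonneg (fun q => ‖Z q‖) P
    rw [ProbabilityTheory.variance_eq_sub hZ.norm] at this
    refine Real.le_sqrt_of_sq_le ?_
    simpa using this
  have hXY := integral_norm_mul_norm_le (hX.sub hY) hZ
  have hi1 := integrable_norm_mul_norm (hX.sub hY) hZ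
  have hi2 : Integrable (fun q => ‖Z q‖) P := (hZ.integrable (by norm_num)).norm
  simp only [Pi.sub_apply] at hXY hi1
  calc _ ≤ ∫ q, c / 2 * (‖X q - Y q‖ * ‖Z q‖ + D * ‖Z q‖) ∂P := by
        refine norm_integral_le_of_norm_le (G := ℝ) ((hi1.add (hi2.const_mul D)).const_mul _)
          (ae_of_all _ fun q => ?_)
        rw [← inner_sub_left]
        refine (norm_inner_le_norm _ _).trans ?_
        refine (mul_le_mul_of_nonneg_right (h.lipschitz _ _ dX dY (X q) (Y q))
          (norm_nonneg _)).trans ?_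
        rw [mul_assoc, ← add_mul]
        gcongr
    _ = c / 2 * (∫ q, ‖X q - Y q‖ * ‖Z q‖ ∂P + D * ∫ q, ‖Z q‖ ∂P) := by
        rw [integral_const_mul, integral_add hi1 (hi2.const_mul D), integral_const_mul]
    _ ≤ c / 2 * (D * √(∫ q, ‖Z q‖ ^ 2 ∂P) + D * √(∫ q, ‖Z q‖ ^ 2 ∂P)) := by
        gcongr
    _ = _ := by ring

/-- Chain rule: the derivative of `Φ` along the line `X + ε Z` of random variables. -/
lemma hasDerivAt_line (h : IsPotential c Φ Ψ) [IsProbabilityMeasure P]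
    {X Z : Ω → Rn n} (hX : MemLp X 2 P) (hZ : MemLp Z 2 P)
    (hd : ∀ ε : ℝ, IsDensity (P.map fun q => X q + ε • Z q)) :
    HasDerivAt (fun ε : ℝ => Φ (P.map fun q => X q + ε • Z q))
      (∫ q, inner ℝ (Dx Ψ (X q) (P.map X)) (Z q) ∂P) 0 := by
  have dX : IsDensity (P.map X) := by simpa using hd 0
  have hc := h.nonneg dX
  set A := ∫ q, inner ℝ (Dx Ψ (X q) (P.map X)) (Z q) ∂P
  set N := ∫ q, ‖Z q‖ ^ 2 ∂P
  have hN : 0 ≤ N := integral_nonneg fun _ => by positivity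
  have hm : ∀ ε : ℝ, MemLp (fun q => X q + ε • Z q) 2 P := fun ε => hX.add (hZ.const_smul ε)
  have hW : ∀ ε : ℝ, W2 (P.map fun q => X q + ε • Z q) (P.map X) ≤ |ε| * √N := fun ε => by
    refine (W2_map_le (hm ε).1.aemeasurable hX.1.aemeasurable
      (integrable_sq_of_memLp ((hm ε).sub hX))).trans (le_of_eq ?_)
    simp only [add_sub_cancel_left, norm_smul, mul_pow]
    rw [integral_const_mul, Real.sqrt_mul (by positivity), Real.sqrt_sq (norm_nonneg _),
      Real.norm_eq_abs]
  have hΨ : ∀ ε : ℝ, Integrable (fun q => Ψ (X q + ε • Z q) (P.map X)) P := fun ε =>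
    (integrable_map_measure (h.diff _ dX).continuous.aestronglyMeasurable
      (hm ε).1.aemeasurable).1 ((h.deriv _ dX).integrable dX (hd ε))
  have hΨ0 : Integrable (fun q => Ψ (X q) (P.map X)) P := by simpa using hΨ 0
  have hsub : ∀ ε : ℝ, Integrable
      (fun q => Ψ (X q + ε • Z q) (P.map X) - Ψ (X q) (P.map X)) P := fun ε => (hΨ ε).sub hΨ0
  have hlin : ∀ ε : ℝ, |(∫ x, Ψ x (P.map X) ∂(P.map fun q => X q + ε • Z q)) -
      (∫ x, Ψ x (P.map X) ∂(P.map X)) - ε * A| ≤ c / 4 * (ε ^ 2 * N) := fun ε => by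
    rw [integral_map (hm ε).1.aemeasurable (h.diff _ dX).continuous.aestronglyMeasurable,
      integral_map hX.1.aemeasurable (h.diff _ dX).continuous.aestronglyMeasurable,
      ← integral_sub (hΨ ε) hΨ0, ← integral_const_mul, ← integral_sub (hsub ε)
        ((integrable_inner_of_memLp (h.memLp_Dx hX dX) hZ).const_mul ε), ← integral_const_mul,
      ← integral_const_mul]
    refine norm_integral_le_of_norm_le (G := ℝ)
      (((integrable_sq_of_memLp hZ).const_mul _).const_mul _) (ae_of_all _ fun q => ?_)
    have := h.abs_taylor_le dX (X q) (X q + ε • Z q)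
    rwa [add_sub_cancel_left, norm_smul, mul_pow, Real.norm_eq_abs, sq_abs, inner_smul_right]
      at this
  rw [hasDerivAt_iff_isLittleO, isLittleO_iff]
  intro η hη
  obtain ⟨δ, hδ, hδ'⟩ := (h.deriv _ dX).exists_delta (ε := η / (2 * (√N + 1))) (by positivity)
  have e1 : ∀ᶠ ε : ℝ in 𝓝 0, |ε| * √N < δ := by
    have : Tendsto (fun ε : ℝ => |ε| * √N) (𝓝 0) (𝓝 (|0| * √N)) :=
      (continuous_abs.mul continuous_const).tendsto 0
    exact this.eventually_lt_const (by simpa using hδ)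
  have e2 : ∀ᶠ ε : ℝ in 𝓝 0, c / 4 * (|ε| * N) < η / 2 := by
    have : Tendsto (fun ε : ℝ => c / 4 * (|ε| * N)) (𝓝 0) (𝓝 (c / 4 * (|0| * N))) :=
      (continuous_const.mul (continuous_abs.mul continuous_const)).tendsto 0
    exact this.eventually_lt_const (by simpa using hη)
  filter_upwards [e1, e2] with ε h1 h2
  have h3 := hδ' _ (hd ε) ((hW ε).trans_lt h1)
  have h4 := hlin ε
  have h5 : η / (2 * (√N + 1)) * W2 (P.map fun q => X q + ε • Z q) (P.map X) ≤ η / 2 * |ε| := by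
    refine (mul_le_mul_of_nonneg_left (hW ε) (by positivity)).trans ?_
    have : √N / (√N + 1) ≤ 1 := (div_le_one (by positivity)).2 (by linarith)
    calc η / (2 * (√N + 1)) * (|ε| * √N) = η / 2 * |ε| * (√N / (√N + 1)) := by
          field_simp
      _ ≤ η / 2 * |ε| * 1 := by gcongr
      _ = _ := mul_one _
  have h6 : c / 4 * (ε ^ 2 * N) ≤ η / 2 * |ε| := by
    calc c / 4 * (ε ^ 2 * N) = c / 4 * (|ε| * N) * |ε| := by rw [← sq_abs]; ring
      _ ≤ _ := by gcongr
  simp only [sub_zero, zero_smul, add_zero, smul_eq_mul, Real.norm_eq_abs]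
  have key : Φ (P.map fun q => X q + ε • Z q) - Φ (P.map X) - ε * A =
      (Φ (P.map fun q => X q + ε • Z q) - Φ (P.map X) -
        ((∫ x, Ψ x (P.map X) ∂(P.map fun q => X q + ε • Z q)) - ∫ x, Ψ x (P.map X) ∂(P.map X)))
      + ((∫ x, Ψ x (P.map X) ∂(P.map fun q => X q + ε • Z q)) -
        (∫ x, Ψ x (P.map X) ∂(P.map X)) - ε * A) := by ring
  change |Φ (P.map fun q => X q + ε • Z q) - Φ (P.map X) - ε * A| ≤ η * |ε|
  rw [key]
  refine (abs_add_le _ _).trans ?_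
  linarith

end IsPotential

/-! ### Displacement expansion across non-absolutely continuous interpolations -/

/-- The uniform distribution on the unit ball, used to smooth the laws along an interpolation. -/
noncomputable def ballNoise (n : ℕ) : Measure (Rn n) :=
  ProbabilityTheory.cond volume (Metric.closedBall 0 1)

instance : IsProbabilityMeasure (ballNoise n) :=
  ProbabilityTheory.cond_isProbabilityMeasure_of_finite
    (Metric.measure_closedBall_pos _ _ one_pos).ne' measure_closedBall_lt_top.ne

lemma ballNoise_ac : ballNoise n ≪ volume := ProbabilityTheory.cond_absolutelyContinuous

lemma ballNoise_norm_le : ∀ᵐ z ∂(ballNoise n), ‖z‖ ≤ 1 := by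
  have := ProbabilityTheory.ae_cond_mem (μ := (volume : Measure (Rn n)))
    (measurableSet_closedBall (x := (0 : Rn n)) (ε := 1))
  filter_upwards [this] with z hz
  simpa using hz

section Noise

variable {Ω : Type*} [MeasurableSpace Ω] {P : Measure Ω}

lemma map_fst_noise {X : Ω → Rn n} (hX : Measurable X) :
    (P.prod (ballNoise n)).map (fun p => X p.1) = P.map X := by
  rw [show (fun p : Ω × Rn n => X p.1) = X ∘ Prod.fst from rfl,
    ← Measure.map_map hX measurable_fst, Measure.map_fst_prod]
  simp

lemma integral_fst_noise [IsProbabilityMeasure P] {E : Type*} [NormedAddCommGroup E]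
    [NormedSpace ℝ E] (g : Ω → E) :
    ∫ p, g p.1 ∂(P.prod (ballNoise n)) = ∫ q, g q ∂P := by
  rw [integral_fun_fst]; simp

lemma memLp_fst_noise {X : Ω → Rn n} (hX2 : MemLp X 2 P) :
    MemLp (fun p : Ω × Rn n => X p.1) 2 (P.prod (ballNoise n)) :=
  hX2.comp_fst _

lemma memLp_snd_noise [IsProbabilityMeasure P] :
    MemLp (fun p : Ω × Rn n => p.2) 2 (P.prod (ballNoise n)) := by
  have : MemLp (fun z : Rn n => z) 2 (ballNoise n) :=
    MemLp.of_bound measurable_id.aestronglyMeasurable 1 ballNoise_norm_le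
  exact this.comp_snd _

/-- Adding independent noise makes every law absolutely continuous. -/
lemma map_add_noise_ac {X : Ω → Rn n} (hX : Measurable X) {ε : ℝ} (hε : ε ≠ 0) :
    (P.prod (ballNoise n)).map (fun p => X p.1 + ε • p.2) ≪ volume := by
  have hmeas : Measurable fun p : Ω × Rn n => X p.1 + ε • p.2 := by fun_prop
  refine Measure.AbsolutelyContinuous.mk fun s hs h0 => ?_
  rw [Measure.map_apply hmeas hs, Measure.prod_apply (hmeas hs)]
  refine (lintegral_congr fun q => ?_).trans lintegral_zero
  refine ballNoise_ac ?_
  have : Prod.mk q ⁻¹' ((fun p : Ω × Rn n => X p.1 + ε • p.2) ⁻¹' s) =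
      (ε • ·) ⁻¹' ((X q + ·) ⁻¹' s) := rfl
  rw [this, Measure.addHaar_preimage_smul _ hε, measure_preimage_add, h0, mul_zero]

end Noise

namespace IsPotential

variable {c : ℝ} {Φ : Measure (Rn n) → ℝ} {Ψ : Rn n → Measure (Rn n) → ℝ}
variable {Ω : Type*} [MeasurableSpace Ω] {P : Measure Ω} [IsProbabilityMeasure P]

/-- The displacement expansion when all the interpolated laws are densities. -/
lemma abs_displacement_le_of_line (h : IsPotential c Φ Ψ) {X Z : Ω → Rn n}
    (hX : MemLp X 2 P) (hZ : MemLp Z 2 P)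
    (hd : ∀ τ : ℝ, IsDensity (P.map fun q => X q + τ • Z q)) :
    |Φ (P.map fun q => X q + Z q) - Φ (P.map X)
      - ∫ q, inner ℝ (Dx Ψ (X q) (P.map X)) (Z q) ∂P| ≤ c / 2 * ∫ q, ‖Z q‖ ^ 2 ∂P := by
  have hm : ∀ τ : ℝ, MemLp (fun q => X q + τ • Z q) 2 P := fun τ => hX.add (hZ.const_smul τ)
  have hN : 0 ≤ ∫ q, ‖Z q‖ ^ 2 ∂P := integral_nonneg fun _ => by positivity
  have hder : ∀ τ : ℝ, HasDerivAt (fun τ : ℝ => Φ (P.map fun q => X q + τ • Z q))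
      (∫ q, inner ℝ (Dx Ψ (X q + τ • Z q) (P.map fun q => X q + τ • Z q)) (Z q) ∂P) τ := by
    intro τ
    have h1 := h.hasDerivAt_line (hm τ) hZ fun ε => by
      simpa [add_assoc, ← add_smul] using hd (τ + ε)
    have h2 := HasDerivAt.comp_sub_const τ τ (by simpa using h1)
    simpa [add_assoc, ← add_smul] using h2
  have dX : IsDensity (P.map X) := by simpa using hd 0
  have key := abs_sub_sub_le_of_deriv hder (A := ∫ q, inner ℝ (Dx Ψ (X q) (P.map X)) (Z q) ∂P)
    (K := c * ∫ q, ‖Z q‖ ^ 2 ∂P) fun τ hτ => by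
      refine (h.abs_integral_inner_Dx_sub_le (hm τ) hX hZ (hd τ) dX).trans (le_of_eq ?_)
      simp only [add_sub_cancel_left, norm_smul, mul_pow]
      rw [integral_const_mul, Real.sqrt_mul (by positivity), Real.sqrt_sq (norm_nonneg _),
        Real.norm_of_nonneg hτ, mul_assoc τ, Real.mul_self_sqrt hN]
      ring
  simp only [one_smul, zero_smul, add_zero] at key
  linarith

/-- Displacement expansion of `Φ` between the laws of two random variables, with an error
quadratic in their `L²` distance. The laws of the interpolations `(1 - τ) X + τ Y` need not be
densities, so the expansion is applied to `X + ε z`, `Y + ε z` with an independent noise `z`,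
and `ε → 0`. -/
lemma abs_displacement_le (h : IsPotential c Φ Ψ) {X Y : Ω → Rn n} (hX : Measurable X)
    (hY : Measurable Y) (dX : IsDensity (P.map X)) (dY : IsDensity (P.map Y)) :
    |Φ (P.map Y) - Φ (P.map X) - ∫ q, inner ℝ (Dx Ψ (X q) (P.map X)) (Y q - X q) ∂P|
      ≤ c / 2 * ∫ q, ‖Y q - X q‖ ^ 2 ∂P := by
  have hX2 : MemLp X 2 P :=
    memLp_two_of_sq hX.aestronglyMeasurable (dX.integrable_sq hX.aemeasurable)
  have hY2 : MemLp Y 2 P :=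
    memLp_two_of_sq hY.aestronglyMeasurable (dY.integrable_sq hY.aemeasurable)
  set Q := P.prod (ballNoise n)
  set N := ∫ q, ‖Y q - X q‖ ^ 2 ∂P
  set A : ℝ → ℝ := fun ε => ∫ p, inner ℝ (Dx Ψ (X p.1 + ε • p.2)
    (Q.map fun p => X p.1 + ε • p.2)) (Y p.1 - X p.1) ∂Q
  have hZ : MemLp (fun p : Ω × Rn n => Y p.1 - X p.1) 2 Q := memLp_fst_noise (hY2.sub hX2)
  have hz : MemLp (fun p : Ω × Rn n => p.2) 2 Q := memLp_snd_noise
  have hm : ∀ {W : Ω → Rn n}, MemLp W 2 P → ∀ ε : ℝ,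
      MemLp (fun p : Ω × Rn n => W p.1 + ε • p.2) 2 Q :=
    fun hW ε => (memLp_fst_noise hW).add (hz.const_smul ε)
  have hdens : ∀ {W : Ω → Rn n}, Measurable W → MemLp W 2 P → ∀ ε : ℝ, ε ≠ 0 →
      IsDensity (Q.map fun p => W p.1 + ε • p.2) := fun hW hW2 ε hε =>
    IsDensity.of_map (hm hW2 ε).1.aemeasurable (map_add_noise_ac hW hε)
      (integrable_sq_of_memLp (hm hW2 ε))
  have hdens' : ∀ {W : Ω → Rn n}, Measurable W → IsDensity (P.map W) → ∀ ε : ℝ,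
      IsDensity (Q.map fun p => W p.1 + ε • p.2) := fun {W} hW dW ε => by
    rcases eq_or_ne ε 0 with rfl | hε
    · simpa [Q, map_fst_noise hW] using dW
    · exact hdens hW (memLp_two_of_sq hW.aestronglyMeasurable
        (dW.integrable_sq hW.aemeasurable)) ε hε
  have hcont : ∀ {W : Ω → Rn n}, Measurable W → IsDensity (P.map W) →
      Tendsto (fun ε : ℝ => Φ (Q.map fun p => W p.1 + ε • p.2)) (𝓝[>] 0) (𝓝 (Φ (P.map W))) := by
    intro W hW dW
    have hW2 : MemLp W 2 P := memLp_two_of_sq hW.aestronglyMeasurable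
      (dW.integrable_sq hW.aemeasurable)
    have := (h.hasDerivAt_line (memLp_fst_noise hW2) hz (hdens' hW dW)).continuousAt.tendsto
    simp only [zero_smul, add_zero, map_fst_noise hW] at this
    exact this.mono_left nhdsWithin_le_nhds
  have hA : Tendsto A (𝓝[>] 0) (𝓝 (A 0)) := by
    have hb : ∀ ε : ℝ, |A ε - A 0| ≤
        c * (√(ε ^ 2 * ∫ p : Ω × Rn n, ‖p.2‖ ^ 2 ∂Q) * √N) := fun ε => by
      refine (h.abs_integral_inner_Dx_sub_le (hm hX2 ε) (hm hX2 0) hZ (hdens' hX dX ε)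
        (hdens' hX dX 0)).trans (le_of_eq ?_)
      simp only [zero_smul, add_zero, add_sub_cancel_left, norm_smul, mul_pow, Real.norm_eq_abs,
        sq_abs]
      rw [integral_const_mul, integral_fst_noise (fun q => ‖Y q - X q‖ ^ 2)]
    rw [tendsto_iff_norm_sub_tendsto_zero]
    refine squeeze_zero (fun _ => norm_nonneg _) hb ?_
    have hc : Continuous fun ε : ℝ =>
        c * (√(ε ^ 2 * ∫ p : Ω × Rn n, ‖p.2‖ ^ 2 ∂Q) * √N) := by fun_prop
    exact (hc.tendsto' 0 0 (by simp)).mono_left nhdsWithin_le_nhds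
  have hA0 : A 0 = ∫ q, inner ℝ (Dx Ψ (X q) (P.map X)) (Y q - X q) ∂P := by
    simp only [A, zero_smul, add_zero, Q, map_fst_noise hX]
    exact integral_fst_noise fun q => inner ℝ (Dx Ψ (X q) (P.map X)) (Y q - X q)
  rw [← hA0]
  refine le_of_tendsto (((hcont hY dY).sub (hcont hX dX)).sub hA).abs ?_
  filter_upwards [self_mem_nhdsWithin] with ε (hε : 0 < ε)
  have hline := h.abs_displacement_le_of_line (hm hX2 ε) hZ fun τ => by
    have := hdens (W := fun q => X q + τ • (Y q - X q)) (by fun_prop)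
      (hX2.add ((hY2.sub hX2).const_smul τ)) ε hε.ne'
    convert this using 3
    abel
  have e1 : (fun p : Ω × Rn n => X p.1 + ε • p.2 + (Y p.1 - X p.1)) =
      fun p => Y p.1 + ε • p.2 := by
    funext p; abel
  rw [e1, integral_fst_noise (fun q => ‖Y q - X q‖ ^ 2)] at hline
  exact hline

/-- `Φ` is locally Lipschitz for the `L²` distance of random variables. -/
lemma abs_sub_le_of_map (h : IsPotential c Φ Ψ) {X Y : Ω → Rn n} (hX : Measurable X)
    (hY : Measurable Y) (dX : IsDensity (P.map X)) (dY : IsDensity (P.map Y)) :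
    |Φ (P.map Y) - Φ (P.map X)| ≤ √(∫ q, ‖Dx Ψ (X q) (P.map X)‖ ^ 2 ∂P) *
      √(∫ q, ‖Y q - X q‖ ^ 2 ∂P) + c / 2 * ∫ q, ‖Y q - X q‖ ^ 2 ∂P := by
  have hX2 : MemLp X 2 P :=
    memLp_two_of_sq hX.aestronglyMeasurable (dX.integrable_sq hX.aemeasurable)
  have hY2 : MemLp Y 2 P :=
    memLp_two_of_sq hY.aestronglyMeasurable (dY.integrable_sq hY.aemeasurable)
  have h1 := h.abs_displacement_le hX hY dX dY
  have h2 : |∫ q, inner ℝ (Dx Ψ (X q) (P.map X)) (Y q - X q) ∂P| ≤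
      √(∫ q, ‖Dx Ψ (X q) (P.map X)‖ ^ 2 ∂P) * √(∫ q, ‖Y q - X q‖ ^ 2 ∂P) :=
    (norm_integral_le_of_norm_le (G := ℝ)
      (integrable_norm_mul_norm (h.memLp_Dx hX2 dX) (hY2.sub hX2))
      (ae_of_all _ fun q => norm_inner_le_norm _ _)).trans
      (integral_norm_mul_norm_le (h.memLp_Dx hX2 dX) (hY2.sub hX2))
  have := abs_le.1 h1
  have := abs_le.1 h2
  exact abs_le.2 ⟨by linarith, by linarith⟩

end IsPotential

/-! ### The integral operator of the flow equation -/

/-- The constants of the problem, on the time interval `[t, T]`. -/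
structure Setting (c lam T t : ℝ) : Prop where
  T_pos : 0 < T
  lam_gt : c * T * (1 + T) < lam
  t_mem : t ∈ Set.Icc 0 T
  c_nonneg : 0 ≤ c

/-- The contraction rate of the flow equation, separately in the position and in the law. -/
noncomputable def rate (c lam T : ℝ) : ℝ := c * T * (1 + T) / (2 * lam)

/-- The Lipschitz constant of the displacement `y(·, s) - id` along the flow. -/
noncomputable def dispRate (c lam T : ℝ) : ℝ := rate c lam T / (1 - rate c lam T)

/-- The displacement `(s-t)/λ p + (1/λ) ∫ₜᵀ (min(s,σ)-t) g(σ) dσ` produced by a final force `p`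
and a running force `g`. -/
noncomputable def drift (lam T t : ℝ) (p : Rn n) (g : ℝ → Rn n) (s : ℝ) : Rn n :=
  ((s - t) / lam) • p + (1 / lam) • ∫ σ in t..T, (min s σ - t) • g σ

namespace Setting

variable {c lam T t : ℝ}

lemma lam_pos (S : Setting c lam T t) : 0 < lam := by
  have := S.T_pos
  have := S.c_nonneg
  exact lt_of_le_of_lt (by positivity) S.lam_gt

lemma rate_nonneg (S : Setting c lam T t) : 0 ≤ rate c lam T := by
  have := S.T_pos
  have := S.c_nonneg
  have := S.lam_pos
  unfold rate
  positivity

lemma rate_lt (S : Setting c lam T t) : 2 * rate c lam T < 1 := by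
  have := S.lam_pos
  have h : 2 * rate c lam T = c * T * (1 + T) / lam := by unfold rate; field_simp
  rw [h, div_lt_one this]
  exact S.lam_gt

lemma dispRate_nonneg (S : Setting c lam T t) : 0 ≤ dispRate c lam T := by
  have := S.rate_nonneg
  have := S.rate_lt
  exact div_nonneg (by linarith) (by linarith)

lemma dispRate_lt_one (S : Setting c lam T t) : dispRate c lam T < 1 := by
  have := S.rate_nonneg
  have := S.rate_lt
  exact (div_lt_one (by linarith)).2 (by linarith)

lemma rate_mul_one_add (S : Setting c lam T t) :
    rate c lam T * (1 + dispRate c lam T) = dispRate c lam T := by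
  have := S.rate_lt
  have := S.rate_nonneg
  have h : 1 - rate c lam T ≠ 0 := by linarith
  unfold dispRate
  field_simp
  ring

lemma t_le (S : Setting c lam T t) : t ≤ T := S.t_mem.2

lemma norm_drift_le (S : Setting c lam T t) {p : Rn n} {g : ℝ → Rn n} {s R : ℝ}
    (hs : s ∈ Set.Icc t T) (hp : ‖p‖ ≤ c / 2 * R) (hg : ∀ σ ∈ Set.Icc t T, ‖g σ‖ ≤ c / 2 * R) :
    ‖drift lam T t p g s‖ ≤ rate c lam T * R := by
  have hlam := S.lam_pos
  have hT := S.T_pos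
  have ht := S.t_mem
  have hR : 0 ≤ c / 2 * R := (norm_nonneg _).trans hp
  have h1 : ‖((s - t) / lam) • p‖ ≤ T / lam * (c / 2 * R) := by
    rw [norm_smul, Real.norm_of_nonneg (div_nonneg (by linarith [hs.1]) hlam.le)]
    gcongr
    linarith [hs.2, ht.1]
  have h2 : ‖∫ σ in t..T, (min s σ - t) • g σ‖ ≤ T * (c / 2 * R) * |T - t| := by
    refine intervalIntegral.norm_integral_le_of_norm_le_const fun σ hσ => ?_
    rw [Set.uIoc_of_le S.t_le] at hσ
    have hmin : t ≤ min s σ := le_min hs.1 hσ.1.le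
    rw [norm_smul, Real.norm_of_nonneg (by linarith)]
    refine mul_le_mul ?_ (hg σ ⟨hσ.1.le, hσ.2⟩) (norm_nonneg _) hT.le
    linarith [min_le_left s σ, hs.2, ht.1]
  have h3 : |T - t| ≤ T := by
    rw [abs_of_nonneg (by linarith [ht.2])]; linarith [ht.1]
  calc ‖drift lam T t p g s‖ ≤ T / lam * (c / 2 * R) + 1 / lam * (T * (c / 2 * R) * T) := by
        refine (norm_add_le _ _).trans (add_le_add h1 ?_)
        rw [norm_smul, Real.norm_of_nonneg (by positivity)]
        gcongr
        exact h2.trans (by gcongr)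
    _ = rate c lam T * R := by unfold rate; field_simp

lemma drift_sub (S : Setting c lam T t) {p₁ p₂ : Rn n} {g₁ g₂ : ℝ → Rn n} {s : ℝ}
    (h₁ : ContinuousOn g₁ (Set.Icc t T)) (h₂ : ContinuousOn g₂ (Set.Icc t T)) :
    drift lam T t p₁ g₁ s - drift lam T t p₂ g₂ s =
      drift lam T t (p₁ - p₂) (fun σ => g₁ σ - g₂ σ) s := by
  have hi : ∀ {g : ℝ → Rn n}, ContinuousOn g (Set.Icc t T) →
      IntervalIntegrable (fun σ => (min s σ - t) • g σ) volume t T := fun hg => by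
    refine ContinuousOn.intervalIntegrable ?_
    rw [Set.uIcc_of_le S.t_le]
    have hmin : Continuous fun σ => min s σ - t := by fun_prop
    exact hmin.continuousOn.smul hg
  unfold drift
  simp only [smul_sub]
  rw [intervalIntegral.integral_sub (hi h₁) (hi h₂), smul_sub]
  abel

lemma norm_drift_sub_le (S : Setting c lam T t) {p₁ p₂ : Rn n} {g₁ g₂ : ℝ → Rn n} {s R : ℝ}
    (h₁ : ContinuousOn g₁ (Set.Icc t T)) (h₂ : ContinuousOn g₂ (Set.Icc t T))
    (hs : s ∈ Set.Icc t T) (hp : ‖p₁ - p₂‖ ≤ c / 2 * R)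
    (hg : ∀ σ ∈ Set.Icc t T, ‖g₁ σ - g₂ σ‖ ≤ c / 2 * R) :
    ‖drift lam T t p₁ g₁ s - drift lam T t p₂ g₂ s‖ ≤ rate c lam T * R := by
  rw [S.drift_sub h₁ h₂]
  exact S.norm_drift_le hs hp hg

end Setting

/-- The second moment of a variable with `‖Z‖ ≤ a ‖W‖ + b`. -/
lemma sqrt_integral_sq_le {Ω : Type*} [MeasurableSpace Ω] {P : Measure Ω} [IsProbabilityMeasure P]
    {Z W : Ω → Rn n} (hW : MemLp W 2 P) {a b : ℝ} (ha : 0 ≤ a) (hb : 0 ≤ b)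
    (h : ∀ q, ‖Z q‖ ≤ a * ‖W q‖ + b) :
    √(∫ q, ‖Z q‖ ^ 2 ∂P) ≤ a * √(∫ q, ‖W q‖ ^ 2 ∂P) + b := by
  set N := ∫ q, ‖W q‖ ^ 2 ∂P
  have hN : 0 ≤ N := integral_nonneg fun _ => by positivity
  have hW1 : ∫ q, ‖W q‖ ∂P ≤ √N := by
    have := ProbabilityTheory.variance_nonneg (fun q => ‖W q‖) P
    rw [ProbabilityTheory.variance_eq_sub hW.norm] at this
    refine Real.le_sqrt_of_sq_le ?_
    simpa using this
  have hi1 : Integrable (fun q => ‖W q‖) P := (hW.integrable (by norm_num)).norm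
  have hi2 := integrable_sq_of_memLp hW
  have hi3 : Integrable (fun q => a ^ 2 * ‖W q‖ ^ 2 + 2 * a * b * ‖W q‖) P :=
    (hi2.const_mul _).add (hi1.const_mul _)
  refine Real.sqrt_le_iff.2 ⟨by positivity, ?_⟩
  calc ∫ q, ‖Z q‖ ^ 2 ∂P ≤ ∫ q, (a ^ 2 * ‖W q‖ ^ 2 + 2 * a * b * ‖W q‖ + b ^ 2) ∂P := by
        refine integral_mono_of_nonneg (ae_of_all _ fun q => by positivity)
          (hi3.add (integrable_const _))
          (ae_of_all _ fun q => ?_)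
        refine (pow_le_pow_left₀ (norm_nonneg _) (h q) 2).trans (le_of_eq ?_)
        ring
    _ = a ^ 2 * N + 2 * a * b * (∫ q, ‖W q‖ ∂P) + b ^ 2 := by
        rw [integral_add hi3 (integrable_const _),
          integral_add (hi2.const_mul _) (hi1.const_mul _), integral_const_mul,
          integral_const_mul]
        simp [N]
    _ ≤ a ^ 2 * N + 2 * a * b * √N + b ^ 2 := by gcongr
    _ = (a * √N + b) ^ 2 := by rw [add_sq, mul_pow, Real.sq_sqrt hN]; ring

lemma IsDensity.memLp_id {m : Measure (Rn n)} (hm : IsDensity m) : MemLp (fun x : Rn n => x) 2 m :=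
  memLp_two_of_sq measurable_id.aestronglyMeasurable hm.moment

/-! ### Regular flows of maps -/

/-- Flows of maps `y(·, s)` that are continuous in time, of linear growth, and whose displacement
`y(·, s) - id` is `θ`-Lipschitz. For `θ < 1` these maps expand distances by a factor, hence they
transport densities to densities. -/
structure IsRegular (θ : ℝ) (y : Rn n → ℝ → Rn n) : Prop where
  continuous_time : ∀ x, Continuous (y x)
  lipschitz : ∀ s x₁ x₂, ‖(y x₁ s - x₁) - (y x₂ s - x₂)‖ ≤ θ * ‖x₁ - x₂‖
  growth : ∃ B ≥ 0, ∀ x s, ‖y x s‖ ≤ B * (1 + ‖x‖)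

namespace IsRegular

variable {θ : ℝ} {y : Rn n → ℝ → Rn n} {m : Measure (Rn n)}

lemma norm_sub_le (h : IsRegular θ y) (s : ℝ) (x₁ x₂ : Rn n) :
    ‖y x₁ s - y x₂ s‖ ≤ (1 + θ) * ‖x₁ - x₂‖ := by
  have h1 := h.lipschitz s x₁ x₂
  have h2 : y x₁ s - y x₂ s = (x₁ - x₂) + ((y x₁ s - x₁) - (y x₂ s - x₂)) := by abel
  rw [h2]
  exact (norm_add_le _ _).trans (by linarith)

lemma le_norm_sub (h : IsRegular θ y) (s : ℝ) (x₁ x₂ : Rn n) :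
    (1 - θ) * ‖x₁ - x₂‖ ≤ ‖y x₁ s - y x₂ s‖ := by
  have h1 := h.lipschitz s x₁ x₂
  have h2 : x₁ - x₂ = (y x₁ s - y x₂ s) - ((y x₁ s - x₁) - (y x₂ s - x₂)) := by abel
  have h3 : ‖x₁ - x₂‖ ≤ ‖y x₁ s - y x₂ s‖ + ‖(y x₁ s - x₁) - (y x₂ s - x₂)‖ := by
    conv_lhs => rw [h2]
    exact _root_.norm_sub_le _ _
  linarith

lemma continuous_uncurry (h : IsRegular θ y) (hθ : 0 ≤ θ) :
    Continuous (fun p : Rn n × ℝ => y p.1 p.2) :=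
  continuous_prod_of_continuous_lipschitzWith _ ⟨1 + θ, by positivity⟩
    (fun x => h.continuous_time x) fun s => LipschitzWith.of_dist_le_mul fun x₁ x₂ => by
      rw [dist_eq_norm, dist_eq_norm]
      exact h.norm_sub_le s x₁ x₂

lemma continuous_space (h : IsRegular θ y) (hθ : 0 ≤ θ) (s : ℝ) : Continuous fun x => y x s :=
  (h.continuous_uncurry hθ).comp (by fun_prop : Continuous fun x : Rn n => (x, s))

lemma memLp (h : IsRegular θ y) (hθ : 0 ≤ θ) (hm : IsDensity m) (s : ℝ) :
    MemLp (fun x => y x s) 2 m := by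
  have := hm.prob
  obtain ⟨B, hB, hy⟩ := h.growth
  have hg : MemLp (fun x : Rn n => 1 + ‖x‖) 2 m := (memLp_const (1 : ℝ)).add hm.memLp_id.norm
  refine hg.of_le_mul (c := B) (h.continuous_space hθ s).aestronglyMeasurable
    (ae_of_all _ fun x => ?_)
  rw [Real.norm_of_nonneg (by positivity)]
  exact hy x s

lemma isDensity_law (h : IsRegular θ y) (hθ : 0 ≤ θ) (hθ1 : θ < 1) (hm : IsDensity m) (s : ℝ) :
    IsDensity (law m y s) := by
  have := hm.prob
  have hc := h.continuous_space hθ s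
  refine IsDensity.of_map hc.aemeasurable ?_ (integrable_sq_of_memLp (h.memLp hθ hm s))
  refine absolutelyContinuous_map_of_antilipschitz hm.ac hc.measurable
    (K := ⟨(1 - θ)⁻¹, inv_nonneg.2 (by linarith)⟩) (AntilipschitzWith.of_le_mul_dist fun a b => ?_)
  rw [dist_eq_norm, dist_eq_norm]
  change _ ≤ (1 - θ)⁻¹ * _
  rw [inv_mul_eq_div, le_div_iff₀ (by linarith), mul_comm]
  exact h.le_norm_sub s a b

lemma tendsto_integral_sub_sq (h : IsRegular θ y) (hθ : 0 ≤ θ) (hm : IsDensity m) (s : ℝ) :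
    Tendsto (fun σ => ∫ x, ‖y x σ - y x s‖ ^ 2 ∂m) (𝓝 s) (𝓝 0) := by
  have := hm.prob
  obtain ⟨B, hB, hy⟩ := h.growth
  have hg : MemLp (fun x : Rn n => 1 + ‖x‖) 2 m := (memLp_const (1 : ℝ)).add hm.memLp_id.norm
  have hlim : Tendsto (fun σ => ∫ x, ‖y x σ - y x s‖ ^ 2 ∂m) (𝓝 s)
      (𝓝 (∫ x : Rn n, (0 : ℝ) ∂m)) := by
    refine tendsto_integral_filter_of_dominated_convergence
      (fun x => (2 * B) ^ 2 * (1 + ‖x‖) ^ 2) ?_ ?_ (hg.integrable_sq.const_mul _) ?_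
    · exact Eventually.of_forall fun σ =>
        (((h.continuous_space hθ σ).sub (h.continuous_space hθ s)).norm.pow 2).aestronglyMeasurable
    · refine Eventually.of_forall fun σ => ae_of_all _ fun x => ?_
      rw [Real.norm_of_nonneg (by positivity), ← mul_pow]
      refine pow_le_pow_left₀ (norm_nonneg _) ((_root_.norm_sub_le _ _).trans ?_) 2
      linarith [hy x σ, hy x s]
    · refine ae_of_all _ fun x => ?_
      have : Continuous fun σ => ‖y x σ - y x s‖ ^ 2 := by
        have := h.continuous_time x
        fun_prop
      exact this.tendsto' s 0 (by simp)
  simpa using hlim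

lemma tendsto_W2_law (h : IsRegular θ y) (hθ : 0 ≤ θ) (hm : IsDensity m) (s : ℝ) :
    Tendsto (fun σ => W2 (law m y σ) (law m y s)) (𝓝 s) (𝓝 0) := by
  have h1 := (Real.continuous_sqrt.tendsto 0).comp (h.tendsto_integral_sub_sq hθ hm s)
  rw [Real.sqrt_zero] at h1
  refine squeeze_zero (fun _ => W2_nonneg _ _) (fun σ => ?_) h1
  exact W2_map_le (h.memLp hθ hm σ).1.aemeasurable (h.memLp hθ hm s).1.aemeasurable
    (integrable_sq_of_memLp ((h.memLp hθ hm σ).sub (h.memLp hθ hm s)))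

/-- The force along the flow is jointly continuous. -/
lemma continuous_force (h : IsRegular θ y) (hθ : 0 ≤ θ) (hθ1 : θ < 1) (hm : IsDensity m) {c : ℝ}
    {Φ : Measure (Rn n) → ℝ} {Ψ : Rn n → Measure (Rn n) → ℝ} (hΨ : IsPotential c Φ Ψ) :
    Continuous fun p : Rn n × ℝ => Dx Ψ (y p.1 p.2) (law m y p.2) := by
  rw [continuous_iff_continuousAt]
  rintro ⟨x, s⟩
  rw [ContinuousAt, tendsto_iff_norm_sub_tendsto_zero]
  refine squeeze_zero (fun _ => norm_nonneg _) (fun p => hΨ.lipschitz _ _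
    (h.isDensity_law hθ hθ1 hm _) (h.isDensity_law hθ hθ1 hm _) _ _) ?_
  have h1 : Tendsto (fun p : Rn n × ℝ => ‖y p.1 p.2 - y x s‖) (𝓝 (x, s)) (𝓝 0) :=
    tendsto_iff_norm_sub_tendsto_zero.1 ((h.continuous_uncurry hθ).tendsto (x, s))
  have h2 : Tendsto (fun p : Rn n × ℝ => W2 (law m y p.2) (law m y s)) (𝓝 (x, s)) (𝓝 0) :=
    (h.tendsto_W2_law hθ hm s).comp (continuous_snd.tendsto (x, s))
  simpa using (h1.add h2).const_mul (c / 2)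

lemma continuous_force_time (h : IsRegular θ y) (hθ : 0 ≤ θ) (hθ1 : θ < 1) (hm : IsDensity m)
    {c : ℝ} {Φ : Measure (Rn n) → ℝ} {Ψ : Rn n → Measure (Rn n) → ℝ} (hΨ : IsPotential c Φ Ψ)
    (x : Rn n) : Continuous fun s => Dx Ψ (y x s) (law m y s) :=
  (h.continuous_force hθ hθ1 hm hΨ).comp (by fun_prop : Continuous fun s : ℝ => (x, s))

end IsRegular

/-! ### Existence of the flow by Picard iteration -/

/-- The time `s` brought back to `[t, T]`. -/
def clampTime (t T s : ℝ) : ℝ := max t (min s T)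

lemma clampTime_mem {t T : ℝ} (h : t ≤ T) (s : ℝ) : clampTime t T s ∈ Set.Icc t T :=
  ⟨le_max_left _ _, max_le h (min_le_right _ _)⟩

lemma clampTime_of_mem {t T s : ℝ} (hs : s ∈ Set.Icc t T) : clampTime t T s = s := by
  unfold clampTime
  rw [min_eq_left hs.2, max_eq_right hs.1]

@[fun_prop]
lemma continuous_clampTime (t T : ℝ) : Continuous (clampTime t T) := by
  unfold clampTime
  fun_prop

/-- The right-hand side of the flow equation, extended to all times by clamping. -/
noncomputable def flowMap (lam T : ℝ) (F FT : Rn n → Measure (Rn n) → ℝ) (t : ℝ)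
    (m : Measure (Rn n)) (y : Rn n → ℝ → Rn n) (x : Rn n) (s : ℝ) : Rn n :=
  x - drift lam T t (Dx FT (y x T) (law m y T)) (fun σ => Dx F (y x σ) (law m y σ))
    (clampTime t T s)

lemma continuous_drift {lam T t : ℝ} {p : Rn n} {g : ℝ → Rn n} (hg : Continuous g) :
    Continuous (drift lam T t p g) := by
  unfold drift
  have : Continuous fun s => ∫ σ in t..T, (min s σ - t) • g σ :=
    intervalIntegral.continuous_parametric_intervalIntegral_of_continuous'
      (by unfold Function.uncurry; fun_prop) t T
  fun_prop

section Existence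

variable {c lam T t : ℝ} {Φ ΦT : Measure (Rn n) → ℝ} {F FT : Rn n → Measure (Rn n) → ℝ}
  {m : Measure (Rn n)} {y y₁ y₂ : Rn n → ℝ → Rn n}

lemma sqrt_moment2_law_le (hm : IsDensity m) {a b : ℝ} (ha : 0 ≤ a) (hb : 0 ≤ b) {s : ℝ}
    (hy : AEMeasurable (fun x => y x s) m) (h : ∀ x, ‖y x s‖ ≤ a * ‖x‖ + b) :
    √(moment2 (law m y s)) ≤ a * √(moment2 m) + b := by
  have := hm.prob
  rw [law, moment2_map hy]
  exact sqrt_integral_sq_le hm.memLp_id ha hb h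

/-- The right-hand side of the flow equation preserves regularity: the displacement rate `θ` solves
`κ (1 + θ) = θ`. -/
lemma IsRegular.flowMap (S : Setting c lam T t) (hF : IsPotential c Φ F)
    (hFT : IsPotential c ΦT FT) (hm : IsDensity m) (h : IsRegular (dispRate c lam T) y) :
    IsRegular (dispRate c lam T) (flowMap lam T F FT t m y) where
  continuous_time x := by
    unfold MeanField.flowMap
    have := continuous_drift (lam := lam) (T := T) (t := t) (p := Dx FT (y x T) (law m y T))
      (h.continuous_force_time S.dispRate_nonneg S.dispRate_lt_one hm hF x)
    fun_prop
  lipschitz s x₁ x₂ := by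
    have hd := h.isDensity_law S.dispRate_nonneg S.dispRate_lt_one hm
    have hc := S.c_nonneg
    have hcont := h.continuous_force_time S.dispRate_nonneg S.dispRate_lt_one hm hF
    have key := S.norm_drift_sub_le (p₁ := Dx FT (y x₂ T) (law m y T))
      (p₂ := Dx FT (y x₁ T) (law m y T)) (R := (1 + dispRate c lam T) * ‖x₁ - x₂‖)
      (hcont x₂).continuousOn (hcont x₁).continuousOn (clampTime_mem S.t_le s) ?_ fun σ _ => ?_
    · rw [← mul_assoc, S.rate_mul_one_add] at key
      refine le_trans (le_of_eq ?_) key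
      unfold MeanField.flowMap
      congr 1
      abel
    · rw [norm_sub_rev]
      refine (hFT.lipschitz_space (hd T) _ _).trans ?_
      gcongr
      exact h.norm_sub_le T x₁ x₂
    · rw [norm_sub_rev]
      refine (hF.lipschitz_space (hd σ) _ _).trans ?_
      gcongr
      exact h.norm_sub_le σ x₁ x₂
  growth := by
    obtain ⟨B, hB, hy⟩ := h.growth
    have hc := S.c_nonneg
    have hr := S.rate_nonneg
    have hd := h.isDensity_law S.dispRate_nonneg S.dispRate_lt_one hm
    have hmom : ∀ s, √(moment2 (law m y s)) ≤ B * √(moment2 m) + B := fun s =>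
      sqrt_moment2_law_le hm hB hB (h.memLp S.dispRate_nonneg hm s).1.aemeasurable
        fun x => (hy x s).trans (le_of_eq (by ring))
    set E := B * √(moment2 m) + B
    have hE : 0 ≤ E := by positivity
    refine ⟨1 + rate c lam T * (1 + B + E), by positivity, fun x s => ?_⟩
    have key := S.norm_drift_le (p := Dx FT (y x T) (law m y T))
      (g := fun σ => Dx F (y x σ) (law m y σ)) (R := 1 + B * (1 + ‖x‖) + E)
      (clampTime_mem S.t_le s) ?_ fun σ _ => ?_
    · refine (_root_.norm_sub_le _ _).trans ((add_le_add_right key _).trans ?_)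
      have hx := norm_nonneg x
      have e : (1 + rate c lam T * (1 + B + E)) * (1 + ‖x‖) - (‖x‖ + rate c lam T *
          (1 + B * (1 + ‖x‖) + E)) = 1 + rate c lam T * ((1 + E) * ‖x‖) := by ring
      have : 0 ≤ rate c lam T * ((1 + E) * ‖x‖) := by positivity
      linarith
    · refine (hFT.growth _ (hd T) _).trans ?_
      gcongr
      exacts [hy x T, hmom T]
    · refine (hF.growth _ (hd σ) _).trans ?_
      gcongr
      exacts [hy x σ, hmom σ]

/-- One step of the contraction estimate, for the weighted distance with weight `‖x‖ + K`. -/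
lemma norm_flowMap_sub_le (S : Setting c lam T t) (hF : IsPotential c Φ F)
    (hFT : IsPotential c ΦT FT) (hm : IsDensity m) (h₁ : IsRegular (dispRate c lam T) y₁)
    (h₂ : IsRegular (dispRate c lam T) y₂) {N K : ℝ} (hN : 0 ≤ N) (hK : 0 ≤ K)
    (h : ∀ x s, ‖y₁ x s - y₂ x s‖ ≤ N * (‖x‖ + K)) (x : Rn n) (s : ℝ) :
    ‖flowMap lam T F FT t m y₁ x s - flowMap lam T F FT t m y₂ x s‖ ≤
      rate c lam T * (N * (‖x‖ + K) + N * (√(moment2 m) + K)) := by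
  have := hm.prob
  have hθ := S.dispRate_nonneg
  have hθ1 := S.dispRate_lt_one
  have hc := S.c_nonneg
  have hd₁ := h₁.isDensity_law hθ hθ1 hm
  have hd₂ := h₂.isDensity_law hθ hθ1 hm
  have hW : ∀ s, W2 (law m y₂ s) (law m y₁ s) ≤ N * (√(moment2 m) + K) := fun s => by
    rw [W2_comm]
    refine (W2_map_le (h₁.memLp hθ hm s).1.aemeasurable (h₂.memLp hθ hm s).1.aemeasurable
      (integrable_sq_of_memLp ((h₁.memLp hθ hm s).sub (h₂.memLp hθ hm s)))).trans ?_
    refine (sqrt_integral_sq_le hm.memLp_id hN (mul_nonneg hN hK) fun x =>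
      (h x s).trans (le_of_eq (mul_add _ _ _))).trans (le_of_eq ?_)
    rw [mul_add]; rfl
  have h' : ∀ x s, ‖y₂ x s - y₁ x s‖ ≤ N * (‖x‖ + K) := fun x s => by
    rw [norm_sub_rev]; exact h x s
  have key := S.norm_drift_sub_le (p₁ := Dx FT (y₂ x T) (law m y₂ T))
    (p₂ := Dx FT (y₁ x T) (law m y₁ T)) (R := N * (‖x‖ + K) + N * (√(moment2 m) + K))
    (h₂.continuous_force_time hθ hθ1 hm hF x).continuousOn
    (h₁.continuous_force_time hθ hθ1 hm hF x).continuousOn (clampTime_mem S.t_le s) ?_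
    fun σ _ => ?_
  · refine le_trans (le_of_eq ?_) key
    unfold flowMap
    congr 1
    abel
  · refine (hFT.lipschitz _ _ (hd₂ T) (hd₁ T) _ _).trans ?_
    gcongr
    exacts [h' x T, hW T]
  · refine (hF.lipschitz _ _ (hd₂ σ) (hd₁ σ) _ _).trans ?_
    gcongr
    exacts [h' x σ, hW σ]

/-- A pointwise limit of regular flows, uniform for the weight `‖x‖ + K`, is regular. -/
lemma IsRegular.of_tendsto {θ : ℝ} {Y : ℕ → Rn n → ℝ → Rn n} (hY : ∀ k, IsRegular θ (Y k))
    {a : ℕ → ℝ} (ha : Tendsto a atTop (𝓝 0)) {K : ℝ}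
    (h : ∀ k x s, ‖Y k x s - y x s‖ ≤ a k * (‖x‖ + K)) : IsRegular θ y := by
  have hlim : ∀ x s, Tendsto (fun k => Y k x s) atTop (𝓝 (y x s)) := fun x s => by
    rw [tendsto_iff_norm_sub_tendsto_zero]
    refine squeeze_zero (fun _ => norm_nonneg _) (fun k => h k x s) ?_
    simpa using ha.mul_const (‖x‖ + K)
  refine ⟨fun x => ?_, fun s x₁ x₂ => ?_, ?_⟩
  · have hu : TendstoUniformly (fun k s => Y k x s) (y x) atTop := by
      rw [Metric.tendstoUniformly_iff]
      intro ε hε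
      have := (ha.mul_const (‖x‖ + K)).eventually_lt_const (u := ε) (by simpa using hε)
      filter_upwards [this] with k hk s
      rw [dist_comm, dist_eq_norm]
      exact (h k x s).trans_lt hk
    exact hu.continuous (Frequently.of_forall fun k => (hY k).continuous_time x)
  · exact le_of_tendsto (((hlim x₁ s).sub_const _).sub ((hlim x₂ s).sub_const _)).norm
      (Eventually.of_forall fun k => (hY k).lipschitz s x₁ x₂)
  · obtain ⟨B, hB, hy⟩ := (hY 0).growth
    refine ⟨B + |a 0| * (1 + |K|), by positivity, fun x s => ?_⟩
    have h1 := h 0 x s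
    have h2 : ‖y x s‖ ≤ ‖Y 0 x s‖ + ‖Y 0 x s - y x s‖ := by
      conv_lhs => rw [show y x s = Y 0 x s - (Y 0 x s - y x s) by abel]
      exact _root_.norm_sub_le _ _
    have h3 : a 0 * (‖x‖ + K) ≤ |a 0| * (1 + |K|) * (1 + ‖x‖) := by
      have hx := norm_nonneg x
      have hK := abs_nonneg K
      calc a 0 * (‖x‖ + K) ≤ |a 0 * (‖x‖ + K)| := le_abs_self _
        _ = |a 0| * |‖x‖ + K| := abs_mul _ _
        _ ≤ |a 0| * ((1 + |K|) * (1 + ‖x‖)) := by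
            gcongr
            refine (abs_add_le _ _).trans ?_
            rw [abs_norm]
            nlinarith
        _ = _ := by ring
    have := hy x s
    linarith

/-- The flow exists: the Picard iterates converge geometrically for the weight `‖x‖ + K`. -/
lemma exists_isRegular_flow (S : Setting c lam T t) (hF : IsPotential c Φ F)
    (hFT : IsPotential c ΦT FT) (hm : IsDensity m) :
    ∃ y : Rn n → ℝ → Rn n, IsRegular (dispRate c lam T) y ∧
      ∀ x s, y x s = flowMap lam T F FT t m y x s := by
  have := hm.prob
  have hr := S.rate_nonneg
  have hr2 := S.rate_lt
  have hθ := S.dispRate_nonneg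
  have hc := S.c_nonneg
  set κ := rate c lam T with hκ
  set M := √(moment2 m) with hM
  have hM0 : 0 ≤ M := Real.sqrt_nonneg _
  set q : ℝ := (1 + 2 * κ) / 2 with hq
  -- the weight is chosen so that `κ (2 K + M) ≤ q K`
  set K : ℝ := 1 + M + 2 * κ * M / (1 - 2 * κ) with hKdef
  have hdiv : 0 ≤ 2 * κ * M / (1 - 2 * κ) := div_nonneg (by positivity) (by linarith)
  have hK : 0 ≤ K := by positivity
  have hq1 : q < 1 := by linarith
  have hq0 : 0 ≤ q := by positivity
  have hstep : ∀ (x : Rn n) (N : ℝ), 0 ≤ N →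
      κ * (N * (‖x‖ + K) + N * (M + K)) ≤ N * q * (‖x‖ + K) := fun x N hN => by
    have h1 : κ * M = (1 - 2 * κ) / 2 * (2 * κ * M / (1 - 2 * κ)) := by
      have : 1 - 2 * κ ≠ 0 := by linarith
      rw [div_mul_div_comm, eq_div_iff (by positivity)]
      ring
    have h2 : κ * M ≤ (1 - 2 * κ) / 2 * K := by
      rw [h1]
      have : 2 * κ * M / (1 - 2 * κ) ≤ K := by linarith
      have h3 : 0 ≤ (1 - 2 * κ) / 2 := by linarith
      gcongr
    have h4 : κ * (‖x‖ + K + (M + K)) ≤ q * (‖x‖ + K) := by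
      have hx := norm_nonneg x
      have : κ * ‖x‖ ≤ q * ‖x‖ := by gcongr; linarith
      have e : q * K = 2 * κ * K + (1 - 2 * κ) / 2 * K := by rw [hq]; ring
      have : κ * (‖x‖ + K + (M + K)) = κ * ‖x‖ + 2 * κ * K + κ * M := by ring
      rw [mul_add q]
      linarith
    calc κ * (N * (‖x‖ + K) + N * (M + K)) = N * (κ * (‖x‖ + K + (M + K))) := by ring
      _ ≤ N * (q * (‖x‖ + K)) := by gcongr
      _ = _ := by ring
  let Y : ℕ → Rn n → ℝ → Rn n := fun k => (flowMap lam T F FT t m)^[k] fun x _ => x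
  have hYs : ∀ k, Y (k + 1) = flowMap lam T F FT t m (Y k) := fun k =>
    Function.iterate_succ_apply' _ _ _
  have hY0 : IsRegular (dispRate c lam T) (Y 0) :=
    ⟨fun x => continuous_const, fun s x₁ x₂ => by simp [Y]; positivity,
      1, zero_le_one, fun x s => by simp [Y]⟩
  have hY : ∀ k, IsRegular (dispRate c lam T) (Y k) := fun k => by
    induction k with
    | zero => exact hY0
    | succ k ih => rw [hYs]; exact ih.flowMap S hF hFT hm
  have hinc : ∀ k x s, ‖Y k x s - Y (k + 1) x s‖ ≤ κ * q ^ k * (‖x‖ + K) := by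
    intro k
    induction k with
    | zero =>
      intro x s
      have hl : law m (Y 0) = fun _ => m := by
        funext s
        exact Measure.map_id
      have key := S.norm_drift_le (p := Dx FT (Y 0 x T) (law m (Y 0) T))
        (g := fun σ => Dx F (Y 0 x σ) (law m (Y 0) σ)) (R := 1 + ‖x‖ + M)
        (clampTime_mem S.t_le s) (by rw [hl]; exact hFT.growth m hm x)
        fun σ _ => by rw [hl]; exact hF.growth m hm x
      rw [hYs]
      have e : Y 0 x s - flowMap lam T F FT t m (Y 0) x s =
          drift lam T t (Dx FT (Y 0 x T) (law m (Y 0) T))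
            (fun σ => Dx F (Y 0 x σ) (law m (Y 0) σ)) (clampTime t T s) := by
        simp only [flowMap, sub_sub_cancel, Y, Function.iterate_zero, id_eq]
      rw [e]
      refine key.trans ?_
      rw [pow_zero, mul_one]
      exact mul_le_mul_of_nonneg_left (by linarith) hr
    | succ k ih =>
      intro x s
      rw [hYs (k + 1)]
      rw [show Y (k + 1) x s = flowMap lam T F FT t m (Y k) x s by rw [hYs]]
      refine (norm_flowMap_sub_le S hF hFT hm (hY k) (hY (k + 1)) (by positivity) hK ih
        x s).trans ((hstep x _ (by positivity)).trans (le_of_eq ?_))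
      rw [pow_succ]; ring
  have hgeo : ∀ x s, ∀ k, dist (Y k x s) (Y (k + 1) x s) ≤ κ * (‖x‖ + K) * q ^ k :=
    fun x s k => by
      rw [dist_eq_norm]
      exact (hinc k x s).trans (le_of_eq (by ring))
  choose y hy using fun x s => cauchySeq_tendsto_of_complete
    (cauchySeq_of_le_geometric q _ hq1 (hgeo x s))
  have hb : ∀ k x s, ‖Y k x s - y x s‖ ≤ κ * q ^ k / (1 - q) * (‖x‖ + K) := fun k x s => by
    rw [← dist_eq_norm]
    exact (dist_le_of_le_geometric_of_tendsto q _ hq1 (hgeo x s) (hy x s) k).trans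
      (le_of_eq (by ring))
  have ha : Tendsto (fun k : ℕ => κ * q ^ k / (1 - q)) atTop (𝓝 0) := by
    simpa using ((tendsto_pow_atTop_nhds_zero_of_lt_one hq0 hq1).const_mul κ).div_const (1 - q)
  have hreg : IsRegular (dispRate c lam T) y := IsRegular.of_tendsto hY ha hb
  refine ⟨y, hreg, fun x s => ?_⟩
  refine tendsto_nhds_unique ((hy x s).comp (tendsto_add_atTop_nat 1)) ?_
  rw [tendsto_iff_norm_sub_tendsto_zero]
  have h1q : 0 ≤ 1 - q := by linarith
  refine squeeze_zero (fun _ => norm_nonneg _) (fun k => ?_)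
    (g := fun k => κ * q ^ k / (1 - q) * q * (‖x‖ + K)) ?_
  · simp only [Function.comp_apply]
    rw [hYs]
    have hn : 0 ≤ κ * q ^ k / (1 - q) := by positivity
    exact (norm_flowMap_sub_le S hF hFT hm (hY k) hreg hn hK (hb k) x s).trans
      (hstep x _ hn)
  · simpa using (ha.mul_const q).mul_const (‖x‖ + K)

/-- A regular fixed point of the right-hand side solves the flow equation. -/
lemma IsRegular.isFlow (S : Setting c lam T t) (hm : IsDensity m)
    (h : IsRegular (dispRate c lam T) y)
    (hy : ∀ x s, y x s = MeanField.flowMap lam T F FT t m y x s) :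
    IsFlow lam T F FT t m y where
  continuous_time x := (h.continuous_time x).continuousOn
  memLp s _ := h.memLp S.dispRate_nonneg hm s
  continuous_L2 s _ := by
    have h0 := h.tendsto_integral_sub_sq S.dispRate_nonneg hm s
    have h1 : Tendsto (fun σ => eLpNorm (fun x => y x σ - y x s) 2 m) (𝓝 s) (𝓝 0) := by
      have h2 : ∀ σ, eLpNorm (fun x => y x σ - y x s) 2 m =
          ENNReal.ofReal (√(∫ x, ‖y x σ - y x s‖ ^ 2 ∂m)) := fun σ =>
        eLpNorm_two_eq ((h.memLp S.dispRate_nonneg hm σ).sub (h.memLp S.dispRate_nonneg hm s))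
      simp_rw [h2]
      have h3 := ENNReal.tendsto_ofReal ((Real.continuous_sqrt.tendsto 0).comp h0)
      simpa using h3
    exact h1.mono_left nhdsWithin_le_nhds
  density s _ := h.isDensity_law S.dispRate_nonneg S.dispRate_lt_one hm s
  eqn x s hs := by
    rw [hy x s]
    unfold MeanField.flowMap drift
    rw [clampTime_of_mem hs, sub_sub]

end Existence

/-! ### Stability, uniqueness and growth of the flow -/

section Estimates

variable {c lam T t : ℝ} {Φ ΦT : Measure (Rn n) → ℝ} {F FT : Rn n → Measure (Rn n) → ℝ}
  {m m₁ m₂ : Measure (Rn n)} {y y₁ y₂ : Rn n → ℝ → Rn n}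

lemma IsFlow.eq_sub_drift (h : IsFlow lam T F FT t m y) (x : Rn n) {s : ℝ}
    (hs : s ∈ Set.Icc t T) :
    y x s = x - drift lam T t (Dx FT (y x T) (law m y T))
      (fun σ => Dx F (y x σ) (law m y σ)) s := by
  rw [drift, ← sub_sub]
  exact h.eqn x s hs

lemma IsFlow.tendsto_sqrt_integral_sub_sq (h : IsFlow lam T F FT t m y) {s : ℝ}
    (hs : s ∈ Set.Icc t T) : Tendsto (fun σ => √(∫ x, ‖y x σ - y x s‖ ^ 2 ∂m))
      (𝓝[Set.Icc t T] s) (𝓝 0) := by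
  have h1 := (ENNReal.tendsto_toReal ENNReal.zero_ne_top).comp (h.continuous_L2 s hs)
  refine h1.congr' ?_
  filter_upwards [self_mem_nhdsWithin] with σ hσ
  have := eLpNorm_two_eq ((h.memLp σ hσ).sub (h.memLp s hs))
  simp only [Pi.sub_def] at this
  rw [Function.comp_apply, this, ENNReal.toReal_ofReal (Real.sqrt_nonneg _)]

lemma IsFlow.continuousOn_force (h : IsFlow lam T F FT t m y) {Ψ : Rn n → Measure (Rn n) → ℝ}
    (hΨ : IsPotential c Φ Ψ) (x : Rn n) :
    ContinuousOn (fun σ => Dx Ψ (y x σ) (law m y σ)) (Set.Icc t T) := by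
  intro s hs
  rw [ContinuousWithinAt, tendsto_iff_norm_sub_tendsto_zero]
  have h1 : Tendsto (fun σ => ‖y x σ - y x s‖) (𝓝[Set.Icc t T] s) (𝓝 0) :=
    tendsto_iff_norm_sub_tendsto_zero.1 (h.continuous_time x s hs)
  have h2 := ((h1.add (h.tendsto_sqrt_integral_sub_sq hs)).const_mul (c / 2))
  rw [add_zero, mul_zero] at h2
  have hc : 0 ≤ c := hΨ.nonneg (h.density s hs)
  refine squeeze_zero' (Eventually.of_forall fun _ => norm_nonneg _) ?_ h2
  filter_upwards [self_mem_nhdsWithin] with σ hσ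
  refine (hΨ.lipschitz _ _ (h.density σ hσ) (h.density s hs) _ _).trans ?_
  gcongr
  exact W2_map_le (h.memLp σ hσ).1.aemeasurable (h.memLp s hs).1.aemeasurable
    (integrable_sq_of_memLp ((h.memLp σ hσ).sub (h.memLp s hs)))

lemma IsFlow.exists_moment2_le (h : IsFlow lam T F FT t m y) :
    ∃ R, 0 ≤ R ∧ ∀ s ∈ Set.Icc t T, moment2 (law m y s) ≤ R := by
  suffices ∃ R, ∀ s ∈ Set.Icc t T, moment2 (law m y s) ≤ R by
    obtain ⟨R, hR⟩ := this
    exact ⟨|R|, abs_nonneg _, fun s hs => (hR s hs).trans (le_abs_self _)⟩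
  refine isCompact_Icc.induction_on (p := fun A => ∃ R, ∀ s ∈ A, moment2 (law m y s) ≤ R)
    ⟨0, by simp⟩ ?_ ?_ ?_
  · rintro A B hAB ⟨R, hR⟩
    exact ⟨R, fun s hs => hR s (hAB hs)⟩
  · rintro A B ⟨R, hR⟩ ⟨R', hR'⟩
    exact ⟨max R R', fun s hs => hs.elim (fun h => (hR s h).trans (le_max_left _ _))
      fun h => (hR' s h).trans (le_max_right _ _)⟩
  · intro s hs
    refine ⟨{σ | σ ∈ Set.Icc t T ∧ √(∫ x, ‖y x σ - y x s‖ ^ 2 ∂m) < 1},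
      inter_mem self_mem_nhdsWithin
        ((h.tendsto_sqrt_integral_sub_sq hs).eventually_lt_const one_pos),
      2 + 2 * moment2 (law m y s), ?_⟩
    rintro σ ⟨hσ, hlt⟩
    rw [law, law, moment2_map (h.memLp σ hσ).1.aemeasurable,
      moment2_map (h.memLp s hs).1.aemeasurable]
    have h3 : ∫ x, ‖y x σ - y x s‖ ^ 2 ∂m ≤ 1 := by
      have := (Real.sqrt_lt' one_pos).1 hlt
      linarith
    have h4 := integral_norm_add_sq_le ((h.memLp σ hσ).sub (h.memLp s hs)) (h.memLp s hs)
    simp only [Pi.sub_apply, sub_add_cancel] at h4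
    linarith

/-- Pathwise comparison of two flows whose laws stay at distance at most `D`. -/
lemma IsFlow.norm_sub_le (S : Setting c lam T t) (hF : IsPotential c Φ F)
    (hFT : IsPotential c ΦT FT) (h₁ : IsFlow lam T F FT t m₁ y₁) (h₂ : IsFlow lam T F FT t m₂ y₂)
    {D : ℝ} (hD : ∀ s ∈ Set.Icc t T, W2 (law m₁ y₁ s) (law m₂ y₂ s) ≤ D) (x₁ x₂ : Rn n) {s : ℝ}
    (hs : s ∈ Set.Icc t T) :
    ‖y₁ x₁ s - y₂ x₂ s‖ ≤ (‖x₁ - x₂‖ + rate c lam T * D) / (1 - rate c lam T) := by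
  have hr := S.rate_nonneg
  have hr2 := S.rate_lt
  have hc := S.c_nonneg
  obtain ⟨s₀, hs₀, hmax⟩ := isCompact_Icc.exists_isMaxOn ⟨s, hs⟩
    ((h₁.continuous_time x₁).sub (h₂.continuous_time x₂)).norm
  set d := ‖y₁ x₁ s₀ - y₂ x₂ s₀‖
  have hd : ∀ σ ∈ Set.Icc t T, ‖y₁ x₁ σ - y₂ x₂ σ‖ ≤ d := fun σ hσ => hmax hσ
  refine (hd s hs).trans ?_
  rw [le_div_iff₀ (by linarith)]
  have hT : T ∈ Set.Icc t T := ⟨S.t_le, le_rfl⟩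
  have key := S.norm_drift_sub_le (p₁ := Dx FT (y₁ x₁ T) (law m₁ y₁ T))
    (p₂ := Dx FT (y₂ x₂ T) (law m₂ y₂ T)) (R := d + D)
    (h₁.continuousOn_force hF x₁) (h₂.continuousOn_force hF x₂) hs₀ ?_ fun σ hσ => ?_
  · have h3 : d ≤ ‖x₁ - x₂‖ + rate c lam T * (d + D) := by
      refine le_trans ?_ (add_le_add_right key _)
      have e : y₁ x₁ s₀ - y₂ x₂ s₀ = (x₁ - x₂) -
          (drift lam T t (Dx FT (y₁ x₁ T) (law m₁ y₁ T))
            (fun σ => Dx F (y₁ x₁ σ) (law m₁ y₁ σ)) s₀ -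
          drift lam T t (Dx FT (y₂ x₂ T) (law m₂ y₂ T))
            (fun σ => Dx F (y₂ x₂ σ) (law m₂ y₂ σ)) s₀) := by
        rw [h₁.eq_sub_drift x₁ hs₀, h₂.eq_sub_drift x₂ hs₀]
        abel
      calc d = _ := congrArg norm e
        _ ≤ _ := _root_.norm_sub_le _ _
    linarith
  · refine (hFT.lipschitz _ _ (h₁.density T hT) (h₂.density T hT) _ _).trans ?_
    gcongr
    exacts [hd T hT, hD T hT]
  · refine (hF.lipschitz _ _ (h₁.density σ hσ) (h₂.density σ hσ) _ _).trans ?_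
    gcongr
    exacts [hd σ hσ, hD σ hσ]

lemma IsFlow.norm_le_of_moment (S : Setting c lam T t) (hF : IsPotential c Φ F)
    (hFT : IsPotential c ΦT FT) (h : IsFlow lam T F FT t m y)
    {D : ℝ} (hD : ∀ s ∈ Set.Icc t T, √(moment2 (law m y s)) ≤ D) (x : Rn n) {s : ℝ}
    (hs : s ∈ Set.Icc t T) :
    ‖y x s‖ ≤ (‖x‖ + rate c lam T * (1 + D)) / (1 - rate c lam T) := by
  have hr := S.rate_nonneg
  have hr2 := S.rate_lt
  have hc := S.c_nonneg
  obtain ⟨s₀, hs₀, hmax⟩ := isCompact_Icc.exists_isMaxOn ⟨s, hs⟩ (h.continuous_time x).norm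
  set d := ‖y x s₀‖
  have hd : ∀ σ ∈ Set.Icc t T, ‖y x σ‖ ≤ d := fun σ hσ => hmax hσ
  refine (hd s hs).trans ?_
  rw [le_div_iff₀ (by linarith)]
  have hT : T ∈ Set.Icc t T := ⟨S.t_le, le_rfl⟩
  have key := S.norm_drift_le (p := Dx FT (y x T) (law m y T))
    (g := fun σ => Dx F (y x σ) (law m y σ)) (R := 1 + d + D) hs₀ ?_ fun σ hσ => ?_
  · have h3 : d ≤ ‖x‖ + rate c lam T * (1 + d + D) := by
      refine le_trans ?_ (add_le_add_right key _)
      calc d = _ := congrArg norm (h.eq_sub_drift x hs₀)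
        _ ≤ _ := _root_.norm_sub_le _ _
    linarith
  · refine (hFT.growth _ (h.density T hT) _).trans ?_
    gcongr
    exacts [hd T hT, hD T hT]
  · refine (hF.growth _ (h.density σ hσ) _).trans ?_
    gcongr
    exacts [hd σ hσ, hD σ hσ]

lemma IsFlow.sqrt_moment2_le (S : Setting c lam T t) (hF : IsPotential c Φ F)
    (hFT : IsPotential c ΦT FT) (hm : IsDensity m) (h : IsFlow lam T F FT t m y) {s : ℝ}
    (hs : s ∈ Set.Icc t T) :
    √(moment2 (law m y s)) ≤ (√(moment2 m) + rate c lam T) / (1 - 2 * rate c lam T) := by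
  have hr := S.rate_nonneg
  have hr2 := S.rate_lt
  obtain ⟨R, hR0, hR⟩ := h.exists_moment2_le
  set A := (fun s => √(moment2 (law m y s))) '' Set.Icc t T
  have hA : BddAbove A := ⟨√R, by
    rintro _ ⟨σ, hσ, rfl⟩
    exact Real.sqrt_le_sqrt (hR σ hσ)⟩
  have hD : ∀ σ ∈ Set.Icc t T, √(moment2 (law m y σ)) ≤ sSup A := fun σ hσ =>
    le_csSup hA ⟨σ, hσ, rfl⟩
  have hD0 : 0 ≤ sSup A := (Real.sqrt_nonneg _).trans (hD s hs)
  refine (hD s hs).trans ?_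
  have h1r : 0 < 1 - rate c lam T := by linarith
  have key : sSup A ≤ (√(moment2 m) + rate c lam T * (1 + sSup A)) / (1 - rate c lam T) := by
    refine csSup_le ⟨_, s, hs, rfl⟩ ?_
    rintro _ ⟨σ, hσ, rfl⟩
    refine (sqrt_moment2_law_le hm (a := 1 / (1 - rate c lam T))
      (b := rate c lam T * (1 + sSup A) / (1 - rate c lam T)) (by positivity) (by positivity)
      (h.memLp σ hσ).1.aemeasurable fun x => ?_).trans (le_of_eq (by ring))
    exact (h.norm_le_of_moment S hF hFT hD x hσ).trans (le_of_eq (by ring))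
  rw [le_div_iff₀ h1r] at key
  rw [le_div_iff₀ (by linarith)]
  linarith

section Coupling

variable {Ω : Type*} [MeasurableSpace Ω] {P : Measure Ω} {X₁ X₂ : Ω → Rn n}

lemma law_map (hX : Measurable X₁) {s : ℝ}
    (hy : AEMeasurable (fun x => y x s) (P.map X₁)) :
    law (P.map X₁) y s = P.map fun q => y (X₁ q) s :=
  AEMeasurable.map_map_of_aemeasurable hy hX.aemeasurable

/-- Stability of the flow with respect to the initial law. -/
lemma IsFlow.W2_law_le (S : Setting c lam T t) (hF : IsPotential c Φ F)
    (hFT : IsPotential c ΦT FT) [IsProbabilityMeasure P] (hX₁ : Measurable X₁)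
    (hX₂ : Measurable X₂) (hd₁ : IsDensity (P.map X₁)) (hd₂ : IsDensity (P.map X₂))
    (h₁ : IsFlow lam T F FT t (P.map X₁) y₁) (h₂ : IsFlow lam T F FT t (P.map X₂) y₂) {s : ℝ}
    (hs : s ∈ Set.Icc t T) :
    W2 (law (P.map X₁) y₁ s) (law (P.map X₂) y₂ s) ≤
      √(∫ q, ‖X₁ q - X₂ q‖ ^ 2 ∂P) / (1 - 2 * rate c lam T) := by
  have hr := S.rate_nonneg
  have hr2 := S.rate_lt
  have hL₁ : ∀ σ ∈ Set.Icc t T, MemLp (fun q => y₁ (X₁ q) σ) 2 P := fun σ hσ =>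
    (h₁.memLp σ hσ).comp_of_map hX₁.aemeasurable
  have hL₂ : ∀ σ ∈ Set.Icc t T, MemLp (fun q => y₂ (X₂ q) σ) 2 P := fun σ hσ =>
    (h₂.memLp σ hσ).comp_of_map hX₂.aemeasurable
  have hX₁2 : MemLp X₁ 2 P := hd₁.memLp_id.comp_of_map hX₁.aemeasurable
  have hX₂2 : MemLp X₂ 2 P := hd₂.memLp_id.comp_of_map hX₂.aemeasurable
  have hW : ∀ σ ∈ Set.Icc t T, W2 (law (P.map X₁) y₁ σ) (law (P.map X₂) y₂ σ) ≤
      √(∫ q, ‖y₁ (X₁ q) σ - y₂ (X₂ q) σ‖ ^ 2 ∂P) := fun σ hσ => by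
    rw [law_map hX₁ (h₁.memLp σ hσ).1.aemeasurable, law_map hX₂ (h₂.memLp σ hσ).1.aemeasurable]
    exact W2_map_le (hL₁ σ hσ).1.aemeasurable (hL₂ σ hσ).1.aemeasurable
      (integrable_sq_of_memLp ((hL₁ σ hσ).sub (hL₂ σ hσ)))
  set A := (fun s => W2 (law (P.map X₁) y₁ s) (law (P.map X₂) y₂ s)) '' Set.Icc t T
  have hA : BddAbove A := by
    obtain ⟨R₁, hR₁0, hR₁⟩ := h₁.exists_moment2_le
    obtain ⟨R₂, hR₂0, hR₂⟩ := h₂.exists_moment2_le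
    refine ⟨√(2 * R₁ + 2 * R₂), ?_⟩
    rintro _ ⟨σ, hσ, rfl⟩
    refine (hW σ hσ).trans (Real.sqrt_le_sqrt ?_)
    have e₁ := hR₁ σ hσ
    have e₂ := hR₂ σ hσ
    rw [law_map hX₁ (h₁.memLp σ hσ).1.aemeasurable, moment2_map (hL₁ σ hσ).1.aemeasurable] at e₁
    rw [law_map hX₂ (h₂.memLp σ hσ).1.aemeasurable, moment2_map (hL₂ σ hσ).1.aemeasurable] at e₂
    have h3 := integral_norm_add_sq_le (hL₁ σ hσ) (hL₂ σ hσ).neg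
    simp only [Pi.neg_apply, norm_neg, ← sub_eq_add_neg] at h3
    linarith
  have hD : ∀ σ ∈ Set.Icc t T, W2 (law (P.map X₁) y₁ σ) (law (P.map X₂) y₂ σ) ≤ sSup A :=
    fun σ hσ => le_csSup hA ⟨σ, hσ, rfl⟩
  have hD0 : 0 ≤ sSup A := (W2_nonneg _ _).trans (hD s hs)
  refine (hD s hs).trans ?_
  have h1r : 0 < 1 - rate c lam T := by linarith
  have key : sSup A ≤ (√(∫ q, ‖X₁ q - X₂ q‖ ^ 2 ∂P) + rate c lam T * sSup A) /
      (1 - rate c lam T) := by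
    refine csSup_le ⟨_, s, hs, rfl⟩ ?_
    rintro _ ⟨σ, hσ, rfl⟩
    refine (hW σ hσ).trans ?_
    refine (sqrt_integral_sq_le (W := fun q => X₁ q - X₂ q) (hX₁2.sub hX₂2)
      (a := 1 / (1 - rate c lam T)) (b := rate c lam T * sSup A / (1 - rate c lam T))
      (by positivity) (by positivity) fun q => ?_).trans (le_of_eq (by ring))
    exact (h₁.norm_sub_le S hF hFT h₂ hD _ _ hσ).trans (le_of_eq (by ring))
  rw [le_div_iff₀ h1r] at key
  rw [le_div_iff₀ (by linarith)]
  linarith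

end Coupling

lemma IsFlow.unique (S : Setting c lam T t) (hF : IsPotential c Φ F)
    (hFT : IsPotential c ΦT FT) (hm : IsDensity m) (h₁ : IsFlow lam T F FT t m y₁)
    (h₂ : IsFlow lam T F FT t m y₂) (x : Rn n) {s : ℝ} (hs : s ∈ Set.Icc t T) :
    y₁ x s = y₂ x s := by
  have := hm.prob
  have hid : m.map id = m := Measure.map_id
  have key : ∀ σ ∈ Set.Icc t T, W2 (law m y₁ σ) (law m y₂ σ) ≤ 0 := fun σ hσ => by
    have := IsFlow.W2_law_le (P := m) (X₁ := id) (X₂ := id) (y₁ := y₁) (y₂ := y₂) S hF hFT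
      measurable_id measurable_id (by rwa [hid]) (by rwa [hid]) (by rwa [hid]) (by rwa [hid]) hσ
    simpa [hid] using this
  have := h₁.norm_sub_le S hF hFT h₂ key x x hs
  rw [sub_self, norm_zero, mul_zero, add_zero, zero_div] at this
  exact sub_eq_zero.1 (norm_le_zero_iff.1 this)

end Estimates

/-! ### Integration by parts along paths with integrable velocity -/

lemma intervalIntegral_eq_Icc {E : Type*} [NormedAddCommGroup E] [NormedSpace ℝ E] {t T : ℝ}
    (h : t ≤ T) (f : ℝ → E) :
    ∫ s in t..T, f s = ∫ s, f s ∂(volume.restrict (Set.Icc t T)) := by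
  rw [intervalIntegral.integral_of_le h, integral_Icc_eq_integral_Ioc]

/-- Fubini's theorem on the triangle `r < σ < τ < T`. -/
lemma integral_inner_integral_swap {r T : ℝ} (h : r ≤ T) {g η : ℝ → Rn n}
    (hg : IntervalIntegrable g volume r T) (hη : IntervalIntegrable η volume r T) :
    ∫ σ in r..T, inner ℝ (∫ τ in σ..T, g τ) (η σ) =
      ∫ τ in r..T, inner ℝ (g τ) (∫ σ in r..τ, η σ) := by
  set μ := volume.restrict (Set.Ioc r T)
  have hg' : Integrable g μ := (intervalIntegrable_iff_integrableOn_Ioc_of_le h).1 hg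
  have hη' : Integrable η μ := (intervalIntegrable_iff_integrableOn_Ioc_of_le h).1 hη
  have hset : MeasurableSet {p : ℝ × ℝ | p.1 < p.2} :=
    measurableSet_lt measurable_fst measurable_snd
  set K : ℝ × ℝ → ℝ := {p : ℝ × ℝ | p.1 < p.2}.indicator fun p => inner ℝ (g p.2) (η p.1)
  have hK : Integrable K (μ.prod μ) := by
    refine Integrable.indicator ?_ hset
    refine (hη'.norm.mul_prod hg'.norm).mono' (hg'.1.comp_snd.inner hη'.1.comp_fst)
      (ae_of_all _ fun p => ?_)
    rw [mul_comm]
    exact norm_inner_le_norm _ _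
  have hswap := integral_integral_swap (f := fun σ τ => K (σ, τ)) hK
  rw [intervalIntegral.integral_of_le h, intervalIntegral.integral_of_le h]
  refine Eq.trans ?_ (hswap.trans ?_)
  · refine setIntegral_congr_fun measurableSet_Ioc fun σ hσ => ?_
    have e1 : (fun τ => K (σ, τ)) =
        (Set.Ioi σ).indicator fun τ => inner ℝ (g τ) (η σ) := by
      funext τ
      simp only [K, Set.indicator, Set.mem_ofPred_eq, Set.mem_Ioi]
    rw [e1, integral_indicator measurableSet_Ioi, Measure.restrict_restrict measurableSet_Ioi,
      Set.inter_comm, Set.Ioc_inter_Ioi, max_eq_right hσ.1.le,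
      intervalIntegral.integral_of_le hσ.2]
    have hi : Integrable g (volume.restrict (Set.Ioc σ T)) :=
      hg'.mono_measure (Measure.restrict_mono (Set.Ioc_subset_Ioc_left hσ.1.le) le_rfl)
    rw [real_inner_comm, ← integral_inner hi]
    exact integral_congr_ae (ae_of_all _ fun τ => real_inner_comm _ _)
  · refine setIntegral_congr_fun measurableSet_Ioc fun τ hτ => ?_
    have e1 : (fun σ => K (σ, τ)) =
        (Set.Iio τ).indicator fun σ => inner ℝ (g τ) (η σ) := by
      funext σ
      simp only [K, Set.indicator, Set.mem_ofPred_eq, Set.mem_Iio]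
    have e2 : Set.Iio τ ∩ Set.Ioc r T = Set.Ioo r τ := by
      ext σ
      simp only [Set.mem_inter_iff, Set.mem_Iio, Set.mem_Ioc, Set.mem_Ioo]
      exact ⟨fun h => ⟨h.2.1, h.1⟩, fun h => ⟨h.2, h.1, h.2.le.trans hτ.2⟩⟩
    rw [e1, integral_indicator measurableSet_Iio, Measure.restrict_restrict measurableSet_Iio,
      e2, intervalIntegral.integral_of_le hτ.1.le, integral_Ioc_eq_integral_Ioo]
    have hi : Integrable η (volume.restrict (Set.Ioo r τ)) := hη'.mono_measure
      (Measure.restrict_mono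
        (show Set.Ioo r τ ⊆ Set.Ioc r T from fun σ hσ => ⟨hσ.1, hσ.2.le.trans hτ.2⟩) le_rfl)
    rw [← integral_inner hi]

/-- Integration by parts for `z(σ) = p + ∫_σᵀ g` against the velocity `η` of a path `δ`. -/
lemma integral_inner_velocity {r T : ℝ} (h : r ≤ T) {g η δ : ℝ → Rn n} (p : Rn n)
    (hg : Continuous g) (hη : IntervalIntegrable η volume r T)
    (hδ : ∀ σ ∈ Set.Icc r T, δ σ = δ r + ∫ τ in r..σ, η τ) :
    ∫ σ in r..T, inner ℝ (p + ∫ τ in σ..T, g τ) (η σ) =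
      inner ℝ p (δ T) + (∫ σ in r..T, inner ℝ (g σ) (δ σ))
        - inner ℝ (p + ∫ τ in r..T, g τ) (δ r) := by
  have hgi := hg.intervalIntegrable (μ := volume)
  have hcont : ContinuousOn (fun σ => ∫ τ in r..σ, η τ) (Set.Icc r T) := by
    have := intervalIntegral.continuousOn_primitive_interval (μ := volume) (f := η) (a := r)
      (b := T)
      (by rw [Set.uIcc_of_le h]; exact (intervalIntegrable_iff_integrableOn_Icc_of_le h).1 hη)
    rwa [Set.uIcc_of_le h] at this
  have i1 : IntervalIntegrable (fun σ => inner ℝ p (η σ)) volume r T :=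
    ⟨hη.1.const_inner p, hη.2.const_inner p⟩
  have i2 : IntervalIntegrable (fun σ => inner ℝ (∫ τ in σ..T, g τ) (η σ)) volume r T := by
    have hc : Continuous fun σ => ∫ τ in σ..T, g τ := by
      simp_rw [fun σ => intervalIntegral.integral_symm (μ := volume) (f := g) T σ]
      exact (intervalIntegral.continuous_primitive (fun a b => hgi a b) T).neg
    obtain ⟨B, hB⟩ := (isCompact_Icc (a := r) (b := T)).exists_bound_of_continuousOn
      hc.continuousOn
    rw [intervalIntegrable_iff_integrableOn_Icc_of_le h] at hη ⊢
    refine (hη.norm.const_mul B).mono'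
      (hc.aestronglyMeasurable.inner hη.1) ?_
    filter_upwards [ae_restrict_mem measurableSet_Icc] with σ hσ
    exact (norm_inner_le_norm _ _).trans
      (mul_le_mul_of_nonneg_right (hB σ hσ) (norm_nonneg _))
  have i3 : IntervalIntegrable (fun σ => inner ℝ (g σ) (∫ τ in r..σ, η τ)) volume r T := by
    refine ContinuousOn.intervalIntegrable ?_
    rw [Set.uIcc_of_le h]
    exact hg.continuousOn.inner hcont
  have i4 : IntervalIntegrable (fun σ => inner ℝ (g σ) (δ r)) volume r T :=
    (hg.inner continuous_const).intervalIntegrable _ _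
  have e1 : ∫ σ in r..T, inner ℝ (g σ) (δ σ) =
      (∫ σ in r..T, inner ℝ (g σ) (δ r)) + ∫ σ in r..T, inner ℝ (g σ) (∫ τ in r..σ, η τ) := by
    rw [← intervalIntegral.integral_add i4 i3]
    refine intervalIntegral.integral_congr fun σ hσ => ?_
    rw [Set.uIcc_of_le h] at hσ
    rw [hδ σ hσ, inner_add_right]
  have e2 : ∫ σ in r..T, inner ℝ (g σ) (δ r) = inner ℝ (∫ τ in r..T, g τ) (δ r) := by
    rw [intervalIntegral.integral_of_le h, intervalIntegral.integral_of_le h, real_inner_comm,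
      ← integral_inner ((intervalIntegrable_iff_integrableOn_Ioc_of_le h).1 (hgi r T))]
    exact integral_congr_ae (ae_of_all _ fun τ => real_inner_comm _ _)
  have e3 : ∫ σ in r..T, inner ℝ p (η σ) = inner ℝ p (∫ σ in r..T, η σ) := by
    rw [intervalIntegral.integral_of_le h, intervalIntegral.integral_of_le h,
      integral_inner ((intervalIntegrable_iff_integrableOn_Ioc_of_le h).1 hη)]
  simp_rw [inner_add_left]
  rw [intervalIntegral.integral_add i1 i2, e3, integral_inner_integral_swap h (hgi r T) hη, e1, e2,
    hδ T ⟨h, le_rfl⟩, inner_add_right]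
  ring

/-- The flow displacement as a double time integral of the forces. -/
lemma drift_eq_integral {lam T t : ℝ} (p : Rn n) {g : ℝ → Rn n} (hg : Continuous g) {s : ℝ}
    (hs : s ∈ Set.Icc t T) :
    drift lam T t p g s = (1 / lam) • ∫ r in t..s, (p + ∫ σ in r..T, g σ) := by
  have hgi := hg.intervalIntegrable (μ := volume)
  have hder : ∀ r, HasDerivAt (fun r => ∫ σ in r..T, g σ) (-g r) r := fun r =>
    intervalIntegral.integral_hasDerivAt_left (hgi r T)
      (hg.stronglyMeasurableAtFilter _ _) hg.continuousAt
  have hc : Continuous fun r => ∫ σ in r..T, g σ :=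
    continuous_iff_continuousAt.2 fun r => (hder r).continuousAt
  have hparts := intervalIntegral.integral_smul_deriv_eq_deriv_smul (a := t) (b := s)
    (u := fun r => r - t) (u' := fun _ => 1) (v := fun r => ∫ σ in r..T, g σ) (v' := fun r => -g r)
    (fun r _ => (hasDerivAt_id r).sub_const t) (fun r _ => hder r)
    intervalIntegrable_const (hg.neg.intervalIntegrable _ _)
  simp only [sub_self, zero_smul, sub_zero, one_smul, smul_neg, intervalIntegral.integral_neg]
    at hparts
  have hsplit : ∫ σ in t..T, (min s σ - t) • g σ =
      (∫ σ in t..s, (σ - t) • g σ) + (s - t) • ∫ σ in s..T, g σ := by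
    have hcm : Continuous fun σ => (min s σ - t) • g σ := by fun_prop
    rw [← intervalIntegral.integral_add_adjacent_intervals (hcm.intervalIntegrable t s)
      (hcm.intervalIntegrable s T), ← intervalIntegral.integral_smul]
    congr 1
    · refine intervalIntegral.integral_congr fun σ hσ => ?_
      rw [Set.uIcc_of_le hs.1] at hσ
      simp only [min_eq_right hσ.2]
    · refine intervalIntegral.integral_congr fun σ hσ => ?_
      rw [Set.uIcc_of_le hs.2] at hσ
      simp only [min_eq_left hσ.1]
  have hsum : ∫ r in t..s, (p + ∫ σ in r..T, g σ) =
      (s - t) • p + ∫ r in t..s, ∫ σ in r..T, g σ := by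
    rw [intervalIntegral.integral_add intervalIntegrable_const (hc.intervalIntegrable _ _),
      intervalIntegral.integral_const]
  have hfin : ∫ r in t..s, ∫ σ in r..T, g σ = ∫ σ in t..T, (min s σ - t) • g σ := by
    rw [eq_sub_iff_add_eq] at hparts
    rw [hsplit, ← hparts]
    abel
  rw [hsum, hfin, drift, smul_add, smul_smul]
  congr 2
  ring

/-! ### The adjoint state -/

/-- The data of a flow `y` from the density `m`: costs with Lipschitz gradients, and a solution of
the flow equation that is regular at all times. -/
structure RegularFlow (c lam T t : ℝ) (Φ ΦT : Measure (Rn n) → ℝ)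
    (F FT : Rn n → Measure (Rn n) → ℝ) (m : Measure (Rn n)) (y : Rn n → ℝ → Rn n) : Prop where
  setting : Setting c lam T t
  pot : IsPotential c Φ F
  potT : IsPotential c ΦT FT
  dens : IsDensity m
  regular : IsRegular (dispRate c lam T) y
  flow : IsFlow lam T F FT t m y

/-- The adjoint states of two flows that stay close. -/
lemma norm_adjoint_sub_le {c lam T t : ℝ} {Φ ΦT : Measure (Rn n) → ℝ}
    {F FT : Rn n → Measure (Rn n) → ℝ} {m₁ m₂ : Measure (Rn n)} {y₁ y₂ : Rn n → ℝ → Rn n}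
    (h₁ : RegularFlow c lam T t Φ ΦT F FT m₁ y₁) (h₂ : RegularFlow c lam T t Φ ΦT F FT m₂ y₂)
    {x₁ x₂ : Rn n} {d D : ℝ} (hd : ∀ s ∈ Set.Icc t T, ‖y₁ x₁ s - y₂ x₂ s‖ ≤ d)
    (hD : ∀ s ∈ Set.Icc t T, W2 (law m₁ y₁ s) (law m₂ y₂ s) ≤ D) {s : ℝ} (hs : s ∈ Set.Icc t T) :
    ‖adjoint T F FT m₁ y₁ x₁ s - adjoint T F FT m₂ y₂ x₂ s‖ ≤ c / 2 * (1 + T) * (d + D) := by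
  have S := h₁.setting
  have hc := S.c_nonneg
  have hT : T ∈ Set.Icc t T := ⟨S.t_le, le_rfl⟩
  have i₁ := (h₁.regular.continuous_force_time S.dispRate_nonneg S.dispRate_lt_one h₁.dens h₁.pot
    x₁).intervalIntegrable (μ := volume) s T
  have i₂ := (h₂.regular.continuous_force_time S.dispRate_nonneg S.dispRate_lt_one h₂.dens h₂.pot
    x₂).intervalIntegrable (μ := volume) s T
  have e : adjoint T F FT m₁ y₁ x₁ s - adjoint T F FT m₂ y₂ x₂ s =
      (Dx FT (y₁ x₁ T) (law m₁ y₁ T) - Dx FT (y₂ x₂ T) (law m₂ y₂ T)) +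
      ∫ σ in s..T, (Dx F (y₁ x₁ σ) (law m₁ y₁ σ) - Dx F (y₂ x₂ σ) (law m₂ y₂ σ)) := by
    rw [intervalIntegral.integral_sub i₁ i₂, adjoint, adjoint]
    abel
  have hR : 0 ≤ d + D :=
    add_nonneg ((norm_nonneg _).trans (hd s hs)) ((W2_nonneg _ _).trans (hD s hs))
  have hint : ‖∫ σ in s..T, (Dx F (y₁ x₁ σ) (law m₁ y₁ σ) - Dx F (y₂ x₂ σ) (law m₂ y₂ σ))‖ ≤
      c / 2 * (d + D) * |T - s| := by
    refine intervalIntegral.norm_integral_le_of_norm_le_const fun σ hσ => ?_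
    rw [Set.uIoc_of_le hs.2] at hσ
    have hσ' : σ ∈ Set.Icc t T := ⟨hs.1.trans hσ.1.le, hσ.2⟩
    refine (h₁.pot.lipschitz _ _ (h₁.flow.density σ hσ') (h₂.flow.density σ hσ') _ _).trans ?_
    gcongr
    exacts [hd σ hσ', hD σ hσ']
  have habs : |T - s| ≤ T := by
    rw [abs_of_nonneg (by linarith [hs.2])]; linarith [hs.1, S.t_mem.1]
  rw [e]
  calc _ ≤ c / 2 * (d + D) + c / 2 * (d + D) * T := by
        refine (norm_add_le _ _).trans (add_le_add ?_ (hint.trans (by gcongr)))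
        refine (h₁.potT.lipschitz _ _ (h₁.flow.density T hT) (h₂.flow.density T hT) _ _).trans ?_
        gcongr
        exacts [hd T hT, hD T hT]
    _ = _ := by ring

/-- The Lipschitz constant of the maps `y(·, σ) ∘ y(·, r)⁻¹` between two times of the flow. -/
noncomputable def flowLip (c lam T : ℝ) : ℝ := (1 + dispRate c lam T) / (1 - dispRate c lam T)

/-- The constant in the quadratic expansion of the value of the deterministic problem. -/
noncomputable def taylorConst (c lam T : ℝ) : ℝ :=
  (T / (2 * lam) * (c / 2 * (1 + T)) ^ 2 + c / 4 * (1 + T)) * flowLip c lam T ^ 2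

/-- The constant in the linear growth of the flow and of its second moments. -/
noncomputable def growthConst (c lam T : ℝ) : ℝ :=
  (1 + rate c lam T) / (1 - 2 * rate c lam T) / (1 - rate c lam T)

namespace RegularFlow

variable {c lam T t : ℝ} {Φ ΦT : Measure (Rn n) → ℝ} {F FT : Rn n → Measure (Rn n) → ℝ}
  {m : Measure (Rn n)} {y : Rn n → ℝ → Rn n}

lemma density (h : RegularFlow c lam T t Φ ΦT F FT m y) (s : ℝ) : IsDensity (law m y s) :=
  h.regular.isDensity_law h.setting.dispRate_nonneg h.setting.dispRate_lt_one h.dens s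

lemma continuous_uncurry (h : RegularFlow c lam T t Φ ΦT F FT m y) :
    Continuous fun p : Rn n × ℝ => y p.1 p.2 :=
  h.regular.continuous_uncurry h.setting.dispRate_nonneg

lemma continuous_space (h : RegularFlow c lam T t Φ ΦT F FT m y) (s : ℝ) :
    Continuous fun x => y x s :=
  h.regular.continuous_space h.setting.dispRate_nonneg s

lemma continuous_force (h : RegularFlow c lam T t Φ ΦT F FT m y) :
    Continuous fun p : Rn n × ℝ => Dx F (y p.1 p.2) (law m y p.2) :=
  h.regular.continuous_force h.setting.dispRate_nonneg h.setting.dispRate_lt_one h.dens h.pot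

lemma continuous_force_time (h : RegularFlow c lam T t Φ ΦT F FT m y) (x : Rn n) :
    Continuous fun s => Dx F (y x s) (law m y s) :=
  h.continuous_force.comp (by fun_prop : Continuous fun s : ℝ => (x, s))

lemma continuous_adjoint (h : RegularFlow c lam T t Φ ΦT F FT m y) :
    Continuous fun p : Rn n × ℝ => adjoint T F FT m y p.1 p.2 := by
  unfold adjoint
  have h1 : Continuous fun p : Rn n × ℝ => Dx FT (y p.1 T) (law m y T) :=
    ((h.potT.continuous_Dx (h.density T)).comp (h.continuous_space T)).comp continuous_fst
  have h2 : Continuous fun p : Rn n × ℝ => ∫ σ in T..p.2, Dx F (y p.1 σ) (law m y σ) :=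
    intervalIntegral.continuous_parametric_intervalIntegral_of_continuous
      (f := fun (p : Rn n × ℝ) σ => Dx F (y p.1 σ) (law m y σ))
      (h.continuous_force.comp (by fun_prop :
        Continuous fun p : (Rn n × ℝ) × ℝ => (p.1.1, p.2))) continuous_snd
  refine h1.add ?_
  simp_rw [fun p : Rn n × ℝ => intervalIntegral.integral_symm (μ := volume)
    (f := fun σ => Dx F (y p.1 σ) (law m y σ)) T p.2]
  exact h2.neg

lemma continuous_adjoint_time (h : RegularFlow c lam T t Φ ΦT F FT m y) (x : Rn n) :
    Continuous (adjoint T F FT m y x) :=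
  h.continuous_adjoint.comp (by fun_prop : Continuous fun s : ℝ => (x, s))

lemma eq_sub_integral (h : RegularFlow c lam T t Φ ΦT F FT m y) (x : Rn n) {s : ℝ}
    (hs : s ∈ Set.Icc t T) :
    y x s = x - (1 / lam) • ∫ r in t..s, adjoint T F FT m y x r := by
  rw [h.flow.eq_sub_drift x hs, drift_eq_integral _ (h.continuous_force_time x) hs]
  rfl

lemma initial (h : RegularFlow c lam T t Φ ΦT F FT m y) (x : Rn n) : y x t = x := by
  rw [h.eq_sub_integral x ⟨le_rfl, h.setting.t_le⟩]
  simp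

lemma law_initial (h : RegularFlow c lam T t Φ ΦT F FT m y) : law m y t = m := by
  unfold law
  simp_rw [h.initial]
  exact Measure.map_id

lemma eq_add_integral (h : RegularFlow c lam T t Φ ΦT F FT m y) (x : Rn n) {r s : ℝ}
    (hr : r ∈ Set.Icc t T) (hs : s ∈ Set.Icc t T) :
    y x s = y x r + ∫ σ in r..s, (-(1 / lam)) • adjoint T F FT m y x σ := by
  have hi := fun a b => (h.continuous_adjoint_time x).intervalIntegrable (μ := volume) a b
  rw [h.eq_sub_integral x hs, h.eq_sub_integral x hr, intervalIntegral.integral_smul,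
    ← intervalIntegral.integral_add_adjacent_intervals (hi t r) (hi r s), smul_add, neg_smul]
  abel

lemma hasDerivWithinAt (h : RegularFlow c lam T t Φ ΦT F FT m y) (x : Rn n) {s : ℝ}
    (hs : s ∈ Set.Icc t T) :
    HasDerivWithinAt (y x) (-(1 / lam) • adjoint T F FT m y x s) (Set.Icc t T) s := by
  have hz := h.continuous_adjoint_time x
  have h1 := ((intervalIntegral.integral_hasDerivAt_right (hz.intervalIntegrable t s)
    (hz.stronglyMeasurableAtFilter _ _) hz.continuousAt).const_smul (1 / lam)).const_sub x
  rw [← neg_smul] at h1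
  exact h1.hasDerivWithinAt.congr (fun r hr => h.eq_sub_integral x hr) (h.eq_sub_integral x hs)

/-- The linear-quadratic expansion of the kinetic energy of a path `X` around a path of the flow;
the linear terms are those of the costs. -/
lemma kinetic_expansion (h : RegularFlow c lam T t Φ ΦT F FT m y) (x : Rn n) {r : ℝ}
    (hr : r ∈ Set.Icc t T) {X a : ℝ → Rn n} (ha : IntervalIntegrable a volume r T)
    (ha2 : IntervalIntegrable (fun σ => ‖a σ‖ ^ 2) volume r T)
    (hX : ∀ σ ∈ Set.Icc r T, X σ = X r + ∫ τ in r..σ, a τ) :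
    lam / 2 * (∫ σ in r..T, ‖a σ‖ ^ 2) =
      1 / (2 * lam) * (∫ σ in r..T, ‖adjoint T F FT m y x σ‖ ^ 2)
      + lam / 2 * (∫ σ in r..T, ‖a σ + (1 / lam) • adjoint T F FT m y x σ‖ ^ 2)
      - inner ℝ (Dx FT (y x T) (law m y T)) (X T - y x T)
      - (∫ σ in r..T, inner ℝ (Dx F (y x σ) (law m y σ)) (X σ - y x σ))
      + inner ℝ (adjoint T F FT m y x r) (X r - y x r) := by
  have hlam := h.setting.lam_pos
  have hz := h.continuous_adjoint_time x
  have hT : T ∈ Set.Icc t T := ⟨h.setting.t_le, le_rfl⟩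
  set z := adjoint T F FT m y x with hzdef
  have hη : IntervalIntegrable (fun σ => a σ + (1 / lam) • z σ) volume r T :=
    ha.add ((hz.const_smul (1 / lam)).intervalIntegrable _ _)
  have hδ : ∀ σ ∈ Set.Icc r T, X σ - y x σ = (X r - y x r) +
      ∫ τ in r..σ, (a τ + (1 / lam) • z τ) := fun σ hσ => by
    have hσ' : σ ∈ Set.Icc t T := ⟨hr.1.trans hσ.1, hσ.2⟩
    have i1 : IntervalIntegrable a volume r σ :=
      ha.mono_set (by rw [Set.uIcc_of_le hr.2, Set.uIcc_of_le hσ.1]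
                      exact Set.Icc_subset_Icc_right hσ.2)
    have i2 : IntervalIntegrable (fun τ => (1 / lam) • z τ) volume r σ :=
      (hz.const_smul (1 / lam)).intervalIntegrable _ _
    rw [hX σ hσ, h.eq_add_integral x hr hσ', intervalIntegral.integral_add i1 i2]
    simp only [neg_smul, intervalIntegral.integral_neg, ← hzdef]
    abel
  have hparts := integral_inner_velocity hr.2 (Dx FT (y x T) (law m y T))
    (h.continuous_force_time x) hη (δ := fun σ => X σ - y x σ) hδ
  have hzz : ∀ σ, Dx FT (y x T) (law m y T) + ∫ τ in σ..T, Dx F (y x τ) (law m y τ) = z σ :=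
    fun σ => rfl
  simp only [hzz] at hparts
  have hpt : ∀ σ, inner ℝ (z σ) (a σ + (1 / lam) • z σ) =
      lam / 2 * ‖a σ + (1 / lam) • z σ‖ ^ 2 + 1 / (2 * lam) * ‖z σ‖ ^ 2
        - lam / 2 * ‖a σ‖ ^ 2 := fun σ => by
    rw [norm_add_sq_real, inner_add_right, inner_smul_right, inner_smul_right, norm_smul, mul_pow,
      real_inner_self_eq_norm_sq, real_inner_comm (z σ), Real.norm_eq_abs, sq_abs]
    field_simp
    ring
  have hz2 : IntervalIntegrable (fun σ => ‖z σ‖ ^ 2) volume r T :=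
    (hz.norm.pow 2).intervalIntegrable _ _
  have hza : IntervalIntegrable (fun σ => inner ℝ (a σ) (z σ)) volume r T := by
    rw [intervalIntegrable_iff_integrableOn_Ioc_of_le hr.2] at ha ha2 hz2 ⊢
    exact integrable_inner_of_memLp (memLp_two_of_sq ha.1 ha2)
      (memLp_two_of_sq hz.aestronglyMeasurable hz2)
  have hη2 : IntervalIntegrable (fun σ => ‖a σ + (1 / lam) • z σ‖ ^ 2) volume r T := by
    have e : (fun σ => ‖a σ + (1 / lam) • z σ‖ ^ 2) = fun σ => ‖a σ‖ ^ 2 +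
        2 * (1 / lam) * inner ℝ (a σ) (z σ) + (1 / lam) ^ 2 * ‖z σ‖ ^ 2 := by
      funext σ
      rw [norm_add_sq_real, inner_smul_right, norm_smul, mul_pow, Real.norm_eq_abs, sq_abs]
      ring
    rw [e]
    exact (ha2.add (hza.const_mul _)).add (hz2.const_mul _)
  have hl : ∫ σ in r..T, inner ℝ (z σ) (a σ + (1 / lam) • z σ) =
      lam / 2 * (∫ σ in r..T, ‖a σ + (1 / lam) • z σ‖ ^ 2) +
        1 / (2 * lam) * (∫ σ in r..T, ‖z σ‖ ^ 2) - lam / 2 * (∫ σ in r..T, ‖a σ‖ ^ 2) := by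
    simp_rw [hpt]
    rw [intervalIntegral.integral_sub ((hη2.const_mul _).add (hz2.const_mul _)) (ha2.const_mul _),
      intervalIntegral.integral_add (hη2.const_mul _) (hz2.const_mul _),
      intervalIntegral.integral_const_mul, intervalIntegral.integral_const_mul,
      intervalIntegral.integral_const_mul]
  rw [hl] at hparts
  linarith

/-! ### Bounds on the flow and the adjoint state -/

lemma norm_le (h : RegularFlow c lam T t Φ ΦT F FT m y) (x : Rn n) {s : ℝ}
    (hs : s ∈ Set.Icc t T) : ‖y x s‖ ≤ growthConst c lam T * (1 + ‖x‖ + √(moment2 m)) := by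
  have S := h.setting
  have hr := S.rate_nonneg
  have hr2 := S.rate_lt
  have h1 := h.flow.norm_le_of_moment S h.pot h.potT
    (fun s hs => h.flow.sqrt_moment2_le S h.pot h.potT h.dens hs) x hs
  refine h1.trans ?_
  unfold growthConst
  set κ := rate c lam T
  set M := √(moment2 m)
  have hM : 0 ≤ M := Real.sqrt_nonneg _
  have hx := norm_nonneg x
  have hκ : 0 < 1 - κ := by linarith
  have h2κ : 0 < 1 - 2 * κ := by linarith
  rw [div_mul_eq_mul_div]
  refine div_le_div_of_nonneg_right ?_ hκ.le
  rw [div_mul_eq_mul_div, le_div_iff₀ h2κ]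
  have e : (‖x‖ + κ * (1 + (M + κ) / (1 - 2 * κ))) * (1 - 2 * κ) =
      ‖x‖ * (1 - 2 * κ) + κ * (1 - 2 * κ) + κ * (M + κ) := by
    linear_combination κ * div_mul_cancel₀ (M + κ) h2κ.ne'
  rw [e]
  nlinarith [mul_nonneg hr hx, mul_nonneg hr hM, mul_nonneg hr hr]

lemma sqrt_moment2_le (h : RegularFlow c lam T t Φ ΦT F FT m y) {s : ℝ}
    (hs : s ∈ Set.Icc t T) :
    √(moment2 (law m y s)) ≤ growthConst c lam T * (1 + √(moment2 m)) := by
  have S := h.setting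
  have hr := S.rate_nonneg
  have hr2 := S.rate_lt
  refine (h.flow.sqrt_moment2_le S h.pot h.potT h.dens hs).trans ?_
  unfold growthConst
  set κ := rate c lam T
  set M := √(moment2 m)
  have hM : 0 ≤ M := Real.sqrt_nonneg _
  have hκ : 0 < 1 - κ := by linarith
  have h2κ : 0 < 1 - 2 * κ := by linarith
  rw [div_div, div_mul_eq_mul_div, div_le_div_iff₀ h2κ (by positivity)]
  have : (M + κ) * (1 - κ) ≤ (1 + κ) * (1 + M) := by nlinarith
  calc (M + κ) * ((1 - 2 * κ) * (1 - κ)) = (M + κ) * (1 - κ) * (1 - 2 * κ) := by ring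
    _ ≤ _ := by gcongr

lemma growthConst_nonneg (S : Setting c lam T t) : 0 ≤ growthConst c lam T := by
  have hr := S.rate_nonneg
  have hr2 := S.rate_lt
  unfold growthConst
  have hκ : 0 < 1 - rate c lam T := by linarith
  have h2κ : 0 < 1 - 2 * rate c lam T := by linarith
  positivity

lemma norm_force_le (h : RegularFlow c lam T t Φ ΦT F FT m y) {Φ' : Measure (Rn n) → ℝ}
    {Ψ : Rn n → Measure (Rn n) → ℝ} (hΨ : IsPotential c Φ' Ψ) (x : Rn n) {s : ℝ}
    (hs : s ∈ Set.Icc t T) : ‖Dx Ψ (y x s) (law m y s)‖ ≤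
      c / 2 * (1 + 2 * growthConst c lam T) * (1 + ‖x‖ + √(moment2 m)) := by
  have hc := h.setting.c_nonneg
  have hG := growthConst_nonneg h.setting
  have hx := norm_nonneg x
  have hM := Real.sqrt_nonneg (moment2 m)
  refine (hΨ.growth _ (h.density s) _).trans ?_
  rw [mul_assoc]
  gcongr
  have h1 := h.norm_le x hs
  have h2 := h.sqrt_moment2_le hs
  have h3 : growthConst c lam T * (1 + √(moment2 m)) ≤
      growthConst c lam T * (1 + ‖x‖ + √(moment2 m)) := by
    gcongr
    linarith
  linarith

lemma norm_adjoint_le (h : RegularFlow c lam T t Φ ΦT F FT m y) (x : Rn n) {s : ℝ}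
    (hs : s ∈ Set.Icc t T) : ‖adjoint T F FT m y x s‖ ≤
      c / 2 * (1 + T) * (1 + 2 * growthConst c lam T) * (1 + ‖x‖ + √(moment2 m)) := by
  have S := h.setting
  have hT := S.T_pos
  set A := c / 2 * (1 + 2 * growthConst c lam T) * (1 + ‖x‖ + √(moment2 m))
  have hTm : T ∈ Set.Icc t T := ⟨S.t_le, le_rfl⟩
  have hA : 0 ≤ A := (norm_nonneg _).trans (h.norm_force_le h.pot x hs)
  have hint : ‖∫ σ in s..T, Dx F (y x σ) (law m y σ)‖ ≤ A * |T - s| := by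
    refine intervalIntegral.norm_integral_le_of_norm_le_const fun σ hσ => ?_
    rw [Set.uIoc_of_le hs.2] at hσ
    exact h.norm_force_le h.pot x ⟨hs.1.trans hσ.1.le, hσ.2⟩
  have habs : |T - s| ≤ T := by
    rw [abs_of_nonneg (by linarith [hs.2])]; linarith [hs.1, S.t_mem.1]
  calc _ ≤ A + A * T :=
      (norm_add_le _ _).trans (add_le_add (h.norm_force_le h.potT x hTm) (hint.trans (by gcongr)))
    _ = _ := by ring

end RegularFlow

/-! ### The value along the flow -/

/-- The cost from time `s` on of the path of the flow started at `ξ`, where `F` and `FT` are the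
running and final costs and the laws of the flow are held fixed. -/
noncomputable def flowValue (lam T : ℝ) (F FT : Rn n → Measure (Rn n) → ℝ) (m : Measure (Rn n))
    (y : Rn n → ℝ → Rn n) (ξ : Rn n) (s : ℝ) : ℝ :=
  1 / (2 * lam) * (∫ σ in s..T, ‖adjoint T F FT m y ξ σ‖ ^ 2)
    + (∫ σ in s..T, F (y ξ σ) (law m y σ)) + FT (y ξ T) (law m y T)

namespace RegularFlow

variable {c lam T t : ℝ} {Φ ΦT : Measure (Rn n) → ℝ} {F FT : Rn n → Measure (Rn n) → ℝ}
  {m : Measure (Rn n)} {y : Rn n → ℝ → Rn n}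

lemma norm_sub_le_flowLip (h : RegularFlow c lam T t Φ ΦT F FT m y) (ξ ξ' : Rn n) (r σ : ℝ) :
    ‖y ξ' σ - y ξ σ‖ ≤ flowLip c lam T * ‖y ξ' r - y ξ r‖ := by
  have hθ := h.setting.dispRate_nonneg
  have hθ1 := h.setting.dispRate_lt_one
  refine (h.regular.norm_sub_le σ ξ' ξ).trans ?_
  rw [flowLip, div_mul_eq_mul_div, le_div_iff₀ (by linarith), mul_assoc]
  refine mul_le_mul_of_nonneg_left ?_ (by linarith)
  rw [mul_comm]
  exact h.regular.le_norm_sub r ξ' ξ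

/-- Two paths of the same flow have values that agree to first order in their positions, the
gradient being the adjoint state. -/
lemma abs_flowValue_sub_le (h : RegularFlow c lam T t Φ ΦT F FT m y)
    (hFc : ∀ x, Continuous fun s => F (y x s) (law m y s)) (ξ ξ' : Rn n) {r : ℝ}
    (hr : r ∈ Set.Icc t T) :
    |flowValue lam T F FT m y ξ' r - flowValue lam T F FT m y ξ r
      - inner ℝ (adjoint T F FT m y ξ r) (y ξ' r - y ξ r)|
      ≤ taylorConst c lam T * ‖y ξ' r - y ξ r‖ ^ 2 := by
  have S := h.setting
  have hlam := S.lam_pos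
  have hc := S.c_nonneg
  have hT := S.T_pos
  set d := flowLip c lam T * ‖y ξ' r - y ξ r‖ with hd
  have hδ : ∀ σ, ‖y ξ' σ - y ξ σ‖ ≤ d := fun σ => h.norm_sub_le_flowLip ξ ξ' r σ
  have hz := h.continuous_adjoint_time ξ
  have hz' := h.continuous_adjoint_time ξ'
  have hzd : ∀ σ ∈ Set.Icc t T,
      ‖adjoint T F FT m y ξ' σ - adjoint T F FT m y ξ σ‖ ≤ c / 2 * (1 + T) * d := fun σ hσ => by
    have := norm_adjoint_sub_le h h (D := 0) (fun s _ => hδ s)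
      (fun s _ => (W2_self (h.density s)).le) hσ
    rwa [add_zero] at this
  have ha : Continuous fun σ => (-(1 / lam)) • adjoint T F FT m y ξ' σ := by fun_prop
  have hkin := h.kinetic_expansion ξ hr (X := y ξ') (ha.intervalIntegrable r T)
    ((ha.norm.pow 2).intervalIntegrable r T)
    fun σ hσ => h.eq_add_integral ξ' hr ⟨hr.1.trans hσ.1, hσ.2⟩
  have e1 : lam / 2 * (∫ σ in r..T, ‖(-(1 / lam)) • adjoint T F FT m y ξ' σ‖ ^ 2) =
      1 / (2 * lam) * (∫ σ in r..T, ‖adjoint T F FT m y ξ' σ‖ ^ 2) := by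
    simp_rw [norm_smul, mul_pow, norm_neg, Real.norm_eq_abs, sq_abs]
    rw [intervalIntegral.integral_const_mul]
    field_simp
  have habs : |T - r| ≤ T := by
    rw [abs_of_nonneg (by linarith [hr.2])]; linarith [hr.1, S.t_mem.1]
  have hmem : ∀ {σ}, σ ∈ Set.uIoc r T → σ ∈ Set.Icc t T := fun {σ} hσ => by
    rw [Set.uIoc_of_le hr.2] at hσ
    exact ⟨hr.1.trans hσ.1.le, hσ.2⟩
  have b1 : |lam / 2 * (∫ σ in r..T, ‖(-(1 / lam)) • adjoint T F FT m y ξ' σ +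
      (1 / lam) • adjoint T F FT m y ξ σ‖ ^ 2)| ≤
      T / (2 * lam) * (c / 2 * (1 + T)) ^ 2 * d ^ 2 := by
    have := intervalIntegral.norm_integral_le_of_norm_le_const (a := r) (b := T)
      (f := fun σ => ‖(-(1 / lam)) • adjoint T F FT m y ξ' σ +
      (1 / lam) • adjoint T F FT m y ξ σ‖ ^ 2) (C := (1 / lam) ^ 2 * (c / 2 * (1 + T) * d) ^ 2)
      fun σ hσ => by
        rw [Real.norm_of_nonneg (by positivity), neg_smul, neg_add_eq_sub, ← smul_sub, norm_smul,
          mul_pow, Real.norm_eq_abs, sq_abs, norm_sub_rev]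
        gcongr
        exact hzd σ (hmem hσ)
    rw [abs_mul, abs_of_pos (by positivity : 0 < lam / 2)]
    calc _ ≤ lam / 2 * ((1 / lam) ^ 2 * (c / 2 * (1 + T) * d) ^ 2 * T) :=
          mul_le_mul_of_nonneg_left (this.trans (by gcongr)) (by positivity)
      _ = _ := by field_simp
  have hgδ : Continuous fun σ => inner ℝ (Dx F (y ξ σ) (law m y σ)) (y ξ' σ - y ξ σ) :=
    (h.continuous_force_time ξ).inner
      ((h.regular.continuous_time ξ').sub (h.regular.continuous_time ξ))
  have b2 : |∫ σ in r..T, (F (y ξ' σ) (law m y σ) - F (y ξ σ) (law m y σ) -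
      inner ℝ (Dx F (y ξ σ) (law m y σ)) (y ξ' σ - y ξ σ))| ≤ c / 4 * d ^ 2 * T := by
    refine (intervalIntegral.norm_integral_le_of_norm_le_const (E := ℝ) (C := c / 4 * d ^ 2)
      fun σ _ => ?_).trans (by gcongr)
    refine (h.pot.abs_taylor_le (h.density σ) _ _).trans ?_
    gcongr
    exact hδ σ
  have hFd : Continuous fun σ => F (y ξ' σ) (law m y σ) - F (y ξ σ) (law m y σ) :=
    (hFc ξ').sub (hFc ξ)
  rw [intervalIntegral.integral_sub (hFd.intervalIntegrable _ _)
    (hgδ.intervalIntegrable _ _), intervalIntegral.integral_sub ((hFc ξ').intervalIntegrable _ _)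
    ((hFc ξ).intervalIntegrable _ _)] at b2
  have b3 : |FT (y ξ' T) (law m y T) - FT (y ξ T) (law m y T) -
      inner ℝ (Dx FT (y ξ T) (law m y T)) (y ξ' T - y ξ T)| ≤ c / 4 * d ^ 2 := by
    refine (h.potT.abs_taylor_le (h.density T) _ _).trans ?_
    gcongr
    exact hδ T
  rw [e1] at hkin
  have etot : taylorConst c lam T * ‖y ξ' r - y ξ r‖ ^ 2 =
      T / (2 * lam) * (c / 2 * (1 + T)) ^ 2 * d ^ 2 + c / 4 * d ^ 2 * T + c / 4 * d ^ 2 := by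
    rw [hd, taylorConst]; ring
  rw [etot, flowValue, flowValue]
  have b1' := abs_le.1 b1
  have b2' := abs_le.1 b2
  have b3' := abs_le.1 b3
  exact abs_le.2 ⟨by linarith, by linarith⟩

end RegularFlow

/-! ### The Hamilton–Jacobi–Bellman and Fokker–Planck equations -/

/-- The inverse of the map `y(·, s)`, a bijection for a regular flow of rate below one. -/
noncomputable def invFlow (y : Rn n → ℝ → Rn n) (s : ℝ) : Rn n → Rn n :=
  Function.invFun fun x => y x s

namespace IsRegular

variable {θ : ℝ} {y : Rn n → ℝ → Rn n} {m : Measure (Rn n)}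

lemma apply_invFlow (h : IsRegular θ y) (hθ : 0 ≤ θ) (hθ1 : θ < 1) (s : ℝ) (x : Rn n) :
    y (invFlow y s x) s = x := by
  refine Function.invFun_eq (f := fun x => y x s) ?_
  lift θ to NNReal using hθ
  -- the preimage is the fixed point of the contraction `ξ ↦ x - (y(ξ, s) - ξ)`
  have hc : ContractingWith θ fun ξ => x - (y ξ s - ξ) := by
    refine ⟨hθ1, LipschitzWith.of_dist_le_mul fun a b => ?_⟩
    rw [dist_sub_left, dist_eq_norm, dist_eq_norm]
    exact h.lipschitz s a b
  refine ⟨hc.fixedPoint, ?_⟩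
  have h1 : x - (y hc.fixedPoint s - hc.fixedPoint) = hc.fixedPoint := hc.fixedPoint_isFixedPt
  have h2 : y hc.fixedPoint s = x - (x - (y hc.fixedPoint s - hc.fixedPoint))
      + hc.fixedPoint := by abel
  rw [h2, h1, sub_add_cancel]

lemma invFlow_apply (h : IsRegular θ y) (hθ1 : θ < 1) (s : ℝ) (x : Rn n) :
    invFlow y s (y x s) = x := by
  refine Function.leftInverse_invFun (f := fun x => y x s) (fun a b hab => ?_) x
  have := h.le_norm_sub s a b
  simp only at hab
  rw [hab, sub_self, norm_zero] at this
  have h0 : ‖a - b‖ ≤ 0 := by nlinarith [norm_nonneg (a - b)]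
  exact sub_eq_zero.1 (norm_le_zero_iff.1 h0)

lemma continuous_invFlow (h : IsRegular θ y) (hθ : 0 ≤ θ) (hθ1 : θ < 1) :
    Continuous fun p : Rn n × ℝ => invFlow y p.2 p.1 := by
  rw [continuous_iff_continuousAt]
  rintro ⟨x, s⟩
  rw [ContinuousAt, tendsto_iff_norm_sub_tendsto_zero]
  have hlim : Tendsto (fun p : Rn n × ℝ => (1 - θ)⁻¹ * ‖p.1 - y (invFlow y s x) p.2‖)
      (𝓝 (x, s)) (𝓝 0) := by
    have := h.continuous_time (invFlow y s x)
    have hc : Continuous fun p : Rn n × ℝ => (1 - θ)⁻¹ * ‖p.1 - y (invFlow y s x) p.2‖ := by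
      fun_prop
    exact hc.tendsto' _ _ (by simp [h.apply_invFlow hθ hθ1])
  refine squeeze_zero (fun _ => norm_nonneg _) (fun p => ?_) hlim
  have := h.le_norm_sub p.2 (invFlow y p.2 p.1) (invFlow y s x)
  rw [h.apply_invFlow hθ hθ1] at this
  rw [inv_mul_eq_div, le_div_iff₀ (by linarith), mul_comm]
  exact this

end IsRegular

/-- The value function of the deterministic control problem in which the laws `m(s)` are frozen;
it is the solution of the HJB equation. -/
noncomputable def valueFn (lam T : ℝ) (F FT : Rn n → Measure (Rn n) → ℝ) (m : Measure (Rn n))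
    (y : Rn n → ℝ → Rn n) (x : Rn n) (s : ℝ) : ℝ :=
  flowValue lam T F FT m y (invFlow y s x) s

namespace RegularFlow

variable {c lam T t : ℝ} {Φ ΦT : Measure (Rn n) → ℝ} {F FT : Rn n → Measure (Rn n) → ℝ}
  {m : Measure (Rn n)} {y : Rn n → ℝ → Rn n}

/-- The potential `F(x, m(s))` is continuous along the flow, since `F(x, ·)` has a continuous
functional derivative of quadratic growth. -/
lemma continuous_potential_time (h : RegularFlow c lam T t Φ ΦT F FT m y)
    {dF : Rn n → Measure (Rn n) → Rn n → ℝ}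
    (hdF : ∀ m, IsDensity m → ∀ x, HasFunctionalDeriv (fun μ => F x μ) m (dF x m))
    (hcont : ∀ m, IsDensity m → ∀ x, Continuous (dF x m)) {C₀ : ℝ}
    (hgr : ∀ m, IsDensity m → ∀ x ξ,
      |dF x m ξ| ≤ C₀ * (1 + ‖x‖ ^ 2 + ‖ξ‖ ^ 2 + moment2 m)) (x : Rn n) :
    Continuous fun s => F (y x s) (law m y s) := by
  have hm := h.dens
  have := hm.prob
  have hθ := h.setting.dispRate_nonneg
  rw [continuous_iff_continuousAt]
  intro s
  set x₀ := y x s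
  set G := dF x₀ (law m y s)
  have hW := h.regular.tendsto_W2_law hθ hm s
  have hδ : Tendsto (fun σ => y x σ - x₀) (𝓝 s) (𝓝 0) :=
    (((h.regular.continuous_time x).sub continuous_const).tendsto' s 0 (by simp))
  -- the increment in space is controlled by the gradient
  have h1 : Tendsto (fun σ => F (y x σ) (law m y σ) - F x₀ (law m y σ)) (𝓝 s) (𝓝 0) := by
    have hb : Tendsto (fun σ => (‖Dx F x₀ (law m y s)‖ + c / 2 * W2 (law m y σ) (law m y s)) *
        ‖y x σ - x₀‖ + c / 4 * ‖y x σ - x₀‖ ^ 2) (𝓝 s) (𝓝 0) := by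
      simpa using ((tendsto_const_nhds.add (hW.const_mul (c / 2))).mul hδ.norm).add
        ((hδ.norm.pow 2).const_mul (c / 4))
    refine squeeze_zero_norm (fun σ => ?_) hb
    have e1 := h.pot.abs_taylor_le (h.density σ) x₀ (y x σ)
    have e2 := abs_real_inner_le_norm (Dx F x₀ (law m y σ)) (y x σ - x₀)
    have e3 : ‖Dx F x₀ (law m y σ)‖ ≤
        ‖Dx F x₀ (law m y s)‖ + c / 2 * W2 (law m y σ) (law m y s) := by
      have e4 := h.pot.lipschitz _ _ (h.density σ) (h.density s) x₀ x₀
      rw [sub_self, norm_zero, zero_add] at e4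
      have e5 := norm_sub_norm_le (Dx F x₀ (law m y σ)) (Dx F x₀ (law m y s))
      linarith
    have e6 := mul_le_mul_of_nonneg_right e3 (norm_nonneg (y x σ - x₀))
    have e1' := abs_le.1 e1
    have e2' := abs_le.1 e2
    rw [Real.norm_eq_abs]
    exact abs_le.2 ⟨by linarith, by linarith⟩
  have hint : ∀ σ, ∫ ξ, G ξ ∂(law m y σ) = ∫ ξ, G (y ξ σ) ∂m := fun σ =>
    integral_map (h.continuous_space σ).aemeasurable
      (hcont _ (h.density s) x₀).aestronglyMeasurable
  have h2 : Tendsto (fun σ => ∫ ξ, G ξ ∂(law m y σ)) (𝓝 s) (𝓝 (∫ ξ, G ξ ∂(law m y s))) := by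
    simp_rw [hint]
    obtain ⟨B, hB, hy⟩ := h.regular.growth
    have hw : MemLp (fun ξ : Rn n => 1 + ‖ξ‖) 2 m := (memLp_const (1 : ℝ)).add hm.memLp_id.norm
    refine tendsto_integral_filter_of_dominated_convergence
      (fun ξ => |C₀| * (1 + ‖x₀‖ ^ 2 + moment2 (law m y s)) +
        |C₀| * B ^ 2 * (1 + ‖ξ‖) ^ 2) ?_ ?_
      ((integrable_const _).add (hw.integrable_sq.const_mul _)) ?_
    · exact Eventually.of_forall fun σ =>
        ((hcont _ (h.density s) x₀).comp (h.continuous_space σ)).aestronglyMeasurable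
    · refine Eventually.of_forall fun σ => ae_of_all _ fun ξ => ?_
      have hM := moment2_nonneg (law m y s)
      have hp := pow_le_pow_left₀ (norm_nonneg _) (hy ξ σ) 2
      calc ‖G (y ξ σ)‖ ≤ C₀ * (1 + ‖x₀‖ ^ 2 + ‖y ξ σ‖ ^ 2 + moment2 (law m y s)) :=
            hgr _ (h.density s) x₀ _
        _ ≤ |C₀| * (1 + ‖x₀‖ ^ 2 + (B * (1 + ‖ξ‖)) ^ 2 + moment2 (law m y s)) := by
            gcongr
            exact le_abs_self _
        _ = _ := by ring
    · exact ae_of_all _ fun ξ => ((hcont _ (h.density s) x₀).comp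
        (h.regular.continuous_time ξ)).tendsto s
  have h3 : Tendsto (fun σ => F x₀ (law m y σ) - F x₀ (law m y s)) (𝓝 s) (𝓝 0) := by
    obtain ⟨δ, hδ, hδ'⟩ := (hdF _ (h.density s) x₀).exists_delta one_pos
    have hb : Tendsto (fun σ => |∫ ξ, G ξ ∂(law m y σ) - ∫ ξ, G ξ ∂(law m y s)| +
        W2 (law m y σ) (law m y s)) (𝓝 s) (𝓝 0) := by
      simpa using (h2.sub_const (∫ ξ, G ξ ∂(law m y s))).abs.add hW
    refine squeeze_zero_norm' ?_ hb
    filter_upwards [hW.eventually_lt_const hδ] with σ hσ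
    have e1 := hδ' _ (h.density σ) hσ
    rw [Real.norm_eq_abs]
    have e2 := abs_sub_abs_le_abs_sub (F x₀ (law m y σ) - F x₀ (law m y s))
      (∫ ξ, G ξ ∂(law m y σ) - ∫ ξ, G ξ ∂(law m y s))
    linarith
  have h4 := (h1.add h3).add_const (F x₀ (law m y s))
  simp only [sub_add_sub_cancel, sub_add_cancel, add_zero, zero_add] at h4
  exact h4

lemma apply_invFlow (h : RegularFlow c lam T t Φ ΦT F FT m y) (s : ℝ) (x : Rn n) :
    y (invFlow y s x) s = x :=
  h.regular.apply_invFlow h.setting.dispRate_nonneg h.setting.dispRate_lt_one s x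

lemma invFlow_apply (h : RegularFlow c lam T t Φ ΦT F FT m y) (s : ℝ) (x : Rn n) :
    invFlow y s (y x s) = x :=
  h.regular.invFlow_apply h.setting.dispRate_lt_one s x

lemma continuous_invFlow (h : RegularFlow c lam T t Φ ΦT F FT m y) :
    Continuous fun p : Rn n × ℝ => invFlow y p.2 p.1 :=
  h.regular.continuous_invFlow h.setting.dispRate_nonneg h.setting.dispRate_lt_one

lemma invFlow_initial (h : RegularFlow c lam T t Φ ΦT F FT m y) (x : Rn n) :
    invFlow y t x = x := by
  have := h.invFlow_apply t x
  rwa [h.initial] at this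

/-- The value at time `s` has the adjoint state of the path through `x` as its gradient at `x`, with
a quadratic remainder that is uniform in `x`. -/
lemma abs_valueFn_sub_le (h : RegularFlow c lam T t Φ ΦT F FT m y)
    (hFc : ∀ x, Continuous fun s => F (y x s) (law m y s)) (x x' : Rn n) {s : ℝ}
    (hs : s ∈ Set.Icc t T) :
    |valueFn lam T F FT m y x' s - valueFn lam T F FT m y x s
      - inner ℝ (adjoint T F FT m y (invFlow y s x) s) (x' - x)|
      ≤ taylorConst c lam T * ‖x' - x‖ ^ 2 := by
  have := h.abs_flowValue_sub_le hFc (invFlow y s x) (invFlow y s x') hs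
  rwa [h.apply_invFlow, h.apply_invFlow] at this

lemma hasGradientAt_valueFn (h : RegularFlow c lam T t Φ ΦT F FT m y)
    (hFc : ∀ x, Continuous fun s => F (y x s) (law m y s)) (x : Rn n) {s : ℝ}
    (hs : s ∈ Set.Icc t T) :
    HasGradientAt (fun x => valueFn lam T F FT m y x s)
      (adjoint T F FT m y (invFlow y s x) s) x := by
  rw [hasGradientAt_iff_isLittleO]
  have h1 : (fun x' => valueFn lam T F FT m y x' s - valueFn lam T F FT m y x s
      - inner ℝ (adjoint T F FT m y (invFlow y s x) s) (x' - x)) =O[𝓝 x]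
      fun x' => ‖x' - x‖ ^ 2 := by
    refine IsBigO.of_bound (taylorConst c lam T) (Eventually.of_forall fun x' => ?_)
    rw [Real.norm_of_nonneg (by positivity : (0 : ℝ) ≤ ‖x' - x‖ ^ 2)]
    exact h.abs_valueFn_sub_le hFc x x' hs
  have h2 : (fun x' => ‖x' - x‖ ^ 2) =o[𝓝 x] fun x' => x' - x := by
    have h3 : Tendsto (fun x' => x' - x) (𝓝 x) (𝓝 0) :=
      Continuous.tendsto' (by fun_prop) x 0 (sub_self x)
    exact (isLittleO_norm_pow_id one_lt_two).comp_tendsto h3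
  exact h1.trans_isLittleO h2

lemma gradient_valueFn (h : RegularFlow c lam T t Φ ΦT F FT m y)
    (hFc : ∀ x, Continuous fun s => F (y x s) (law m y s)) (x : Rn n) {s : ℝ}
    (hs : s ∈ Set.Icc t T) :
    gradient (fun x => valueFn lam T F FT m y x s) x = adjoint T F FT m y (invFlow y s x) s :=
  (h.hasGradientAt_valueFn hFc x hs).gradient

lemma hasDerivAt_flowValue (h : RegularFlow c lam T t Φ ΦT F FT m y)
    (hFc : ∀ x, Continuous fun s => F (y x s) (law m y s)) (ξ : Rn n) (s : ℝ) :
    HasDerivAt (flowValue lam T F FT m y ξ)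
      (1 / (2 * lam) * (-‖adjoint T F FT m y ξ s‖ ^ 2) + -F (y ξ s) (law m y s)) s := by
  have hz := (h.continuous_adjoint_time ξ).norm.pow 2
  have h1 := intervalIntegral.integral_hasDerivAt_left (hz.intervalIntegrable s T)
    (hz.stronglyMeasurableAtFilter volume (𝓝 s)) hz.continuousAt
  have h2 := intervalIntegral.integral_hasDerivAt_left ((hFc ξ).intervalIntegrable s T)
    ((hFc ξ).stronglyMeasurableAtFilter volume (𝓝 s)) (hFc ξ).continuousAt
  exact ((h1.const_mul (1 / (2 * lam))).add h2).add_const _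

lemma hasDerivAt_adjoint (h : RegularFlow c lam T t Φ ΦT F FT m y) (ξ : Rn n) (s : ℝ) :
    HasDerivAt (adjoint T F FT m y ξ) (-Dx F (y ξ s) (law m y s)) s := by
  have hg := h.continuous_force_time ξ
  exact (intervalIntegral.integral_hasDerivAt_left (hg.intervalIntegrable s T)
    (hg.stronglyMeasurableAtFilter volume (𝓝 s)) hg.continuousAt).const_add _

/-- The Hamilton–Jacobi–Bellman equation: the time derivative of the value at a fixed point is its
derivative along the flow, minus the transport term. -/
lemma hasDerivWithinAt_valueFn (h : RegularFlow c lam T t Φ ΦT F FT m y)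
    (hFc : ∀ x, Continuous fun s => F (y x s) (law m y s)) (x : Rn n) {s : ℝ}
    (hs : s ∈ Set.Icc t T) :
    HasDerivWithinAt (valueFn lam T F FT m y x)
      (1 / (2 * lam) * ‖adjoint T F FT m y (invFlow y s x) s‖ ^ 2 - F x (law m y s))
      (Set.Icc t T) s := by
  have hlam := h.setting.lam_pos
  set ξ := invFlow y s x
  have hξ : y ξ s = x := h.apply_invFlow s x
  -- compare the value at `x` with the value along the path of the flow that is at `x` at time `s`
  set e : ℝ → ℝ := fun σ => valueFn lam T F FT m y x σ - flowValue lam T F FT m y ξ σ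
    - inner ℝ (adjoint T F FT m y ξ σ) (x - y ξ σ) with he
  have hy := h.hasDerivWithinAt ξ hs
  have he0 : e s = 0 := by
    simp only [e, hξ, sub_self, inner_zero_right, sub_zero]
    exact sub_self _
  have hder_e : HasDerivWithinAt e 0 (Set.Icc t T) s := by
    rw [hasDerivWithinAt_iff_isLittleO]
    have h1 : (fun σ => e σ - e s - (σ - s) • (0 : ℝ)) =O[𝓝[Set.Icc t T] s]
        fun σ => ‖y ξ σ - y ξ s‖ ^ 2 := by
      refine IsBigO.of_bound (taylorConst c lam T) ?_
      filter_upwards [self_mem_nhdsWithin] with σ hσ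
      rw [he0, smul_zero, sub_zero, sub_zero,
        Real.norm_of_nonneg (by positivity : (0 : ℝ) ≤ ‖y ξ σ - y ξ s‖ ^ 2), hξ,
        norm_sub_rev (y ξ σ) x]
      have := h.abs_flowValue_sub_le hFc ξ (invFlow y σ x) hσ
      rwa [h.apply_invFlow] at this
    have h2 : (fun σ => ‖y ξ σ - y ξ s‖ ^ 2) =O[𝓝[Set.Icc t T] s] fun σ => (σ - s) ^ 2 :=
      (hy.hasFDerivWithinAt.isBigO_sub.norm_left).pow 2
    have h3 : (fun σ : ℝ => (σ - s) ^ 2) =o[𝓝[Set.Icc t T] s] fun σ => σ - s := by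
      have h4 : Tendsto (fun σ => σ - s) (𝓝[Set.Icc t T] s) (𝓝 0) :=
        ((continuous_id.sub continuous_const).tendsto' s 0 (sub_self s)).mono_left
          nhdsWithin_le_nhds
      exact (isLittleO_pow_id one_lt_two).comp_tendsto h4
    exact h1.trans_isLittleO (h2.trans_isLittleO h3)
  have hin : HasDerivWithinAt (fun σ => inner ℝ (adjoint T F FT m y ξ σ) (x - y ξ σ))
      (1 / lam * ‖adjoint T F FT m y ξ s‖ ^ 2) (Set.Icc t T) s := by
    have := (h.hasDerivAt_adjoint ξ s).hasDerivWithinAt.inner ℝ (hy.const_sub x)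
    refine this.congr_deriv ?_
    rw [hξ, sub_self, inner_zero_right, add_zero, neg_smul, neg_neg, inner_smul_right,
      real_inner_self_eq_norm_sq]
  have hsum := (hder_e.add (h.hasDerivAt_flowValue hFc ξ s).hasDerivWithinAt).add hin
  rw [hξ] at hsum
  refine (hsum.congr_deriv ?_).congr (fun σ _ => ?_) ?_
  · field_simp
    ring
  · simp only [he, Pi.add_apply]
    ring
  · simp only [he, Pi.add_apply]
    ring

lemma norm_sub_time_le (h : RegularFlow c lam T t Φ ΦT F FT m y) (x : Rn n) {r s : ℝ}
    (hr : r ∈ Set.Icc t T) (hs : s ∈ Set.Icc t T) :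
    ‖y x s - y x r‖ ≤ 1 / lam * (c / 2 * (1 + T) * (1 + 2 * growthConst c lam T) *
      (1 + ‖x‖ + √(moment2 m))) * |s - r| := by
  have hlam := h.setting.lam_pos
  rw [h.eq_add_integral x hr hs, add_sub_cancel_left]
  refine intervalIntegral.norm_integral_le_of_norm_le_const fun σ hσ => ?_
  have hσ' : σ ∈ Set.Icc t T :=
    Set.uIcc_subset_Icc hr hs (Set.uIoc_subset_uIcc hσ)
  rw [norm_smul, norm_neg, Real.norm_of_nonneg (by positivity)]
  gcongr
  exact h.norm_adjoint_le x hσ'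

/-- The laws of the flow solve the Fokker–Planck equation. -/
lemma hasDerivWithinAt_integral_law (h : RegularFlow c lam T t Φ ΦT F FT m y)
    {φ : Rn n → ℝ} (hφ : ContDiff ℝ ∞ φ) (hφc : HasCompactSupport φ) {s : ℝ}
    (hs : s ∈ Set.Icc t T) :
    HasDerivWithinAt (fun σ => ∫ x, φ x ∂(law m y σ))
      (∫ x, inner ℝ (gradient φ (y x s)) (-(1 / lam) • adjoint T F FT m y x s) ∂m)
      (Set.Icc t T) s := by
  have := h.dens.prob
  have hint : ∀ σ, ∫ x, φ x ∂(law m y σ) = ∫ x, φ (y x σ) ∂m := fun σ =>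
    integral_map (h.continuous_space σ).aemeasurable hφ.continuous.aestronglyMeasurable
  simp_rw [hint]
  obtain ⟨K, hK⟩ := hφ.lipschitzWith_of_hasCompactSupport hφc (by simp)
  have hφi : ∀ σ, Integrable (fun x => φ (y x σ)) m := fun σ => by
    obtain ⟨B, hB⟩ := hφc.exists_bound_of_continuous hφ.continuous
    exact Integrable.of_bound (hφ.continuous.comp (h.continuous_space σ)).aestronglyMeasurable B
      (ae_of_all _ fun x => hB _)
  rw [hasDerivWithinAt_iff_tendsto_slope]
  set A : Rn n → ℝ := fun x => 1 / lam * (c / 2 * (1 + T) * (1 + 2 * growthConst c lam T) *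
      (1 + ‖x‖ + √(moment2 m)))
  have hA : Integrable A m :=
    ((((integrable_const _).add (h.dens.memLp_id.integrable (by norm_num)).norm).add
      (integrable_const _)).const_mul _).const_mul _
  have hslope : ∀ σ, slope (fun σ => ∫ x, φ (y x σ) ∂m) s σ =
      ∫ x, slope (fun σ => φ (y x σ)) s σ ∂m := fun σ => by
    simp_rw [slope_def_field]
    rw [integral_div, integral_sub (hφi σ) (hφi s)]
  simp_rw [funext hslope]
  refine tendsto_integral_filter_of_dominated_convergence (fun x => K * A x) ?_ ?_
    (hA.const_mul _) ?_
  · refine Eventually.of_forall fun σ => ?_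
    simp_rw [slope_def_field]
    exact (((hφi σ).sub (hφi s)).div_const _).1
  · filter_upwards [self_mem_nhdsWithin] with σ hσ
    refine ae_of_all _ fun x => ?_
    have hne : 0 < |σ - s| := abs_pos.2 (sub_ne_zero.2 hσ.2)
    rw [slope_def_field, norm_div, Real.norm_eq_abs (σ - s), div_le_iff₀ hne]
    have h1 := hK.dist_le_mul (y x σ) (y x s)
    rw [dist_eq_norm, dist_eq_norm] at h1
    refine h1.trans ?_
    rw [mul_assoc]
    exact mul_le_mul_of_nonneg_left (h.norm_sub_time_le x hs hσ.1) K.2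
  · refine ae_of_all _ fun x => ?_
    rw [← hasDerivWithinAt_iff_tendsto_slope]
    have h1 := ((hφ.differentiable (by simp)) (y x s)).hasGradientAt.hasFDerivAt
    exact h1.comp_hasDerivWithinAt s (h.hasDerivWithinAt x hs)

lemma isHJBFPSolution (h : RegularFlow c lam T t Φ ΦT F FT m y)
    (hFc : ∀ x, Continuous fun s => F (y x s) (law m y s)) :
    IsHJBFPSolution lam T F FT t m (valueFn lam T F FT m y) (law m y) where
  differentiable s hs x := (h.hasGradientAt_valueFn hFc x hs).differentiableAt
  continuous_gradient := by
    have hc : Continuous fun p : Rn n × ℝ => adjoint T F FT m y (invFlow y p.2 p.1) p.2 :=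
      h.continuous_adjoint.comp (h.continuous_invFlow.prodMk continuous_snd)
    exact hc.continuousOn.congr fun p hp => h.gradient_valueFn hFc p.1 hp.2
  hjb x s hs := by
    rw [h.gradient_valueFn hFc x hs]
    exact h.hasDerivWithinAt_valueFn hFc x hs
  final x := by
    rw [valueFn, flowValue, h.apply_invFlow]
    simp
  density s _ := h.density s
  fp φ hφ hφc s hs := by
    refine (h.hasDerivWithinAt_integral_law hφ hφc hs).congr_deriv ?_
    have hgr : Continuous fun x => gradient φ x :=
      ((InnerProductSpace.toDual ℝ (Rn n)).symm.continuous).comp (hφ.continuous_fderiv (by simp))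
    have hz : Continuous fun x => adjoint T F FT m y (invFlow y s x) s :=
      h.continuous_adjoint.comp ((h.continuous_invFlow.comp
        (by fun_prop : Continuous fun x : Rn n => (x, s))).prodMk continuous_const)
    simp_rw [h.gradient_valueFn hFc _ hs]
    rw [law, integral_map (h.continuous_space s).aemeasurable
      (hgr.inner hz).aestronglyMeasurable, ← integral_const_mul]
    simp_rw [h.invFlow_apply, inner_smul_right]
  initial := h.law_initial

lemma valueFn_initial (h : RegularFlow c lam T t Φ ΦT F FT m y) (x : Rn n) :
    valueFn lam T F FT m y x t = uFormula lam T F FT t m y x := by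
  rw [valueFn, h.invFlow_initial]
  rfl

end RegularFlow

/-! ### Random paths of finite energy -/

/-- A random path `X` with velocity `a` of finite energy on `[t, T]`, whose laws are densities. -/
structure IsRandomPath {Ω : Type*} [MeasurableSpace Ω] (t T : ℝ) (P : Measure Ω)
    (X a : Ω → ℝ → Rn n) : Prop where
  measurable_path : Measurable (Function.uncurry X)
  measurable_velocity : Measurable (Function.uncurry a)
  energy : Integrable (fun p : Ω × ℝ => ‖a p.1 p.2‖ ^ 2)
    (P.prod (volume.restrict (Set.Icc t T)))
  ode : ∀ᵐ q ∂P, ∀ s ∈ Set.Icc t T, X q s = X q t + ∫ σ in t..s, a q σ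
  density : ∀ s ∈ Set.Icc t T, IsDensity (P.map fun q => X q s)

/-- The cost of a random path: `λ/2` times its energy, plus functionals of its laws. -/
noncomputable def action {Ω : Type*} [MeasurableSpace Ω] (lam T t : ℝ)
    (Φ ΦT : Measure (Rn n) → ℝ) (P : Measure Ω) (X a : Ω → ℝ → Rn n) : ℝ :=
  lam / 2 * (∫ s in t..T, ∫ q, ‖a q s‖ ^ 2 ∂P) + (∫ s in t..T, Φ (P.map fun q => X q s))
    + ΦT (P.map fun q => X q T)

/-- Linearity of the integral for a sum of five terms. -/
lemma integral_add_sub_sub_add {Ω : Type*} [MeasurableSpace Ω] {P : Measure Ω}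
    {f₁ f₂ f₃ f₄ f₅ : Ω → ℝ} (h₁ : Integrable f₁ P) (h₂ : Integrable f₂ P) (h₃ : Integrable f₃ P)
    (h₄ : Integrable f₄ P) (h₅ : Integrable f₅ P) :
    ∫ q, (f₁ q + f₂ q - f₃ q - f₄ q + f₅ q) ∂P =
      (∫ q, f₁ q ∂P) + (∫ q, f₂ q ∂P) - (∫ q, f₃ q ∂P) - (∫ q, f₄ q ∂P) + ∫ q, f₅ q ∂P := by
  have e : ∀ q, f₁ q + f₂ q - f₃ q - f₄ q + f₅ q = (f₁ + f₂ - f₃ - f₄ + f₅) q := fun _ => rfl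
  simp_rw [e]
  rw [integral_add' (((h₁.add h₂).sub h₃).sub h₄) h₅, integral_sub' ((h₁.add h₂).sub h₃) h₄,
    integral_sub' (h₁.add h₂) h₃, integral_add' h₁ h₂]

section RandomPath

variable {Ω : Type*} [MeasurableSpace Ω] {P : Measure Ω} {t T : ℝ}

lemma norm_integral_sq_le {a : ℝ → Rn n} (ha : MemLp a 2 (volume.restrict (Set.Icc t T))) {r s : ℝ}
    (hr : r ∈ Set.Icc t T) (hs : s ∈ Set.Icc t T) :
    ‖∫ σ in r..s, a σ‖ ^ 2 ≤ |s - r| * ∫ σ, ‖a σ‖ ^ 2 ∂(volume.restrict (Set.Icc t T)) := by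
  have hsub : Set.uIoc r s ⊆ Set.Icc t T :=
    Set.uIoc_subset_uIcc.trans (Set.uIcc_subset_Icc hr hs)
  set μ := volume.restrict (Set.uIoc r s)
  have hμ : μ ≤ volume.restrict (Set.Icc t T) := Measure.restrict_mono hsub le_rfl
  have haμ : MemLp a 2 μ := ha.mono_measure hμ
  have hfin : IsFiniteMeasure μ := ⟨by simp [μ, Set.uIoc]⟩
  have h1 : ‖∫ σ in r..s, a σ‖ ≤ ∫ σ, ‖‖a σ‖‖ * ‖(1 : ℝ)‖ ∂μ := by
    simpa using intervalIntegral.norm_integral_le_integral_norm_uIoc (f := a) (μ := volume)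
  have h2 := integral_norm_mul_norm_le haμ.norm (memLp_const (1 : ℝ))
  have h3 := pow_le_pow_left₀ (norm_nonneg _) (h1.trans h2) 2
  refine h3.trans ?_
  rw [mul_pow, Real.sq_sqrt (integral_nonneg fun _ => by positivity),
    Real.sq_sqrt (integral_nonneg fun _ => by positivity), mul_comm]
  have h4 : ∫ _, ‖(1 : ℝ)‖ ^ 2 ∂μ = |s - r| := by
    simp [μ, Set.uIoc, Measure.real, max_sub_min_eq_abs']
    exact abs_sub_comm _ _
  rw [h4]
  refine mul_le_mul_of_nonneg_left ?_ (abs_nonneg _)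
  simp only [norm_norm]
  exact integral_mono_measure hμ (ae_of_all _ fun _ => by positivity) (integrable_sq_of_memLp ha)

lemma ae_memLp_of_prod [SFinite P] {a : Ω → ℝ → Rn n}
    (ha : MemLp (fun p : Ω × ℝ => a p.1 p.2) 2 (P.prod (volume.restrict (Set.Icc t T)))) :
    ∀ᵐ q ∂P, MemLp (a q) 2 (volume.restrict (Set.Icc t T)) := by
  filter_upwards [(integrable_sq_of_memLp ha).prod_right_ae, ha.1.prodMk_left] with q h1 h2
  exact memLp_two_of_sq h2 h1

/-- The mean square displacement over a time step is controlled by the energy. -/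
lemma integral_norm_displacement_sq_le [SFinite P] {a : Ω → ℝ → Rn n}
    (ha : MemLp (fun p : Ω × ℝ => a p.1 p.2) 2 (P.prod (volume.restrict (Set.Icc t T)))) {r s : ℝ}
    (hr : r ∈ Set.Icc t T) (hs : s ∈ Set.Icc t T) {Z : Ω → Rn n}
    (hZ : ∀ᵐ q ∂P, Z q = ∫ σ in r..s, a q σ) :
    ∫ q, ‖Z q‖ ^ 2 ∂P ≤
      |s - r| * ∫ p, ‖a p.1 p.2‖ ^ 2 ∂(P.prod (volume.restrict (Set.Icc t T))) := by
  have hi := integrable_sq_of_memLp ha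
  rw [integral_prod _ hi, ← integral_const_mul]
  refine integral_mono_of_nonneg (ae_of_all _ fun q => by positivity)
    (hi.integral_prod_left.const_mul _) ?_
  filter_upwards [hZ, ae_memLp_of_prod ha] with q h1 h2
  rw [h1]
  exact norm_integral_sq_le h2 hr hs

namespace IsRandomPath

variable {X a : Ω → ℝ → Rn n}

lemma measurable_at (h : IsRandomPath t T P X a) (s : ℝ) : Measurable fun q => X q s :=
  h.measurable_path.comp (measurable_id.prodMk measurable_const)

lemma memLp_velocity (h : IsRandomPath t T P X a) :
    MemLp (fun p : Ω × ℝ => a p.1 p.2) 2 (P.prod (volume.restrict (Set.Icc t T))) :=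
  memLp_two_of_sq h.measurable_velocity.aestronglyMeasurable h.energy

lemma memLp_at (h : IsRandomPath t T P X a) {s : ℝ} (hs : s ∈ Set.Icc t T) :
    MemLp (fun q => X q s) 2 P :=
  (h.density s hs).memLp_id.comp_of_map (h.measurable_at s).aemeasurable

lemma ae_sub_eq [SFinite P] (h : IsRandomPath t T P X a) {r s : ℝ} (hr : r ∈ Set.Icc t T)
    (hs : s ∈ Set.Icc t T) : ∀ᵐ q ∂P, X q s - X q r = ∫ σ in r..s, a q σ := by
  filter_upwards [h.ode, ae_memLp_of_prod h.memLp_velocity] with q h1 h2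
  have ht : t ∈ Set.Icc t T := ⟨le_rfl, hr.1.trans hr.2⟩
  have hi : ∀ {u}, u ∈ Set.Icc t T → IntervalIntegrable (a q) volume t u := fun {u} hu => by
    rw [intervalIntegrable_iff_integrableOn_Icc_of_le hu.1]
    exact (h2.integrable (by norm_num)).mono_measure
      (Measure.restrict_mono (Set.Icc_subset_Icc_right hu.2) le_rfl)
  rw [h1 s hs, h1 r hr, ← intervalIntegral.integral_interval_sub_left (hi hs) (hi hr)]
  abel

lemma memLp_path [IsProbabilityMeasure P] (h : IsRandomPath t T P X a) (hle : t ≤ T) :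
    MemLp (fun p : Ω × ℝ => X p.1 p.2) 2 (P.prod (volume.restrict (Set.Icc t T))) := by
  have ht : t ∈ Set.Icc t T := ⟨le_rfl, hle⟩
  refine memLp_two_of_sq h.measurable_path.aestronglyMeasurable ?_
  have hb : Integrable (fun p : Ω × ℝ => 2 * ‖X p.1 t‖ ^ 2 +
      2 * ((T - t) * ∫ σ, ‖a p.1 σ‖ ^ 2 ∂(volume.restrict (Set.Icc t T))))
      (P.prod (volume.restrict (Set.Icc t T))) :=
    (((integrable_sq_of_memLp (h.memLp_at ht)).const_mul 2).add
      ((h.energy.integral_prod_left.const_mul (T - t)).const_mul 2)).comp_fst _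
  refine hb.mono' (h.measurable_path.norm.pow_const 2).aestronglyMeasurable ?_
  have e1 : ∀ᵐ q ∂P, ∀ s ∈ Set.Icc t T, ‖X q s‖ ^ 2 ≤ 2 * ‖X q t‖ ^ 2 +
      2 * ((T - t) * ∫ σ, ‖a q σ‖ ^ 2 ∂(volume.restrict (Set.Icc t T))) := by
    filter_upwards [h.ode, ae_memLp_of_prod h.memLp_velocity] with q h1 h2 s hs
    have h3 := norm_integral_sq_le h2 ht hs
    have h4 : |s - t| * ∫ σ, ‖a q σ‖ ^ 2 ∂(volume.restrict (Set.Icc t T)) ≤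
        (T - t) * ∫ σ, ‖a q σ‖ ^ 2 ∂(volume.restrict (Set.Icc t T)) := by
      refine mul_le_mul_of_nonneg_right ?_ (integral_nonneg fun _ => by positivity)
      rw [abs_of_nonneg (by linarith [hs.1])]
      linarith [hs.2]
    rw [h1 s hs]
    have h5 := pow_le_pow_left₀ (norm_nonneg _) (norm_add_le (X q t) (∫ σ in t..s, a q σ)) 2
    nlinarith [sq_nonneg (‖X q t‖ - ‖∫ σ in t..s, a q σ‖)]
  filter_upwards [Measure.quasiMeasurePreserving_fst.ae e1,
    Measure.quasiMeasurePreserving_snd.ae (ae_restrict_mem measurableSet_Icc)] with p h1 h2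
  rw [Real.norm_of_nonneg (by positivity)]
  exact h1 p.2 h2

/-- The running cost is continuous in time. -/
lemma continuousOn_potential [IsProbabilityMeasure P] (h : IsRandomPath t T P X a) {c : ℝ}
    {Φ : Measure (Rn n) → ℝ} {Ψ : Rn n → Measure (Rn n) → ℝ} (hΨ : IsPotential c Φ Ψ) :
    ContinuousOn (fun s => Φ (P.map fun q => X q s)) (Set.Icc t T) := by
  intro s hs
  have hc := hΨ.nonneg (h.density s hs)
  set A := ∫ p, ‖a p.1 p.2‖ ^ 2 ∂(P.prod (volume.restrict (Set.Icc t T)))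
  have hA : 0 ≤ A := integral_nonneg fun _ => by positivity
  set D := √(∫ q, ‖Dx Ψ (X q s) (P.map fun q => X q s)‖ ^ 2 ∂P)
  rw [ContinuousWithinAt, tendsto_iff_norm_sub_tendsto_zero]
  have hcont : Continuous fun σ => D * √(|σ - s| * A) + c / 2 * (|σ - s| * A) := by fun_prop
  have hlim := (hcont.tendsto' s 0 (by simp)).mono_left
    (nhdsWithin_le_nhds (s := Set.Icc t T))
  refine squeeze_zero' (Eventually.of_forall fun _ => norm_nonneg _) ?_ hlim
  filter_upwards [self_mem_nhdsWithin] with σ hσ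
  have h1 := hΨ.abs_sub_le_of_map (P := P) (h.measurable_at s) (h.measurable_at σ) (h.density s hs)
    (h.density σ hσ)
  have h2 := integral_norm_displacement_sq_le h.memLp_velocity hs hσ (h.ae_sub_eq hs hσ)
  refine h1.trans ?_
  gcongr

end IsRandomPath

end RandomPath

/-! ### The quadratic expansion of the cost around the flow -/

namespace RegularFlow

variable {c lam T t : ℝ} {Φ ΦT : Measure (Rn n) → ℝ} {F FT : Rn n → Measure (Rn n) → ℝ}
  {Ω : Type*} [MeasurableSpace Ω] {P : Measure Ω}
  {y : Rn n → ℝ → Rn n} {Y₀ : Ω → Rn n}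

lemma law_eq (h : RegularFlow c lam T t Φ ΦT F FT (P.map Y₀) y) (hY₀ : Measurable Y₀) (s : ℝ) :
    law (P.map Y₀) y s = P.map fun q => y (Y₀ q) s :=
  law_map hY₀ (h.continuous_space s).aemeasurable

/-- A function of the flow with linear growth is square-integrable along the random flow. -/
lemma memLp_prod [IsProbabilityMeasure P]
    (h : RegularFlow c lam T t Φ ΦT F FT (P.map Y₀) y) (hY₀ : Measurable Y₀)
    {f : Rn n → ℝ → Rn n} (hf : Continuous fun p : Rn n × ℝ => f p.1 p.2) {K : ℝ}
    (hb : ∀ x, ∀ s ∈ Set.Icc t T, ‖f x s‖ ≤ K * (1 + ‖x‖ + √(moment2 (P.map Y₀)))) :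
    MemLp (fun p : Ω × ℝ => f (Y₀ p.1) p.2) 2 (P.prod (volume.restrict (Set.Icc t T))) := by
  have hY2 : MemLp Y₀ 2 P := h.dens.memLp_id.comp_of_map hY₀.aemeasurable
  have hg : MemLp (fun q => 1 + ‖Y₀ q‖ + √(moment2 (P.map Y₀))) 2 P :=
    ((memLp_const (1 : ℝ)).add hY2.norm).add (memLp_const _)
  refine (hg.comp_fst (volume.restrict (Set.Icc t T))).of_le_mul (c := K) ?_ ?_
  · exact (hf.measurable.comp ((hY₀.comp measurable_fst).prodMk
      measurable_snd)).aestronglyMeasurable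
  · filter_upwards [Measure.quasiMeasurePreserving_snd.ae (ae_restrict_mem measurableSet_Icc)]
      with p hp
    rw [Real.norm_of_nonneg (by positivity)]
    exact hb _ _ hp

/-- The random flow is a random path of finite energy. -/
lemma isRandomPath [IsProbabilityMeasure P]
    (h : RegularFlow c lam T t Φ ΦT F FT (P.map Y₀) y) (hY₀ : Measurable Y₀) :
    IsRandomPath t T P (fun q s => y (Y₀ q) s)
      (fun q s => -(1 / lam) • adjoint T F FT (P.map Y₀) y (Y₀ q) s) where
  measurable_path := h.continuous_uncurry.measurable.comp
    ((hY₀.comp measurable_fst).prodMk measurable_snd)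
  measurable_velocity := (h.continuous_adjoint.measurable.comp
    ((hY₀.comp measurable_fst).prodMk measurable_snd)).const_smul (-(1 / lam))
  energy := integrable_sq_of_memLp ((h.memLp_prod hY₀ h.continuous_adjoint
    fun x _ hs => h.norm_adjoint_le x hs).const_smul (-(1 / lam)))
  ode := ae_of_all _ fun q s hs =>
    h.eq_add_integral (Y₀ q) ⟨le_rfl, h.setting.t_le⟩ hs
  density s _ := by
    rw [← h.law_eq hY₀]
    exact h.density s

/-- The cost of a random path exceeds the cost of the flow by a linear term in the initial
displacement, the energy of the relative velocity, and an error quadratic in the displacement. -/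
lemma abs_action_sub_le [IsProbabilityMeasure P]
    (h : RegularFlow c lam T t Φ ΦT F FT (P.map Y₀) y) (hY₀ : Measurable Y₀)
    {X a : Ω → ℝ → Rn n} (hX : IsRandomPath t T P X a) :
    |action lam T t Φ ΦT P X a
      - action lam T t Φ ΦT P (fun q s => y (Y₀ q) s)
          (fun q s => -(1 / lam) • adjoint T F FT (P.map Y₀) y (Y₀ q) s)
      - (∫ q, inner ℝ (adjoint T F FT (P.map Y₀) y (Y₀ q) t) (X q t - Y₀ q) ∂P)
      - lam / 2 * ∫ p, ‖a p.1 p.2 + (1 / lam) • adjoint T F FT (P.map Y₀) y (Y₀ p.1) p.2‖ ^ 2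
          ∂(P.prod (volume.restrict (Set.Icc t T)))|
      ≤ c / 2 * (∫ s in t..T, ∫ q, ‖X q s - y (Y₀ q) s‖ ^ 2 ∂P)
        + c / 2 * ∫ q, ‖X q T - y (Y₀ q) T‖ ^ 2 ∂P := by
  have S := h.setting
  have hle := S.t_le
  have hlam := S.lam_pos
  have htm : t ∈ Set.Icc t T := ⟨le_rfl, hle⟩
  have hTm : T ∈ Set.Icc t T := ⟨hle, le_rfl⟩
  set m := P.map Y₀ with hm
  set ν := volume.restrict (Set.Icc t T) with hν
  have hY := h.isRandomPath hY₀
  have hY2 : MemLp Y₀ 2 P := h.dens.memLp_id.comp_of_map hY₀.aemeasurable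
  have lz : MemLp (fun p : Ω × ℝ => adjoint T F FT m y (Y₀ p.1) p.2) 2 (P.prod ν) :=
    h.memLp_prod hY₀ h.continuous_adjoint fun x _ hs => h.norm_adjoint_le x hs
  have lg : MemLp (fun p : Ω × ℝ => Dx F (y (Y₀ p.1) p.2) (law m y p.2)) 2 (P.prod ν) :=
    h.memLp_prod (f := fun x s => Dx F (y x s) (law m y s)) hY₀ h.continuous_force
      fun x _ hs => h.norm_force_le h.pot x hs
  have lX := hX.memLp_path hle
  have lY := hY.memLp_path hle
  have la := hX.memLp_velocity
  have lδ : MemLp (fun p : Ω × ℝ => X p.1 p.2 - y (Y₀ p.1) p.2) 2 (P.prod ν) := lX.sub lY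
  have lη : MemLp (fun p : Ω × ℝ => a p.1 p.2 + (1 / lam) • adjoint T F FT m y (Y₀ p.1) p.2) 2
      (P.prod ν) := la.add (lz.const_smul (1 / lam))
  have f1 := integrable_sq_of_memLp la
  have f2 := integrable_sq_of_memLp lz
  have f3 := integrable_sq_of_memLp lη
  have f4 := integrable_inner_of_memLp lg lδ
  have f5 := integrable_sq_of_memLp lδ
  have lp : MemLp (fun q => Dx FT (y (Y₀ q) T) (law m y T)) 2 P :=
    h.potT.memLp_Dx (hY.memLp_at hTm) (h.density T)
  have lzt : MemLp (fun q => adjoint T F FT m y (Y₀ q) t) 2 P := by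
    have hg : MemLp (fun q => 1 + ‖Y₀ q‖ + √(moment2 m)) 2 P :=
      ((memLp_const (1 : ℝ)).add hY2.norm).add (memLp_const _)
    have hzm : Measurable fun x => adjoint T F FT m y x t :=
      (h.continuous_adjoint.comp (by fun_prop : Continuous fun x : Rn n => (x, t))).measurable
    refine hg.of_le_mul (hzm.comp hY₀).aestronglyMeasurable (ae_of_all _ fun q => ?_)
      (c := c / 2 * (1 + T) * (1 + 2 * growthConst c lam T))
    rw [Real.norm_of_nonneg (by positivity)]
    exact h.norm_adjoint_le _ htm
  have g1 := integrable_inner_of_memLp lp ((hX.memLp_at hTm).sub (hY.memLp_at hTm))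
  have g2 := integrable_inner_of_memLp lzt ((hX.memLp_at htm).sub hY2)
  simp only [Pi.sub_apply] at g1 g2
  -- integrate the pathwise expansion of the kinetic energy
  have hkin : lam / 2 * (∫ p, ‖a p.1 p.2‖ ^ 2 ∂(P.prod ν)) =
      1 / (2 * lam) * (∫ p, ‖adjoint T F FT m y (Y₀ p.1) p.2‖ ^ 2 ∂(P.prod ν))
      + lam / 2 * (∫ p, ‖a p.1 p.2 + (1 / lam) • adjoint T F FT m y (Y₀ p.1) p.2‖ ^ 2 ∂(P.prod ν))
      - (∫ q, inner ℝ (Dx FT (y (Y₀ q) T) (law m y T)) (X q T - y (Y₀ q) T) ∂P)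
      - (∫ p, inner ℝ (Dx F (y (Y₀ p.1) p.2) (law m y p.2)) (X p.1 p.2 - y (Y₀ p.1) p.2)
          ∂(P.prod ν))
      + ∫ q, inner ℝ (adjoint T F FT m y (Y₀ q) t) (X q t - Y₀ q) ∂P := by
    have i1 := f1.integral_prod_left.const_mul (lam / 2)
    have i2 := f2.integral_prod_left.const_mul (1 / (2 * lam))
    have i3 := f3.integral_prod_left.const_mul (lam / 2)
    have i4 := f4.integral_prod_left
    rw [integral_prod _ f1, integral_prod _ f2, integral_prod _ f3, integral_prod _ f4,
      ← integral_const_mul, ← integral_const_mul, ← integral_const_mul,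
      ← integral_add_sub_sub_add i2 i3 g1 i4 g2]
    refine integral_congr_ae ?_
    filter_upwards [hX.ode, ae_memLp_of_prod la] with q h1 h2
    have j1 : IntervalIntegrable (a q) volume t T :=
      (intervalIntegrable_iff_integrableOn_Icc_of_le hle).2 (h2.integrable (by norm_num))
    have j2 : IntervalIntegrable (fun σ => ‖a q σ‖ ^ 2) volume t T :=
      (intervalIntegrable_iff_integrableOn_Icc_of_le hle).2 (integrable_sq_of_memLp h2)
    have := h.kinetic_expansion (Y₀ q) htm j1 j2 h1
    simp only [intervalIntegral_eq_Icc hle, h.initial] at this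
    exact this
  -- compare the running costs at each time
  have hrun : |(∫ s in t..T, Φ (P.map fun q => X q s)) -
      (∫ s in t..T, Φ (P.map fun q => y (Y₀ q) s)) -
      (∫ p, inner ℝ (Dx F (y (Y₀ p.1) p.2) (law m y p.2)) (X p.1 p.2 - y (Y₀ p.1) p.2)
          ∂(P.prod ν))| ≤ c / 2 * (∫ s in t..T, ∫ q, ‖X q s - y (Y₀ q) s‖ ^ 2 ∂P) := by
    rw [integral_prod_symm _ f4, intervalIntegral_eq_Icc hle, intervalIntegral_eq_Icc hle,
      intervalIntegral_eq_Icc hle]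
    have k1 : Integrable (fun s => Φ (P.map fun q => X q s)) ν :=
      (hX.continuousOn_potential h.pot).integrableOn_compact isCompact_Icc
    have k2 : Integrable (fun s => Φ (P.map fun q => y (Y₀ q) s)) ν :=
      (hY.continuousOn_potential h.pot).integrableOn_compact isCompact_Icc
    have k3 : Integrable (fun s => Φ (P.map fun q => X q s) - Φ (P.map fun q => y (Y₀ q) s)) ν :=
      k1.sub k2
    rw [← integral_sub k1 k2, ← integral_sub k3 f4.integral_prod_right,
      ← integral_const_mul]
    refine norm_integral_le_of_norm_le (G := ℝ) (f5.integral_prod_right.const_mul _) ?_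
    filter_upwards [ae_restrict_mem measurableSet_Icc] with s hs
    have := h.pot.abs_displacement_le (hY.measurable_at s) (hX.measurable_at s)
      (hY.density s hs) (hX.density s hs)
    rw [← h.law_eq hY₀] at this
    rw [← h.law_eq hY₀]
    exact this
  have hfin := h.potT.abs_displacement_le (hY.measurable_at T) (hX.measurable_at T)
      (hY.density T hTm) (hX.density T hTm)
  rw [← h.law_eq hY₀] at hfin
  have e1 : ∫ s in t..T, ∫ q, ‖a q s‖ ^ 2 ∂P = ∫ p, ‖a p.1 p.2‖ ^ 2 ∂(P.prod ν) := by
    rw [intervalIntegral_eq_Icc hle, integral_prod_symm _ f1]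
  have e2 : lam / 2 * (∫ s in t..T, ∫ q, ‖-(1 / lam) • adjoint T F FT m y (Y₀ q) s‖ ^ 2 ∂P) =
      1 / (2 * lam) * (∫ p, ‖adjoint T F FT m y (Y₀ p.1) p.2‖ ^ 2 ∂(P.prod ν)) := by
    simp_rw [norm_smul, mul_pow, norm_neg, Real.norm_eq_abs, sq_abs, integral_const_mul]
    rw [intervalIntegral.integral_const_mul, intervalIntegral_eq_Icc hle, integral_prod_symm _ f2]
    field_simp
    rfl
  rw [action, action, e1, e2, ← h.law_eq hY₀ T]
  have hrun' := abs_le.1 hrun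
  have hfin' := abs_le.1 hfin
  exact abs_le.2 ⟨by linarith, by linarith⟩

/-- The flow minimizes the cost among random paths with the same initial positions: the relative
kinetic energy dominates the possible lack of convexity of the costs because `λ > cT(1+T)`. -/
lemma action_le [IsProbabilityMeasure P]
    (h : RegularFlow c lam T t Φ ΦT F FT (P.map Y₀) y) (hY₀ : Measurable Y₀)
    {X a : Ω → ℝ → Rn n} (hX : IsRandomPath t T P X a) (h0 : ∀ᵐ q ∂P, X q t = Y₀ q) :
    action lam T t Φ ΦT P (fun q s => y (Y₀ q) s)
      (fun q s => -(1 / lam) • adjoint T F FT (P.map Y₀) y (Y₀ q) s) ≤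
    action lam T t Φ ΦT P X a := by
  have S := h.setting
  have hle := S.t_le
  have hc := S.c_nonneg
  have hT := S.T_pos
  have htm : t ∈ Set.Icc t T := ⟨le_rfl, hle⟩
  have hTm : T ∈ Set.Icc t T := ⟨hle, le_rfl⟩
  have key := h.abs_action_sub_le hY₀ hX
  have hzero : ∫ q, inner ℝ (adjoint T F FT (P.map Y₀) y (Y₀ q) t) (X q t - Y₀ q) ∂P = 0 := by
    refine integral_eq_zero_of_ae ?_
    filter_upwards [h0] with q hq
    simp [hq]
  set η : Ω → ℝ → Rn n := fun q s => a q s + (1 / lam) • adjoint T F FT (P.map Y₀) y (Y₀ q) s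
  set B := ∫ p, ‖η p.1 p.2‖ ^ 2 ∂(P.prod (volume.restrict (Set.Icc t T)))
  have hY := h.isRandomPath hY₀
  have hB : 0 ≤ B := integral_nonneg fun _ => by positivity
  have lη : MemLp (fun p : Ω × ℝ => η p.1 p.2) 2 (P.prod (volume.restrict (Set.Icc t T))) := by
    have := hX.memLp_velocity.sub hY.memLp_velocity
    have e : (fun p : Ω × ℝ => η p.1 p.2) = (fun p : Ω × ℝ => a p.1 p.2) -
        fun p : Ω × ℝ => -(1 / lam) • adjoint T F FT (P.map Y₀) y (Y₀ p.1) p.2 := by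
      funext p
      simp only [η, Pi.sub_apply, neg_smul, sub_neg_eq_add]
    rw [e]
    exact this
  have hδ : ∀ s ∈ Set.Icc t T, ∫ q, ‖X q s - y (Y₀ q) s‖ ^ 2 ∂P ≤ T * B := fun s hs => by
    have h1 := integral_norm_displacement_sq_le lη htm hs (Z := fun q => X q s - y (Y₀ q) s) ?_
    · refine h1.trans (mul_le_mul_of_nonneg_right ?_ hB)
      rw [abs_of_nonneg (by linarith [hs.1])]
      linarith [hs.2, S.t_mem.1]
    · filter_upwards [hX.ode, h0, ae_memLp_of_prod hX.memLp_velocity] with q h1 h2 h3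
      have i1 : IntervalIntegrable (a q) volume t s := by
        rw [intervalIntegrable_iff_integrableOn_Icc_of_le hs.1]
        exact (h3.integrable (by norm_num)).mono_measure
          (Measure.restrict_mono (Set.Icc_subset_Icc_right hs.2) le_rfl)
      have i2 : IntervalIntegrable (fun σ => (1 / lam) • adjoint T F FT (P.map Y₀) y (Y₀ q) σ)
          volume t s :=
        ((h.continuous_adjoint_time (Y₀ q)).const_smul (1 / lam)).intervalIntegrable _ _
      rw [h1 s hs, h2, h.eq_sub_integral (Y₀ q) hs, intervalIntegral.integral_add i1 i2,
        intervalIntegral.integral_smul]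
      abel
  have hint : ∫ s in t..T, ∫ q, ‖X q s - y (Y₀ q) s‖ ^ 2 ∂P ≤ T * (T * B) := by
    have h1 := intervalIntegral.norm_integral_le_of_norm_le_const (E := ℝ) (a := t) (b := T)
      (f := fun s => ∫ q, ‖X q s - y (Y₀ q) s‖ ^ 2 ∂P) (C := T * B) fun s hs => by
        rw [Set.uIoc_of_le hle] at hs
        rw [Real.norm_of_nonneg (integral_nonneg fun _ => by positivity)]
        exact hδ s ⟨hs.1.le, hs.2⟩
    refine (le_abs_self _).trans (h1.trans ?_)
    rw [mul_comm]
    refine mul_le_mul_of_nonneg_right ?_ (by positivity)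
    rw [abs_of_nonneg (by linarith)]
    linarith [S.t_mem.1]
  rw [hzero] at key
  have k1 := (abs_le.1 key).1
  have k2 : c / 2 * (∫ s in t..T, ∫ q, ‖X q s - y (Y₀ q) s‖ ^ 2 ∂P) ≤ c / 2 * (T * (T * B)) := by
    gcongr
  have k3 : c / 2 * ∫ q, ‖X q T - y (Y₀ q) T‖ ^ 2 ∂P ≤ c / 2 * (T * B) := by
    gcongr
    exact hδ T hTm
  have k4 : c * T * (1 + T) * B ≤ lam * B := mul_le_mul_of_nonneg_right S.lam_gt.le hB
  have k5 : c / 2 * (T * (T * B)) + c / 2 * (T * B) = 1 / 2 * (c * T * (1 + T) * B) := by ring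
  change _ ≤ action lam T t Φ ΦT P X a - _ - 0 - lam / 2 * B at k1
  linarith

end RegularFlow

/-! ### Stability of the optimal cost in the initial law -/

/-- The cost of the flow `y` started from the law `m`. -/
noncomputable def flowAction (lam T t : ℝ) (Φ ΦT : Measure (Rn n) → ℝ)
    (F FT : Rn n → Measure (Rn n) → ℝ) (m : Measure (Rn n)) (y : Rn n → ℝ → Rn n) : ℝ :=
  action lam T t Φ ΦT m y fun x s => -(1 / lam) • adjoint T F FT m y x s

/-- The constant that bounds the quadratic error when the optimal costs from two laws are
compared along a coupling. -/
noncomputable def stabConst (c lam T : ℝ) : ℝ :=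
  (8 * T / lam * (c / 2 * (1 + T)) ^ 2 + 2 * c * (1 + T)) * (1 / (1 - 2 * rate c lam T)) ^ 4

lemma intervalIntegral_le_mul {t T K : ℝ} (ht : t ∈ Set.Icc 0 T) {g : ℝ → ℝ}
    (h0 : ∀ s, 0 ≤ g s) (hg : ∀ s ∈ Set.Icc t T, g s ≤ K) : ∫ s in t..T, g s ≤ T * K := by
  have hK : 0 ≤ K := (h0 t).trans (hg t ⟨le_rfl, ht.2⟩)
  have h1 := intervalIntegral.norm_integral_le_of_norm_le_const (E := ℝ) (a := t) (b := T)
    (f := g) (C := K) fun s hs => by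
      rw [Set.uIoc_of_le ht.2] at hs
      rw [Real.norm_of_nonneg (h0 s)]
      exact hg s ⟨hs.1.le, hs.2⟩
  refine (le_abs_self _).trans (h1.trans ?_)
  rw [mul_comm]
  refine mul_le_mul_of_nonneg_right ?_ hK
  rw [abs_of_nonneg (sub_nonneg.2 ht.2)]
  linarith [ht.1]

lemma stabConst_nonneg {c lam T t : ℝ} (S : Setting c lam T t) : 0 ≤ stabConst c lam T := by
  have := S.T_pos
  have := S.lam_pos
  have := S.c_nonneg
  unfold stabConst
  positivity

lemma taylorConst_nonneg {c lam T t : ℝ} (S : Setting c lam T t) : 0 ≤ taylorConst c lam T := by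
  have := S.T_pos
  have := S.lam_pos
  have := S.c_nonneg
  unfold taylorConst
  positivity

namespace RegularFlow

variable {c lam T t : ℝ} {Φ ΦT : Measure (Rn n) → ℝ} {F FT : Rn n → Measure (Rn n) → ℝ}
  {Ω : Type*} [MeasurableSpace Ω] {P : Measure Ω}

lemma action_eq_flowAction {y : Rn n → ℝ → Rn n} {Y₀ : Ω → Rn n}
    (h : RegularFlow c lam T t Φ ΦT F FT (P.map Y₀) y) (hY₀ : Measurable Y₀) :
    action lam T t Φ ΦT P (fun q s => y (Y₀ q) s)
      (fun q s => -(1 / lam) • adjoint T F FT (P.map Y₀) y (Y₀ q) s) =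
    flowAction lam T t Φ ΦT F FT (P.map Y₀) y := by
  have hl : ∀ s, ((P.map Y₀).map fun x => y x s) = P.map fun q => y (Y₀ q) s := h.law_eq hY₀
  have he : ∀ s, ∫ x, ‖-(1 / lam) • adjoint T F FT (P.map Y₀) y x s‖ ^ 2 ∂(P.map Y₀) =
      ∫ q, ‖-(1 / lam) • adjoint T F FT (P.map Y₀) y (Y₀ q) s‖ ^ 2 ∂P := fun s =>
    integral_map hY₀.aemeasurable (((h.continuous_adjoint.comp
      (by fun_prop : Continuous fun x : Rn n => (x, s))).const_smul
        (-(1 / lam))).norm.pow 2).aestronglyMeasurable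
  simp_rw [flowAction, action, hl, he]

variable [IsProbabilityMeasure P] {Y₁ Y₂ : Ω → Rn n} {y₁ y₂ : Rn n → ℝ → Rn n}

/-- The optimal costs from two laws agree to first order along any coupling of the laws, the
differential being given by the adjoint state at the initial time. -/
lemma abs_flowAction_sub_le (h₁ : RegularFlow c lam T t Φ ΦT F FT (P.map Y₁) y₁)
    (h₂ : RegularFlow c lam T t Φ ΦT F FT (P.map Y₂) y₂) (hY₁ : Measurable Y₁)
    (hY₂ : Measurable Y₂) :
    |flowAction lam T t Φ ΦT F FT (P.map Y₂) y₂ - flowAction lam T t Φ ΦT F FT (P.map Y₁) y₁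
      - ∫ q, inner ℝ (adjoint T F FT (P.map Y₁) y₁ (Y₁ q) t) (Y₂ q - Y₁ q) ∂P|
      ≤ stabConst c lam T * ∫ q, ‖Y₁ q - Y₂ q‖ ^ 2 ∂P := by
  have S := h₁.setting
  have hlam := S.lam_pos
  have hc := S.c_nonneg
  have hT := S.T_pos
  have hκ := S.rate_nonneg
  have hκ2 := S.rate_lt
  have hTm : T ∈ Set.Icc t T := ⟨S.t_le, le_rfl⟩
  have hX := h₂.isRandomPath hY₂
  have key := h₁.abs_action_sub_le hY₁ hX
  rw [h₁.action_eq_flowAction hY₁, h₂.action_eq_flowAction hY₂] at key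
  simp only [h₂.initial] at key
  set E := ∫ q, ‖Y₁ q - Y₂ q‖ ^ 2 ∂P with hE
  have hE0 : 0 ≤ E := integral_nonneg fun _ => by positivity
  have hL1 : MemLp (fun q => Y₁ q - Y₂ q) 2 P :=
    (h₁.dens.memLp_id.comp_of_map hY₁.aemeasurable).sub
      (h₂.dens.memLp_id.comp_of_map hY₂.aemeasurable)
  set κ := rate c lam T with hκdef
  set L := 1 / (1 - 2 * κ) with hL
  have h2κ : 0 < 1 - 2 * κ := by linarith
  have hLpos : 0 < L := by positivity
  have hL_one : 1 ≤ L := by rw [hL, le_div_iff₀ h2κ]; linarith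
  set D := √E * L with hD
  have hD0 : 0 ≤ D := by positivity
  have hDW : ∀ s ∈ Set.Icc t T, W2 (law (P.map Y₁) y₁ s) (law (P.map Y₂) y₂ s) ≤ D := fun s hs => by
    have := IsFlow.W2_law_le S h₁.pot h₁.potT hY₁ hY₂ h₁.dens h₂.dens h₁.flow h₂.flow hs
    rwa [← hκdef, ← hE, div_eq_mul_one_div] at this
  -- the distance of the two paths, and with it that of the laws and of the adjoint states
  set w : Ω → ℝ := fun q => ‖Y₁ q - Y₂ q‖ + √E
  have hw0 : ∀ q, 0 ≤ w q := fun q => by positivity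
  have hpath : ∀ q, ∀ s ∈ Set.Icc t T, ‖y₁ (Y₁ q) s - y₂ (Y₂ q) s‖ ≤ L ^ 2 * w q := fun q s hs => by
    refine (IsFlow.norm_sub_le S h₁.pot h₁.potT h₁.flow h₂.flow hDW (Y₁ q) (Y₂ q) hs).trans ?_
    rw [← hκdef]
    have hLκ : 1 / (1 - κ) ≤ L := one_div_le_one_div_of_le h2κ (by linarith)
    have hκ1 : κ ≤ 1 := by linarith
    calc (‖Y₁ q - Y₂ q‖ + κ * D) / (1 - κ) = (‖Y₁ q - Y₂ q‖ + κ * D) * (1 / (1 - κ)) := by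
          rw [div_eq_mul_one_div]
      _ ≤ (L * ‖Y₁ q - Y₂ q‖ + 1 * D) * L := by
          gcongr
          exact le_mul_of_one_le_left (norm_nonneg _) hL_one
      _ = L ^ 2 * w q := by simp only [w, hD]; ring
  have hDw : ∀ q, D ≤ L ^ 2 * w q := fun q => by
    have h1 : D ≤ L * w q := by
      rw [hD, mul_comm]
      gcongr
      exact le_add_of_nonneg_left (norm_nonneg _)
    refine h1.trans ?_
    rw [sq, mul_assoc]
    exact le_mul_of_one_le_left (by positivity) hL_one
  have hw : Integrable (fun q => w q ^ 2) P := by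
    have : MemLp w 2 P := hL1.norm.add (memLp_const _)
    exact this.integrable_sq
  have hwE : ∫ q, w q ^ 2 ∂P ≤ 4 * E := by
    have h1 : Integrable (fun q => 2 * ‖Y₁ q - Y₂ q‖ ^ 2 + 2 * E) P :=
      ((integrable_sq_of_memLp hL1).const_mul 2).add (integrable_const _)
    have h2 := integral_mono hw h1 fun q => by
      have := sq_nonneg (‖Y₁ q - Y₂ q‖ - √E)
      have h3 := Real.sq_sqrt hE0
      simp only [w]
      nlinarith
    rw [integral_add ((integrable_sq_of_memLp hL1).const_mul 2) (integrable_const _),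
      integral_const_mul, ← hE, integral_const, probReal_univ, one_smul] at h2
    linarith
  have hsq : ∀ {K : ℝ} {g : Ω → ℝ}, (∀ q, 0 ≤ g q) → 0 ≤ K → (∀ q, g q ≤ K * w q) →
      ∫ q, g q ^ 2 ∂P ≤ 4 * K ^ 2 * E := fun {K g} hg hK hgw => by
    have h1 := integral_mono_of_nonneg (ae_of_all P fun q => sq_nonneg (g q))
      (hw.const_mul (K ^ 2)) (ae_of_all P fun q => by
        have := pow_le_pow_left₀ (hg q) (hgw q) 2
        rwa [mul_pow] at this)
    rw [integral_const_mul] at h1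
    refine h1.trans ?_
    calc K ^ 2 * ∫ q, w q ^ 2 ∂P ≤ K ^ 2 * (4 * E) := by gcongr
      _ = _ := by ring
  have hδ : ∀ s ∈ Set.Icc t T, ∫ q, ‖y₂ (Y₂ q) s - y₁ (Y₁ q) s‖ ^ 2 ∂P ≤ 4 * (L ^ 2) ^ 2 * E :=
    fun s hs => hsq (fun q => norm_nonneg _) (by positivity) fun q => by
      rw [norm_sub_rev]
      exact hpath q s hs
  set A := c / 2 * (1 + T) with hA
  have hη : ∀ s ∈ Set.Icc t T, ∫ q, ‖-(1 / lam) • adjoint T F FT (P.map Y₂) y₂ (Y₂ q) s +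
      (1 / lam) • adjoint T F FT (P.map Y₁) y₁ (Y₁ q) s‖ ^ 2 ∂P ≤
      4 * (1 / lam * (A * (2 * L ^ 2))) ^ 2 * E :=
    fun s hs => hsq (fun q => norm_nonneg _) (by positivity) fun q => by
      rw [neg_smul, neg_add_eq_sub, ← smul_sub, norm_smul, Real.norm_of_nonneg (by positivity),
        mul_assoc]
      gcongr
      refine (norm_adjoint_sub_le h₁ h₂ (hpath q) hDW hs).trans ?_
      rw [show A * (2 * L ^ 2) * w q = A * (L ^ 2 * w q + L ^ 2 * w q) by ring]
      exact mul_le_mul_of_nonneg_left (add_le_add_right (hDw q) _) (by positivity)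
  have lη := (hX.memLp_velocity.sub (h₁.isRandomPath hY₁).memLp_velocity)
  have b1 : ∫ p, ‖-(1 / lam) • adjoint T F FT (P.map Y₂) y₂ (Y₂ p.1) p.2 +
      (1 / lam) • adjoint T F FT (P.map Y₁) y₁ (Y₁ p.1) p.2‖ ^ 2
      ∂(P.prod (volume.restrict (Set.Icc t T))) ≤
      T * (4 * (1 / lam * (A * (2 * L ^ 2))) ^ 2 * E) := by
    have hi : Integrable (fun p : Ω × ℝ => ‖-(1 / lam) • adjoint T F FT (P.map Y₂) y₂ (Y₂ p.1) p.2 +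
        (1 / lam) • adjoint T F FT (P.map Y₁) y₁ (Y₁ p.1) p.2‖ ^ 2)
        (P.prod (volume.restrict (Set.Icc t T))) := by
      refine (integrable_sq_of_memLp lη).congr (ae_of_all _ fun p => ?_)
      simp only [Pi.sub_apply, neg_smul, sub_neg_eq_add]
    rw [integral_prod_symm _ hi, ← intervalIntegral_eq_Icc S.t_le]
    exact intervalIntegral_le_mul S.t_mem (fun s => integral_nonneg fun _ => by positivity) hη
  have b2 := intervalIntegral_le_mul S.t_mem (fun s => integral_nonneg fun _ => by positivity) hδ
  have b3 := hδ T hTm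
  have hB0 : 0 ≤ ∫ p, ‖-(1 / lam) • adjoint T F FT (P.map Y₂) y₂ (Y₂ p.1) p.2 +
      (1 / lam) • adjoint T F FT (P.map Y₁) y₁ (Y₁ p.1) p.2‖ ^ 2
      ∂(P.prod (volume.restrict (Set.Icc t T))) := integral_nonneg fun _ => by positivity
  have c1 := mul_le_mul_of_nonneg_left b1 (show 0 ≤ lam / 2 by positivity)
  have c0 := mul_nonneg (show 0 ≤ lam / 2 by positivity) hB0
  have c2 := mul_le_mul_of_nonneg_left b2 (show 0 ≤ c / 2 by positivity)
  have c3 := mul_le_mul_of_nonneg_left b3 (show 0 ≤ c / 2 by positivity)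
  have e : stabConst c lam T * E = lam / 2 * (T * (4 * (1 / lam * (A * (2 * L ^ 2))) ^ 2 * E)) +
      c / 2 * (T * (4 * (L ^ 2) ^ 2 * E)) + c / 2 * (4 * (L ^ 2) ^ 2 * E) := by
    rw [stabConst, ← hκdef, ← hL, ← hA]
    field_simp
    ring
  rw [e]
  have key' := abs_le.1 key
  exact abs_le.2 ⟨by linarith, by linarith⟩

end RegularFlow

/-! ### Growth of the value along the flow -/

/-- The constant in the quadratic growth of the value along the flow. -/
noncomputable def valueGrowth (c lam T C₀ : ℝ) : ℝ :=
  3 * (T / (2 * lam) * (c / 2 * (1 + T) * (1 + 2 * growthConst c lam T)) ^ 2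
    + |C₀| * (1 + T) * (1 + 2 * growthConst c lam T ^ 2))

lemma valueGrowth_nonneg {c lam T t : ℝ} (S : Setting c lam T t) (C₀ : ℝ) :
    0 ≤ valueGrowth c lam T C₀ := by
  have := S.T_pos
  have := S.lam_pos
  unfold valueGrowth
  positivity

namespace RegularFlow

variable {c lam T t C₀ : ℝ} {Φ ΦT : Measure (Rn n) → ℝ} {F FT : Rn n → Measure (Rn n) → ℝ}
  {m : Measure (Rn n)} {y : Rn n → ℝ → Rn n}

lemma abs_cost_le (h : RegularFlow c lam T t Φ ΦT F FT m y) {Ψ : Rn n → Measure (Rn n) → ℝ}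
    (hΨ : ∀ m, IsDensity m → ∀ x, |Ψ x m| ≤ C₀ * (1 + ‖x‖ ^ 2 + moment2 m)) (x : Rn n) {s : ℝ}
    (hs : s ∈ Set.Icc t T) : |Ψ (y x s) (law m y s)| ≤
      |C₀| * (1 + 2 * growthConst c lam T ^ 2) * (1 + ‖x‖ + √(moment2 m)) ^ 2 := by
  have hG := growthConst_nonneg h.setting
  set G := growthConst c lam T
  set r := 1 + ‖x‖ + √(moment2 m) with hr
  have hx := norm_nonneg x
  have hM := Real.sqrt_nonneg (moment2 m)
  have hr1 : 1 ≤ r := by linarith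
  have h1 := pow_le_pow_left₀ (norm_nonneg _) (h.norm_le x hs) 2
  have h2 : moment2 (law m y s) ≤ (G * r) ^ 2 := by
    rw [← Real.sq_sqrt (moment2_nonneg (law m y s))]
    refine pow_le_pow_left₀ (Real.sqrt_nonneg _) ((h.sqrt_moment2_le hs).trans ?_) 2
    gcongr
    linarith
  have hpos : 0 ≤ 1 + ‖y x s‖ ^ 2 + moment2 (law m y s) := by
    have := moment2_nonneg (law m y s)
    positivity
  calc _ ≤ C₀ * (1 + ‖y x s‖ ^ 2 + moment2 (law m y s)) := hΨ _ (h.density s) _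
    _ ≤ |C₀| * (r ^ 2 + (G * r) ^ 2 + (G * r) ^ 2) := by
        gcongr
        · exact le_abs_self _
        · exact one_le_pow₀ hr1
    _ = _ := by ring

lemma abs_uFormula_le (h : RegularFlow c lam T t Φ ΦT F FT m y)
    (hF : ∀ m, IsDensity m → ∀ x, |F x m| ≤ C₀ * (1 + ‖x‖ ^ 2 + moment2 m))
    (hFT : ∀ m, IsDensity m → ∀ x, |FT x m| ≤ C₀ * (1 + ‖x‖ ^ 2 + moment2 m)) (x : Rn n) :
    |uFormula lam T F FT t m y x| ≤ valueGrowth c lam T C₀ * (1 + ‖x‖ ^ 2 + moment2 m) := by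
  have S := h.setting
  have hlam := S.lam_pos
  have hT := S.T_pos
  set G := growthConst c lam T with hG
  set r := 1 + ‖x‖ + √(moment2 m) with hr
  set A := c / 2 * (1 + T) * (1 + 2 * G)
  set K := |C₀| * (1 + 2 * G ^ 2)
  have b1 : ∫ s in t..T, ‖adjoint T F FT m y x s‖ ^ 2 ≤ T * (A * r) ^ 2 :=
    intervalIntegral_le_mul S.t_mem (fun s => by positivity) fun s hs =>
      pow_le_pow_left₀ (norm_nonneg _) (h.norm_adjoint_le x hs) 2
  have b1' : 0 ≤ ∫ s in t..T, ‖adjoint T F FT m y x s‖ ^ 2 :=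
    intervalIntegral.integral_nonneg S.t_le fun _ _ => by positivity
  have b2 : |∫ s in t..T, F (y x s) (law m y s)| ≤ T * (K * r ^ 2) := by
    refine (intervalIntegral.norm_integral_le_of_norm_le_const (E := ℝ) (C := K * r ^ 2)
      fun s hs => ?_).trans ?_
    · rw [Set.uIoc_of_le S.t_le] at hs
      exact h.abs_cost_le hF x ⟨hs.1.le, hs.2⟩
    · rw [mul_comm, abs_of_nonneg (sub_nonneg.2 S.t_le)]
      gcongr
      linarith [S.t_mem.1]
  have b3 : |FT (y x T) (law m y T)| ≤ K * r ^ 2 := h.abs_cost_le hFT x ⟨S.t_le, le_rfl⟩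
  have b4 : r ^ 2 ≤ 3 * (1 + ‖x‖ ^ 2 + moment2 m) := by
    have := Real.sq_sqrt (moment2_nonneg m)
    rw [hr]
    nlinarith [sq_nonneg (1 - ‖x‖), sq_nonneg (1 - √(moment2 m)),
      sq_nonneg (‖x‖ - √(moment2 m))]
  have c1 : |1 / (2 * lam) * ∫ s in t..T, ‖adjoint T F FT m y x s‖ ^ 2| ≤
      1 / (2 * lam) * (T * (A * r) ^ 2) := by
    rw [abs_of_nonneg (by positivity)]
    gcongr
  rw [uFormula]
  calc _ ≤ 1 / (2 * lam) * (T * (A * r) ^ 2) + T * (K * r ^ 2) + K * r ^ 2 :=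
        (abs_add_three _ _ _).trans (add_le_add (add_le_add c1 b2) b3)
    _ = (T / (2 * lam) * A ^ 2 + |C₀| * (1 + T) * (1 + 2 * G ^ 2)) * r ^ 2 := by
        simp only [K]
        ring
    _ ≤ (T / (2 * lam) * A ^ 2 + |C₀| * (1 + T) * (1 + 2 * G ^ 2)) *
          (3 * (1 + ‖x‖ ^ 2 + moment2 m)) := by gcongr
    _ = _ := by rw [valueGrowth]; ring

lemma continuous_valueFn_initial (h : RegularFlow c lam T t Φ ΦT F FT m y)
    (hFc : ∀ x, Continuous fun s => F (y x s) (law m y s)) :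
    Continuous fun x => valueFn lam T F FT m y x t :=
  continuous_iff_continuousAt.2 fun x =>
    (h.hasGradientAt_valueFn hFc x ⟨le_rfl, h.setting.t_le⟩).continuousAt

lemma integrable_valueFn (h : RegularFlow c lam T t Φ ΦT F FT m y)
    (hFc : ∀ x, Continuous fun s => F (y x s) (law m y s))
    (hF : ∀ m, IsDensity m → ∀ x, |F x m| ≤ C₀ * (1 + ‖x‖ ^ 2 + moment2 m))
    (hFT : ∀ m, IsDensity m → ∀ x, |FT x m| ≤ C₀ * (1 + ‖x‖ ^ 2 + moment2 m))
    {μ : Measure (Rn n)} (hμ : IsDensity μ) :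
    Integrable (fun x => valueFn lam T F FT m y x t) μ := by
  have := hμ.prob
  have hb : Integrable (fun x : Rn n => valueGrowth c lam T C₀ * (1 + ‖x‖ ^ 2 + moment2 m)) μ :=
    (((integrable_const _).add hμ.moment).add (integrable_const _)).const_mul _
  refine hb.mono' (h.continuous_valueFn_initial hFc).aestronglyMeasurable (ae_of_all _ fun x => ?_)
  rw [h.valueFn_initial]
  exact h.abs_uFormula_le hF hFT x

/-- The optimal cost is differentiable in the initial law, with a quadratic remainder. -/
lemma abs_flowAction_sub_sub_le {m₂ : Measure (Rn n)} {y₂ : Rn n → ℝ → Rn n}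
    (h : RegularFlow c lam T t Φ ΦT F FT m y) (h₂ : RegularFlow c lam T t Φ ΦT F FT m₂ y₂)
    (hFc : ∀ x, Continuous fun s => F (y x s) (law m y s))
    (hF : ∀ m, IsDensity m → ∀ x, |F x m| ≤ C₀ * (1 + ‖x‖ ^ 2 + moment2 m))
    (hFT : ∀ m, IsDensity m → ∀ x, |FT x m| ≤ C₀ * (1 + ‖x‖ ^ 2 + moment2 m)) :
    |flowAction lam T t Φ ΦT F FT m₂ y₂ - flowAction lam T t Φ ΦT F FT m y
      - (∫ x, valueFn lam T F FT m y x t ∂m₂ - ∫ x, valueFn lam T F FT m y x t ∂m)|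
      ≤ (stabConst c lam T + taylorConst c lam T) * W2 m m₂ ^ 2 := by
  have S := h.setting
  have htm : t ∈ Set.Icc t T := ⟨le_rfl, S.t_le⟩
  refine le_mul_W2_sq h.dens h₂.dens (add_nonneg (stabConst_nonneg S) (taylorConst_nonneg S))
    fun γ hγ => ?_
  have := isProbabilityMeasure_of_coupling h.dens hγ
  have hsq := integrable_sub_sq_of_coupling h.dens h₂.dens hγ
  have hu := h.continuous_valueFn_initial hFc
  have i1 := h.integrable_valueFn hFc hF hFT h.dens
  have i2 := h.integrable_valueFn hFc hF hFT h₂.dens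
  obtain ⟨rfl, rfl⟩ := hγ
  have key := h.abs_flowAction_sub_le h₂ measurable_fst measurable_snd
  set m := γ.map Prod.fst
  set u := fun x => valueFn lam T F FT m y x t
  have j1 : Integrable (fun p : Rn n × Rn n => u p.1) γ := i1.comp_measurable measurable_fst
  have j2 : Integrable (fun p : Rn n × Rn n => u p.2) γ := i2.comp_measurable measurable_snd
  have hbound : ∀ p : Rn n × Rn n, |u p.2 - u p.1 - inner ℝ (adjoint T F FT m y p.1 t) (p.2 - p.1)|
      ≤ taylorConst c lam T * ‖p.1 - p.2‖ ^ 2 := fun p => by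
    have := h.abs_valueFn_sub_le hFc p.1 p.2 htm
    rwa [h.invFlow_initial, norm_sub_rev p.2 p.1] at this
  have hz : Continuous fun x => adjoint T F FT m y x t :=
    h.continuous_adjoint.comp (by fun_prop : Continuous fun x : Rn n => (x, t))
  have hmeas : Continuous fun p : Rn n × Rn n =>
      u p.2 - u p.1 - inner ℝ (adjoint T F FT m y p.1 t) (p.2 - p.1) :=
    ((hu.comp continuous_snd).sub (hu.comp continuous_fst)).sub
      ((hz.comp continuous_fst).inner (continuous_snd.sub continuous_fst))
  have jr : Integrable (fun p : Rn n × Rn n =>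
      u p.2 - u p.1 - inner ℝ (adjoint T F FT m y p.1 t) (p.2 - p.1)) γ :=
    (hsq.const_mul (taylorConst c lam T)).mono' hmeas.aestronglyMeasurable (ae_of_all _ hbound)
  have j21 : Integrable (fun p : Rn n × Rn n => u p.2 - u p.1) γ := j2.sub j1
  have j3 : Integrable
      (fun p : Rn n × Rn n => inner ℝ (adjoint T F FT m y p.1 t) (p.2 - p.1)) γ := by
    refine (j21.sub jr).congr (ae_of_all _ fun p => ?_)
    simp only [Pi.sub_apply]
    ring
  have hr : |∫ p, (u p.2 - u p.1 - inner ℝ (adjoint T F FT m y p.1 t) (p.2 - p.1)) ∂γ| ≤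
      taylorConst c lam T * ∫ p, ‖p.1 - p.2‖ ^ 2 ∂γ := by
    rw [← integral_const_mul]
    exact norm_integral_le_of_norm_le (G := ℝ) (hsq.const_mul _) (ae_of_all _ hbound)
  rw [integral_sub j21 j3, integral_sub j2 j1] at hr
  have k1 : ∫ x, u x ∂m = ∫ p, u p.1 ∂γ :=
    integral_map measurable_fst.aemeasurable hu.aestronglyMeasurable
  have k2 : ∫ x, u x ∂(γ.map Prod.snd) = ∫ p, u p.2 ∂γ :=
    integral_map measurable_snd.aemeasurable hu.aestronglyMeasurable
  change |_ - _ - (∫ x, u x ∂(γ.map Prod.snd) - ∫ x, u x ∂m)| ≤ _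
  rw [k1, k2, add_mul]
  have key' := abs_le.1 key
  have hr' := abs_le.1 hr
  exact abs_le.2 ⟨by linarith, by linarith⟩

end RegularFlow

/-! ### The value function -/

section Admissible

variable {lam T t : ℝ} {f h : Rn n → Measure (Rn n) → ℝ} {m : Measure (Rn n)}
  {v x : Rn n → ℝ → Rn n}

lemma IsAdmissible.initial (hv : IsAdmissible T t m v x) (hle : t ≤ T) : ∀ᵐ ξ ∂m, x ξ t = ξ := by
  filter_upwards [hv.ode] with ξ hξ
  simpa using hξ t ⟨le_rfl, hle⟩

lemma IsAdmissible.isRandomPath (hv : IsAdmissible T t m v x) (hle : t ≤ T) :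
    IsRandomPath t T m x (fun ξ s => v (x ξ s) s) where
  measurable_path := hv.measurable_state
  measurable_velocity := hv.measurable_feedback.comp (hv.measurable_state.prodMk measurable_snd)
  energy := hv.energy
  ode := by
    filter_upwards [hv.ode, hv.initial hle] with ξ h1 h2 s hs
    rw [h2]
    exact h1 s hs
  density := hv.density

lemma IsAdmissible.cost_eq (hv : IsAdmissible T t m v x) :
    cost lam T f h t m v x = action lam T t (fun μ => ∫ ξ, f ξ μ ∂μ) (fun μ => ∫ ξ, h ξ μ ∂μ) m x
      (fun ξ s => v (x ξ s) s) := by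
  have he : ∀ s, ∫ ξ, ‖v ξ s‖ ^ 2 ∂(law m x s) = ∫ ξ, ‖v (x ξ s) s‖ ^ 2 ∂m := fun s =>
    integral_map
      (hv.measurable_state.comp (measurable_id.prodMk measurable_const)).aemeasurable
      ((hv.measurable_feedback.comp
        (measurable_id.prodMk measurable_const)).norm.pow_const 2).aestronglyMeasurable
  simp_rw [cost, he]
  rfl

end Admissible

namespace RegularFlow

variable {c lam T t : ℝ} {f h : Rn n → Measure (Rn n) → ℝ} {F FT : Rn n → Measure (Rn n) → ℝ}
  {m : Measure (Rn n)} {y : Rn n → ℝ → Rn n}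

/-- The feedback `-(1/λ) z(y(·, s)⁻¹(x), s)` generates the flow and is admissible. -/
lemma isAdmissible {Φ ΦT : Measure (Rn n) → ℝ} (hy : RegularFlow c lam T t Φ ΦT F FT m y) :
    IsAdmissible T t m (fun x s => -(1 / lam) • adjoint T F FT m y (invFlow y s x) s) y where
  measurable_feedback := ((hy.continuous_adjoint.comp
    (hy.continuous_invFlow.prodMk continuous_snd)).const_smul (-(1 / lam))).measurable
  measurable_state := hy.continuous_uncurry.measurable
  energy := by
    have := hy.dens.prob
    have hid : m.map id = m := Measure.map_id
    have hy' : RegularFlow c lam T t Φ ΦT F FT (m.map id) y := by rwa [hid]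
    have h1 := (hy'.isRandomPath measurable_id).energy
    rw [hid] at h1
    simpa only [hy.invFlow_apply, id_eq] using h1
  ode := ae_of_all _ fun ξ s hs => by
    have h1 := hy.eq_add_integral ξ ⟨le_rfl, hy.setting.t_le⟩ hs
    rw [hy.initial] at h1
    simpa only [hy.invFlow_apply] using h1
  density s _ := hy.density s

/-- The flow is optimal. -/
lemma isLeast_costs
    (hy : RegularFlow c lam T t (fun μ => ∫ ξ, f ξ μ ∂μ) (fun μ => ∫ ξ, h ξ μ ∂μ) F FT m y) :
    IsLeast (costs lam T f h t m) (flowAction lam T t (fun μ => ∫ ξ, f ξ μ ∂μ)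
      (fun μ => ∫ ξ, h ξ μ ∂μ) F FT m y) := by
  constructor
  · refine ⟨_, _, hy.isAdmissible, ?_⟩
    rw [hy.isAdmissible.cost_eq]
    simp only [hy.invFlow_apply, flowAction]
  · rintro _ ⟨v, x, hv, rfl⟩
    have := hy.dens.prob
    have hid : m.map id = m := Measure.map_id
    have hle := hy.setting.t_le
    rw [hv.cost_eq]
    have hy' : RegularFlow c lam T t (fun μ => ∫ ξ, f ξ μ ∂μ) (fun μ => ∫ ξ, h ξ μ ∂μ) F FT
        (m.map id) y := by rwa [hid]
    have h1 := hy'.action_le measurable_id (hv.isRandomPath hle) (hv.initial hle)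
    rw [hid] at h1
    exact h1

lemma V_eq
    (hy : RegularFlow c lam T t (fun μ => ∫ ξ, f ξ μ ∂μ) (fun μ => ∫ ξ, h ξ μ ∂μ) F FT m y) :
    V lam T f h m t = flowAction lam T t (fun μ => ∫ ξ, f ξ μ ∂μ)
      (fun μ => ∫ ξ, h ξ μ ∂μ) F FT m y :=
  hy.isLeast_costs.csInf_eq

end RegularFlow

/-- A quadratic bound for the remainder implies differentiability. -/
lemma HasFunctionalDeriv.of_le_W2_sq {Φ : Measure (Rn n) → ℝ} {m : Measure (Rn n)} {G : Rn n → ℝ}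
    {C : ℝ} (hm : IsDensity m) (hG : ∀ μ, IsDensity μ → Integrable G μ)
    (hΦ : ∀ μ, IsDensity μ →
      |Φ μ - Φ m - (∫ x, G x ∂μ - ∫ x, G x ∂m)| ≤ C * W2 m μ ^ 2) :
    HasFunctionalDeriv Φ m G := by
  refine ⟨hG m hm, fun μ hμ hlim => ⟨fun k => hG _ (hμ k), ?_⟩⟩
  have h1 : (fun k => Φ (μ k) - Φ m - (∫ x, G x ∂(μ k) - ∫ x, G x ∂m))
      =O[atTop] fun k => W2 (μ k) m ^ 2 := by
    refine IsBigO.of_bound C (Eventually.of_forall fun k => ?_)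
    rw [Real.norm_of_nonneg (sq_nonneg (W2 (μ k) m)), W2_comm]
    exact hΦ _ (hμ k)
  exact h1.trans_isLittleO ((isLittleO_pow_id one_lt_two).comp_tendsto hlim)

namespace Assumptions

variable {c C₀ lam T t : ℝ} {f h F FT : Rn n → Measure (Rn n) → ℝ}
  {dF dFT : Rn n → Measure (Rn n) → Rn n → ℝ} {m : Measure (Rn n)}

lemma isPotential (A : Assumptions c C₀ f h F FT dF dFT) :
    IsPotential c (fun μ => ∫ ξ, f ξ μ ∂μ) F :=
  ⟨A.F_deriv, A.F_diff, A.DxF_lipschitz, A.DxF_growth⟩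

lemma isPotential_final (A : Assumptions c C₀ f h F FT dF dFT) :
    IsPotential c (fun μ => ∫ ξ, h ξ μ ∂μ) FT :=
  ⟨A.FT_deriv, A.FT_diff, A.DxFT_lipschitz, A.DxFT_growth⟩

lemma exists_regularFlow (A : Assumptions c C₀ f h F FT dF dFT) (hT : 0 < T)
    (hlam : c * T * (1 + T) < lam) (ht : t ∈ Set.Icc 0 T) (hm : IsDensity m) :
    ∃ y, RegularFlow c lam T t (fun μ => ∫ ξ, f ξ μ ∂μ) (fun μ => ∫ ξ, h ξ μ ∂μ) F FT m y := by
  have S : Setting c lam T t := ⟨hT, hlam, ht, A.isPotential.nonneg hm⟩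
  obtain ⟨y, hy, heq⟩ := exists_isRegular_flow S A.isPotential A.isPotential_final hm
  exact ⟨y, S, A.isPotential, A.isPotential_final, hm, hy, hy.isFlow S hm heq⟩

end Assumptions

end MeanField

/-- `C` depends only on the constants of the problem (and on the dimension), not on the cost
functions, `m` or `t`. -/
theorem mainTheorem3 (n : ℕ) (lam T c C₀ : ℝ) (hT : 0 < T) (hlam : c * T * (1 + T) < lam) :
    ∃ C : ℝ, ∀ (f h F FT : MeanField.Rn n → Measure (MeanField.Rn n) → ℝ)
      (dF dFT : MeanField.Rn n → Measure (MeanField.Rn n) → MeanField.Rn n → ℝ),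
      MeanField.Assumptions c C₀ f h F FT dF dFT →
      ∀ t ∈ Set.Icc 0 T, ∀ m : Measure (MeanField.Rn n), MeanField.IsDensity m →
        -- the infimum that defines the value function is a genuine one
        IsGLB (MeanField.costs lam T f h t m) (MeanField.V lam T f h m t) ∧
        -- the flow `y_{mt}` exists and is unique
        ∃ y : MeanField.Rn n → ℝ → MeanField.Rn n,
          MeanField.IsFlow lam T F FT t m y ∧
          (∀ y', MeanField.IsFlow lam T F FT t m y' →
            ∀ x, ∀ s ∈ Set.Icc t T, y' x s = y x s) ∧
          -- `u = u_{mt}` is the HJB component of the HJB-FP system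
          ∃ u : MeanField.Rn n → ℝ → ℝ,
            MeanField.IsHJBFPSolution lam T F FT t m u (MeanField.law m y) ∧
            (∀ x, u x t = MeanField.uFormula lam T F FT t m y x) ∧
            -- `u_{mt}(·, t)` is the functional derivative of `V(·, t)` at `m`
            MeanField.HasFunctionalDeriv (fun μ => MeanField.V lam T f h μ t) m
              (fun x => u x t) ∧
            -- growth
            (∀ x, |u x t| ≤ C * (1 + ‖x‖ ^ 2 + MeanField.moment2 m)) ∧
            -- quantitative form of the differentiability
            (∀ m₂ : Measure (MeanField.Rn n), MeanField.IsDensity m₂ →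
              |MeanField.V lam T f h m₂ t - MeanField.V lam T f h m t
                - (∫ x, u x t ∂m₂ - ∫ x, u x t ∂m)| ≤ C * MeanField.W2 m m₂ ^ 2) := by
  refine ⟨MeanField.valueGrowth c lam T C₀ +
    (MeanField.stabConst c lam T + MeanField.taylorConst c lam T), ?_⟩
  intro f h F FT dF dFT A t ht m hm
  obtain ⟨y, hy⟩ := A.exists_regularFlow hT hlam ht hm
  have S := hy.setting
  have hFc := hy.continuous_potential_time A.dF_deriv
    (fun μ hμ x => (A.dF_diff μ hμ x).continuous) A.dF_growth
  have c1 := MeanField.valueGrowth_nonneg S C₀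
  have c2 := MeanField.stabConst_nonneg S
  have c3 := MeanField.taylorConst_nonneg S
  have hquad : ∀ m₂ : Measure (MeanField.Rn n), MeanField.IsDensity m₂ →
      |MeanField.V lam T f h m₂ t - MeanField.V lam T f h m t
        - (∫ x, MeanField.valueFn lam T F FT m y x t ∂m₂
          - ∫ x, MeanField.valueFn lam T F FT m y x t ∂m)| ≤
      (MeanField.valueGrowth c lam T C₀ +
        (MeanField.stabConst c lam T + MeanField.taylorConst c lam T)) *
        MeanField.W2 m m₂ ^ 2 := fun m₂ hm₂ => by
    obtain ⟨y₂, hy₂⟩ := A.exists_regularFlow hT hlam ht hm₂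
    rw [hy.V_eq, hy₂.V_eq]
    exact (hy.abs_flowAction_sub_sub_le hy₂ hFc A.F_growth A.FT_growth).trans
      (mul_le_mul_of_nonneg_right (le_add_of_nonneg_left c1) (sq_nonneg _))
  refine ⟨?_, y, hy.flow, fun y' hy' x s hs =>
    hy'.unique S A.isPotential A.isPotential_final hm hy.flow x hs,
    MeanField.valueFn lam T F FT m y, hy.isHJBFPSolution hFc, hy.valueFn_initial,
    .of_le_W2_sq hm (fun μ hμ => hy.integrable_valueFn hFc A.F_growth A.FT_growth hμ) hquad,
    fun x => ?_, hquad⟩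
  · rw [hy.V_eq]
    exact hy.isLeast_costs.isGLB
  · rw [hy.valueFn_initial]
    refine (hy.abs_uFormula_le A.F_growth A.FT_growth x).trans ?_
    have := MeanField.moment2_nonneg m
    gcongr
    linarith
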